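/- **Setting.** For $c>0$, $c\ne1$, let $\mathcal D_c=\{(a,v)\in\mathbb R^2:\ 0<a\le c,\ a+v>c-1\}$ and let $\Delta_c$ be the set of $(a,v)\in\mathcal D_c$ with $v$ between $0$ and $c-1$ (both included). For $(a,v)\in\mathcal D_c$ let $\zeta_{a,v,c}=(F,G)$ be the pair of increasing Möbius maps $$F(z)=\frac{a+cz}{1-vz}\ \text{ on }[-1,0],\qquad G(z)=\frac{a(z-c)}{ac+z(1+v-c)}\ \text{ on }[0,a].$$ Its rotation number $\rho(\zeta_{a,v,c})$ is that of the circle homeomorphism obtained from $F$ on $[-1,-a/c]$ and $G\circ F$ on $[-a/c,0]$ by identifying $-1$ with $0$. Write $[s_0,s_1,\dots]=1/(s_0+1/(s_1+\cdots))$. The height of the pair is the least $k$ with $F^k(-1)\le0<F^{k+1}(-1)$, if it exists; the renormalization $\mathcal R_c(a,v)=(a',v')$ is then defined by the property that $\zeta_{a',v',1/c}$ is the pair $(F^k\circ G,\,F)$ rescaled by $x\mapsto-x/a$. A point of $\mathcal D_c$ is $n$ times renormalizable if it has a height and its renormalization is in $\mathcal D_{1/c}$ and is $n-1$ times renormalizable.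 Let $\mathcal O^n_c$ be the set of $n$ times renormalizable points and $\mathcal T_c=\mathcal R_{1/c}\circ\mathcal R_c$ on $\mathcal O^2_c$. For a sequence $(r_i)_{i\in\mathbb Z}$ of positive integers, let $L_{c,(r_0,r_1,\dots)}$ be the set of points of $\Delta_c$ that are infinitely renormalizable with successive heights $r_0,r_1,\dots$, and let $L_{c,(\dots,r_{-2},r_{-1})}$ be the set of $x\in\Delta_c$ such that for every $k$ there is $y\in\Delta_c\cap\mathcal O^{2k}_c$ with first $2k$ heights $r_{-2k},\dots,r_{-1}$ and $\mathcal T_c^k(y)=x$. **Theorem.** Let $c\in(1/2,2)\setminus\{1\}$, let $p\ge1$, and let $(r_i)_{i\in\mathbb Z}$ be a sequence of positive integers with $r_{i+2p}=r_i$ for all $i$. Then there is a unique point $(a_*,v_*)$ with $\mathcal T_c^p(a_*,v_*)=(a_*,v_*)$ (all these iterates being defined) and $\rho(\zeta_{a_*,v_*,c})=[r_0,r_1,r_2,\dots]$. It is hyperbolic with one stable and one unstable direction: $D\mathcal T_c^p(a_*,v_*)$ has one real eigenvalue of modulus less than $1$ and one of modulus greater than $1$. The sets $L_{c,(r_0,r_1,\dots)}$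 and $L_{c,(\dots,r_{-2},r_{-1})}$ are simple continuous curves, and $$L_{c,(r_0,r_1,\dots)}=W^s(a_*,v_*),\qquad L_{c,(\dots,r_{-2},r_{-1})}=W^u(a_*,v_*).$$ Here $W^s(a_*,v_*)$, the global stable manifold in $\Delta_c$, is the connected component containing $(a_*,v_*)$ of the set of infinitely renormalizable $x\in\Delta_c$ with $|\mathcal T_c^n(x)-\mathcal T_c^n(a_*,v_*)|\to0$ as $n\to\infty$. The global unstable manifold $W^u(a_*,v_*)$ is the connected component containing $(a_*,v_*)$ of the set of $x\in\Delta_c$ that have a backward orbit $x=y_0,y_1,y_2,\dots$ in $\Delta_c$ ($\mathcal T_c(y_{n+1})=y_n$) with $|y_n-z_n|\to0$, where $z_n$ is the point of the cycle of $(a_*,v_*)$ with $\mathcal T_c^n(z_n)=(a_*,v_*)$. -/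

import Mathlib

open Filter Topology

noncomputable section

namespace BreakPair

/-! The parameter `q = (a, v)` is a point of `ℝ × ℝ`. -/

/-- The Möbius map `F_{a,v,c}`. -/
def F (c : ℝ) (q : ℝ × ℝ) (z : ℝ) : ℝ := (q.1 + c * z) / (1 - q.2 * z)

/-- The Möbius map `G_{a,v,c}`. -/
def G (c : ℝ) (q : ℝ × ℝ) (z : ℝ) : ℝ := q.1 * (z - c) / (q.1 * c + z * (1 + q.2 - c))

/-- The parameter domain `𝒟_c`. -/
def D (c : ℝ) : Set (ℝ × ℝ) := {q | 0 < q.1 ∧ q.1 ≤ c ∧ c - 1 < q.1 + q.2}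

/-- The absorbing domain `Δ_c`: `0 ≤ v ≤ c - 1` if `c > 1`, and `c - 1 ≤ v ≤ 0` if `c < 1`. -/
def Del (c : ℝ) : Set (ℝ × ℝ) := {q | q ∈ D c ∧ min 0 (c - 1) ≤ q.2 ∧ q.2 ≤ max 0 (c - 1)}

/-! ### Rotation number -/

/-- The lift to `ℝ` of the circle map `f_{a,v,c}`. The circle `ℝ / ℤ` is identified with `[-1, 0]`,
where the map is `F` on `[-1, -a/c]` and `G ∘ F` on `[-a/c, 0]`; the branch `G ∘ F` has made one
more turn. A real `x` is written as `t + (⌊x⌋ + 1)` with `t ∈ [-1, 0)`. -/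
def lift (c : ℝ) (q : ℝ × ℝ) (x : ℝ) : ℝ :=
  (if Int.fract x - 1 < -q.1 / c then F c q (Int.fract x - 1)
    else G c q (F c q (Int.fract x - 1)) + 1) + (⌊x⌋ + 1)

/-- `ρ` is the rotation number of `f_{a,v,c}`. -/
def HasRotationNumber (c : ℝ) (q : ℝ × ℝ) (ρ : ℝ) : Prop :=
  ∀ x : ℝ, Tendsto (fun n : ℕ => ((lift c q)^[n] x - x) / n) atTop (𝓝 ρ)

/-- The infinite continued fraction `[s₀, s₁, …] = 1 / (s₀ + 1 / (s₁ + ⋯))`. -/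
def contFract (s : ℕ → ℕ) : GenContFract ℝ :=
  ⟨0, Stream'.Seq.ofStream (fun n => ⟨1, (s n : ℝ)⟩)⟩

/-- `ρ(ζ_{a,v,c}) = [s₀, s₁, …]`. -/
def RotationNumberEq (c : ℝ) (q : ℝ × ℝ) (s : ℕ → ℕ) : Prop :=
  ∃ ρ : ℝ, Tendsto (contFract s).convs atTop (𝓝 ρ) ∧ HasRotationNumber c q ρ

/-! ### Renormalization -/

/-- The height of `ζ_{a,v,c}` is `k`: the least `k` with `0 ∈ [F^k (G 0), F^(k+1) (G 0))`.
(Here `G 0 = -1`.) -/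
def HasHeight (c : ℝ) (q : ℝ × ℝ) (k : ℕ) : Prop :=
  IsLeast {k : ℕ | (F c q)^[k] (G c q 0) ≤ 0 ∧ 0 < (F c q)^[k + 1] (G c q 0)} k

/-- The height of `ζ_{a,v,c}` (used only if it exists). -/
def height (c : ℝ) (q : ℝ × ℝ) : ℕ :=
  sInf {k : ℕ | (F c q)^[k] (G c q 0) ≤ 0 ∧ 0 < (F c q)^[k + 1] (G c q 0)}

/-- First map of the pair rescaled by `x ↦ -x / a`: the map `F^k ∘ G` in the new coordinate. -/
def rescaledFst (c : ℝ) (q : ℝ × ℝ) (k : ℕ) (x : ℝ) : ℝ :=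
  -(F c q)^[k] (G c q (-(q.1 * x))) / q.1

/-- Second map of the rescaled pair: the map `F` in the new coordinate. -/
def rescaledSnd (c : ℝ) (q : ℝ × ℝ) (x : ℝ) : ℝ := -F c q (-(q.1 * x)) / q.1

/-- The renormalization operator `ℛ_c`. The new parameters are read off from the rescaled first map
`η`: `a' = η 0`, `b' = -η (-1)`, `b' = (1/c - a') / (v' + 1)`. That the renormalized pair is then
`ζ_{a',v',1/c}` is `F_renorm` and `G_renorm` below. -/
def renorm (c : ℝ) (q : ℝ × ℝ) : ℝ × ℝ :=
  let a' := rescaledFst c q (height c q) 0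
  let b' := -rescaledFst c q (height c q) (-1)
  (a', (1 / c - a' - b') / b')

/-- The pair `ζ_{a,v,c}` is `n` times renormalizable, and the heights of the pair and of its
successive renormalizations are `s 0, …, s (n - 1)`. -/
def HasHeights : ℕ → ℝ → ℝ × ℝ → (ℕ → ℕ) → Prop
  | 0, c, q, _ => q ∈ D c
  | n + 1, c, q, s =>
      q ∈ D c ∧ HasHeight c q (s 0) ∧ HasHeights n (1 / c) (renorm c q) (fun i => s (i + 1))

/-- The set `𝒪^n_c` of `n` times renormalizable parameters. -/
def Ren (n : ℕ) (c : ℝ) : Set (ℝ × ℝ) := {q | ∃ s, HasHeights n c q s}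

/-- The operator `𝒯_c = ℛ_{1/c} ∘ ℛ_c` (meaningful on `𝒪^2_c`). -/
def T (c : ℝ) (q : ℝ × ℝ) : ℝ × ℝ := renorm (1 / c) (renorm c q)

/-- The set `𝒮_{c,(r_{-2k}, …, r_{m-1})}` of points of `Δ_c` that have a past of length `k` under
`𝒯_c : Δ_c ∩ 𝒪^2_c → Δ_c` with the heights `r_{-2k}, …, r_{-1}`, and next heights
`r_0, …, r_{m-1}`. -/
def cyl (c : ℝ) (r : ℤ → ℕ) (k m : ℕ) : Set (ℝ × ℝ) :=
  {q | q ∈ Del c ∧ ∃ y ∈ Del c,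
    HasHeights (2 * k + m) c y (fun i => r ((i : ℤ) - 2 * (k : ℤ))) ∧ (T c)^[k] y = q}

/-- `L_{c,(r_0, r_1, …)}`. -/
def Lfuture (c : ℝ) (r : ℤ → ℕ) : Set (ℝ × ℝ) := ⋂ m : ℕ, cyl c r 0 m

/-- `L_{c,(…, r_{-2}, r_{-1})}`. -/
def Lpast (c : ℝ) (r : ℤ → ℕ) : Set (ℝ × ℝ) := ⋂ k : ℕ, cyl c r k 0

/-! ### Hyperbolic periodic points and their invariant manifolds -/

/-- `z` is `p`-periodic under `𝒯_c`, all iterates being defined. -/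
def IsPeriodic (c : ℝ) (p : ℕ) (z : ℝ × ℝ) : Prop := z ∈ Ren (2 * p) c ∧ (T c)^[p] z = z

/-- The `p`-periodic point `z` of `𝒯_c` is hyperbolic with one stable and one unstable direction:
the differential of `𝒯_c^p` at `z` (a linear map of the plane) has an eigenvalue inside and an
eigenvalue outside of the unit circle. -/
def IsHyperbolic (c : ℝ) (p : ℕ) (z : ℝ × ℝ) : Prop :=
  ∃ A : (ℝ × ℝ) →L[ℝ] (ℝ × ℝ), HasFDerivAt ((T c)^[p]) A z ∧
    ∃ s u : ℝ, |s| < 1 ∧ 1 < |u| ∧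
      Module.End.HasEigenvalue (A : (ℝ × ℝ) →ₗ[ℝ] (ℝ × ℝ)) s ∧
      Module.End.HasEigenvalue (A : (ℝ × ℝ) →ₗ[ℝ] (ℝ × ℝ)) u

/-- Points of `Δ_c` whose forward orbit is infinite and asymptotic to that of `z`. -/
def stableSet (c : ℝ) (z : ℝ × ℝ) : Set (ℝ × ℝ) :=
  {x | x ∈ Del c ∧ (∀ n, x ∈ Ren n c) ∧
    Tendsto (fun n : ℕ => dist ((T c)^[n] x) ((T c)^[n] z)) atTop (𝓝 0)}

/-- Points of `Δ_c` that have a backward orbit in `Δ_c` asymptotic to the backward orbit of the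
`p`-periodic point `z` along its cycle, in which `𝒯_c^{-n} z` is `𝒯_c^{(p-1)n} z`. -/
def unstableSet (c : ℝ) (p : ℕ) (z : ℝ × ℝ) : Set (ℝ × ℝ) :=
  {x | ∃ y : ℕ → ℝ × ℝ, y 0 = x ∧
    (∀ n, y n ∈ Del c) ∧ (∀ n, y (n + 1) ∈ Ren 2 c ∧ T c (y (n + 1)) = y n) ∧
    Tendsto (fun n : ℕ => dist (y n) ((T c)^[(p - 1) * n] z)) atTop (𝓝 0)}

/-- The global stable manifold of `z`. As `𝒯_c` is only piecewise continuous, with infinitely many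
branches, the stable set is a countable union of curves; the manifold is the one through `z`. -/
def Ws (c : ℝ) (z : ℝ × ℝ) : Set (ℝ × ℝ) := connectedComponentIn (stableSet c z) z

/-- The global unstable manifold of `z`, the part through `z` of the unstable set. -/
def Wu (c : ℝ) (p : ℕ) (z : ℝ × ℝ) : Set (ℝ × ℝ) := connectedComponentIn (unstableSet c p z) z

/-- A simple continuous curve: an injective continuous image of a nondegenerate interval. -/
def IsCurve (L : Set (ℝ × ℝ)) : Prop :=
  ∃ (I : Set ℝ) (γ : ℝ → ℝ × ℝ), I.OrdConnected ∧ I.Nontrivial ∧ ContinuousOn γ I ∧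
    Set.InjOn γ I ∧ γ '' I = L

/-! ### The renormalization of `ζ_{a,v,c}` is `ζ_{a',v',1/c}` -/

theorem G_zero {c : ℝ} (hc : 0 < c) {q : ℝ × ℝ} (hq : q ∈ D c) : G c q 0 = -1 := by
  have := hq.1
  simp only [G]
  field_simp
  ring

theorem neg_one_lt {c : ℝ} {q : ℝ × ℝ} (hq : q ∈ D c) : -1 < q.2 := by
  obtain ⟨_, h2, h3⟩ := hq
  linarith

theorem rescaledFst_eq {c : ℝ} (hc : 0 < c) {q : ℝ × ℝ} (hq : q ∈ D c) {x : ℝ}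
    (hx1 : -1 ≤ x) (hx0 : x ≤ 0) :
    ∀ k : ℕ, (∀ j ≤ k, -1 ≤ (F c q)^[j] (-1) ∧ (F c q)^[j] (-1) ≤ 0) →
      rescaledFst c q k x = F (1 / c)
        (-(F c q)^[k] (-1) / q.1, (1 - c - q.2 * (F c q)^[k] (-1)) / c) x := by
  have hv := neg_one_lt hq
  have ha := hq.1
  have key : ∀ X : ℝ, -1 ≤ X → X ≤ 0 → 0 < 1 - q.2 * X ∧ 0 < c - (1 - c - q.2 * X) * x := by
    intro X h1 h0
    have h : 0 < 1 - q.2 * X := by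
      rcases le_total 0 q.2 with h | h <;> nlinarith
    refine ⟨h, ?_⟩
    have e : c - (1 - c - q.2 * X) * x = c * (1 + x) + (1 - q.2 * X) * (-x) := by ring
    rw [e]
    rcases hx0.lt_or_eq with h' | h'
    · have : 0 ≤ c * (1 + x) := by apply mul_nonneg hc.le; linarith
      have : 0 < (1 - q.2 * X) * (-x) := mul_pos h (by linarith)
      linarith
    · rw [h']; linarith
  intro k
  induction k with
  | zero =>
    intro _
    obtain ⟨-, h2⟩ := key (-1) le_rfl (by norm_num)
    simp only [rescaledFst, F, G, Function.iterate_zero, id]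
    have e1 : q.1 * c + -(q.1 * x) * (1 + q.2 - c) = q.1 * (c - (1 - c - q.2 * -1) * x) := by ring
    have e2 : 1 - (1 - c - q.2 * -1) / c * x = (c - (1 - c - q.2 * -1) * x) / c := by field_simp
    rw [e1, e2]
    generalize c - (1 - c - q.2 * -1) * x = U at *
    field_simp
    ring
  | succ k ih =>
    intro hk
    have hk' := ih (fun j hj => hk j (by omega))
    obtain ⟨l1, l2⟩ := hk k (by omega)
    obtain ⟨m1, m2⟩ := hk (k + 1) le_rfl
    simp only [Function.iterate_succ_apply'] at m1 m2 ⊢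
    set X := (F c q)^[k] (-1) with hX
    obtain ⟨hV, hU⟩ := key X l1 l2
    obtain ⟨-, hW⟩ := key _ m1 m2
    have e1 : (F c q)^[k] (G c q (-(q.1 * x))) = -(q.1 * rescaledFst c q k x) := by
      simp only [rescaledFst]; field_simp
    have e2 : rescaledFst c q (k + 1) x = rescaledSnd c q (rescaledFst c q k x) := by
      conv_lhs => rw [rescaledFst, Function.iterate_succ_apply', e1]
      rfl
    rw [e2, hk']
    have hY : F c q X = (q.1 + c * X) / (1 - q.2 * X) := rfl
    have hYV : F c q X * (1 - q.2 * X) = q.1 + c * X := by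
      rw [hY]; exact div_mul_cancel₀ _ hV.ne'
    generalize F c q X = Y at *
    simp only [rescaledSnd, F]
    have d1 : 1 - (1 - c - q.2 * X) / c * x = (c - (1 - c - q.2 * X) * x) / c := by field_simp
    have d2 : 1 - (1 - c - q.2 * Y) / c * x = (c - (1 - c - q.2 * Y) * x) / c := by field_simp
    have d4 : 1 - q.2 * -(q.1 * ((-X / q.1 + 1 / c * x) / ((c - (1 - c - q.2 * X) * x) / c)))
        = (1 - q.2 * X) * (c - (1 - c - q.2 * Y) * x) / (c - (1 - c - q.2 * X) * x) := by
      rw [eq_div_iff hU.ne']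
      have : q.1 * ((-X / q.1 + 1 / c * x) / ((c - (1 - c - q.2 * X) * x) / c))
          = (q.1 * x - c * X) / (c - (1 - c - q.2 * X) * x) := by
        generalize c - (1 - c - q.2 * X) * x = U at *
        field_simp
        ring
      rw [this]
      have h3 : (q.1 * x - c * X) / (c - (1 - c - q.2 * X) * x) * (c - (1 - c - q.2 * X) * x)
          = q.1 * x - c * X := div_mul_cancel₀ _ hU.ne'
      linear_combination q.2 * h3 - q.2 * x * hYV
    rw [d2, d1, d4]
    have d5 : q.1 + c * -(q.1 * ((-X / q.1 + 1 / c * x) / ((c - (1 - c - q.2 * X) * x) / c)))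
        = (1 - q.2 * X) * (c * Y - q.1 * x) / (c - (1 - c - q.2 * X) * x) := by
      rw [eq_div_iff hU.ne']
      have : q.1 * ((-X / q.1 + 1 / c * x) / ((c - (1 - c - q.2 * X) * x) / c))
          = (q.1 * x - c * X) / (c - (1 - c - q.2 * X) * x) := by
        generalize c - (1 - c - q.2 * X) * x = U at *
        field_simp
        ring
      rw [this]
      have h3 : (q.1 * x - c * X) / (c - (1 - c - q.2 * X) * x) * (c - (1 - c - q.2 * X) * x)
          = q.1 * x - c * X := div_mul_cancel₀ _ hU.ne'
      linear_combination -c * h3 - c * hYV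
    rw [d5]
    generalize 1 - q.2 * X = V at *
    generalize c - (1 - c - q.2 * X) * x = U at *
    generalize c - (1 - c - q.2 * Y) * x = W at *
    field_simp
    ring

theorem renorm_eq {c : ℝ} (hc : 0 < c) {q : ℝ × ℝ} (hq : q ∈ D c) {k : ℕ} (hk : HasHeight c q k) :
    (∀ j ≤ k, -1 ≤ (F c q)^[j] (-1) ∧ (F c q)^[j] (-1) ≤ 0) ∧ height c q = k ∧
      renorm c q = (-(F c q)^[k] (-1) / q.1, (1 - c - q.2 * (F c q)^[k] (-1)) / c) := by
  have hh : height c q = k := hk.csInf_eq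
  have hv := neg_one_lt hq
  have ha := hq.1
  obtain ⟨⟨k1, k2⟩, k3⟩ := hk
  rw [G_zero hc hq] at k1 k2
  have hb : ∀ j ≤ k, -1 ≤ (F c q)^[j] (-1) ∧ (F c q)^[j] (-1) ≤ 0 := by
    intro j
    induction j with
    | zero => intro _; simp
    | succ j ih =>
      intro hj
      obtain ⟨i1, i2⟩ := ih (by omega)
      have hle : (F c q)^[j + 1] (-1) ≤ 0 := by
        by_contra hcon
        have : j ∈ {k : ℕ | (F c q)^[k] (G c q 0) ≤ 0 ∧ 0 < (F c q)^[k + 1] (G c q 0)} := by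
          rw [Set.mem_ofPred_eq, G_zero hc hq]
          exact ⟨i2, not_le.1 hcon⟩
        have := k3 this
        omega
      refine ⟨?_, hle⟩
      rw [Function.iterate_succ_apply']
      have hV : 0 < 1 - q.2 * (F c q)^[j] (-1) := by
        rcases le_total 0 q.2 with h | h <;> nlinarith
      simp only [F]
      change -1 ≤ (q.1 + c * (F c q)^[j] (-1)) / (1 - q.2 * (F c q)^[j] (-1))
      rw [le_div_iff₀ hV]
      obtain ⟨-, h2, h3⟩ := hq
      nlinarith
  refine ⟨hb, hh, ?_⟩
  have f0 := rescaledFst_eq hc hq (x := 0) (by norm_num) le_rfl k hb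
  have f1 := rescaledFst_eq hc hq (x := -1) le_rfl (by norm_num) k hb
  obtain ⟨i1, i2⟩ := hb k le_rfl
  rw [Function.iterate_succ_apply'] at k2
  have hV : 0 < 1 - q.2 * (F c q)^[k] (-1) := by
    rcases le_total 0 q.2 with h | h <;> nlinarith
  simp only [renorm, hh, f0, f1]
  generalize (F c q)^[k] (-1) = X at *
  have hpos : 0 < q.1 + c * X := by
    have : 0 < (q.1 + c * X) / (1 - q.2 * X) := k2
    rcases div_pos_iff.1 this with h | h
    · exact h.1
    · exact absurd h.2 (not_lt.2 hV.le)
  simp only [F]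
  ext
  · simp
  · have e : 1 - (1 - c - q.2 * X) / c * -1 = (1 - q.2 * X) / c := by field_simp; ring
    have e2 : -((-X / q.1 + 1 / c * -1) / ((1 - q.2 * X) / c))
        = (q.1 + c * X) / (q.1 * (1 - q.2 * X)) := by
      field_simp
      ring
    simp only [mul_zero, add_zero, sub_zero, div_one]
    rw [e, e2]
    generalize hVe : 1 - q.2 * X = V at *
    have hn := hpos.ne'
    rw [div_eq_iff (by positivity)]
    field_simp
    subst hVe
    ring

theorem F_renorm {c : ℝ} (hc : 0 < c) {q : ℝ × ℝ} (hq : q ∈ D c) {k : ℕ} (hk : HasHeight c q k)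
    {x : ℝ} (hx1 : -1 ≤ x) (hx0 : x ≤ 0) :
    F (1 / c) (renorm c q) x = rescaledFst c q k x := by
  obtain ⟨hb, -, hr⟩ := renorm_eq hc hq hk
  rw [hr, rescaledFst_eq hc hq hx1 hx0 k hb]

theorem G_renorm {c : ℝ} (hc : 0 < c) {q : ℝ × ℝ} (hq : q ∈ D c) {k : ℕ} (hk : HasHeight c q k)
    (ha' : 0 < (renorm c q).1) (x : ℝ) :
    G (1 / c) (renorm c q) x = rescaledSnd c q x := by
  obtain ⟨hb, -, hr⟩ := renorm_eq hc hq hk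
  have ha := hq.1
  rw [hr] at ha' ⊢
  generalize (F c q)^[k] (-1) = X at *
  simp only [G, rescaledSnd, F] at ha' ⊢
  have hX : X < 0 := by
    rcases div_pos_iff.1 ha' with h | h
    · linarith [h.1]
    · exact absurd h.2 (not_lt.2 ha.le)
  have e : -X / q.1 * (1 / c) + x * (1 + (1 - c - q.2 * X) / c - 1 / c)
      = (-X / (q.1 * c)) * (1 - q.2 * -(q.1 * x)) := by
    field_simp
    ring
  rw [e]
  rcases eq_or_ne (1 - q.2 * -(q.1 * x)) 0 with h | h
  · rw [h]; simp
  · have hX' := hX.ne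
    generalize 1 - q.2 * -(q.1 * x) = V at *
    field_simp
    ring

end BreakPair

end

noncomputable section

namespace BreakPair

/-! The renormalization is a deformation of the natural extension of the Gauss map. On the part v ≠
0 of Δ_c take the coordinates x = a/c and y = c(c-1-v)/(av), and follow the orbit of -1 in the
coordinate ξ = -cz/a. One step of height k becomes a relation `Link` between (x, y) and (x', y'),
carried by a `Block` with ξ_0 = 1/x, ξ_k = x' and 1/ω = ξ_0 + y. With δ = 1 - 1/c replaced by 0 it
would read x = 1/(k + x'), y' = 1/(k + y).

Two features of that model survive. The reversal ξ_j ↦ 1/ω - ξ_{k-j} of a block turns a link from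
(x, y) to (x', y') into a link from (y', x') to (y, x) (`Block.reverse`, `Link.symm`), so past and
future play the same role up to exchanging c and 1/c. And in cross form, as a map (x', y) ↦ (x, y'),
the relation contracts the distance |log(1+x) - log(1+u)| in the maximum norm (`Block.contract`,
`Link.contract`), at a rate `lrate c` < 1 that is the same for c and 1/c. The bounds 1/2 < c < 2 are
used for this contraction.

The contraction carries the dynamics. A fixed point argument on two-sided sequences (`exists_orbit`)
gives orbits with prescribed heights; if the heights are periodic, so is the orbit (`exists_cycle`).
Two points with the same infinite future satisfy ld(x, x') ≤ κ ld(y, y'), and their y-distance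
decays geometrically (`cross_future`); hence the points with 0 ≤ y ≤ 1 and given future heights form
a graph over y (`exists_stable_graph`). By time reversal the points with a given past form a graph
over x. A point of Δ_c may also have y > 1 or v = 0, so the full future curve is the pull-back of a
graph by one renormalization (`isCurve_Lfuture`).

Both curves are connected and consist of asymptotic points, so they lie in W^s and W^u. Conversely
heights are constant on connected sets of renormalizable points (`heights_const`), so these
components cannot leave the curves. The cross inequalities pass to the differential as a cone
condition, which forces one eigenvalue on each side of the unit circle (`exists_eigenvalues`).

For the rotation number, the maps of the n-th renormalization are semiconjugate to words f^q - p in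
the lift f, with p/q the convergents of [s_0, s_1, …] for the heights s_i (`exists_semi`); the signs
of their displacements identify the rotation number. Hence heights can be read off from it, and two
periodic points with the same heights, which must lie in Δ_c, coincide by the contraction. -/

/-! ### Orbit blocks and their reversal -/

/-- The orbit `-1, F (-1), …, F^k (-1)` in the coordinate `ξ = -z / x`, where `x = a / c`,
`ω = a v / (c (c - 1))` and `δ = 1 - 1 / c`. -/
structure Block (δ ω : ℝ) (k : ℕ) (ξ : ℕ → ℝ) : Prop where
  nonneg : ∀ j ≤ k, 0 ≤ ξ j
  le : ∀ j ≤ k, ω * ξ j ≤ 1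
  step : ∀ j < k, ξ j = ξ (j + 1) + 1 - δ * ξ (j + 1) * (1 - ω * ξ j)

theorem Block.lower {δ ω : ℝ} {k : ℕ} {ξ : ℕ → ℝ} (h : Block δ ω k ξ) (hω : 0 ≤ ω)
    (hδ : δ ≤ 1 / 2) {j : ℕ} (hj : j < k) : 1 + ξ (j + 1) / 2 ≤ ξ j := by
  have h1 := h.nonneg j hj.le
  have h2 := h.nonneg (j + 1) hj
  have h3 := h.le j hj.le
  have h4 := h.step j hj
  have h5 : 0 ≤ ω * ξ j := mul_nonneg hω h1
  have h6 : δ * (ξ (j + 1) * (1 - ω * ξ j)) ≤ 1 / 2 * (ξ (j + 1) * (1 - ω * ξ j)) :=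
    mul_le_mul_of_nonneg_right hδ (mul_nonneg h2 (by linarith))
  have h7 : ξ (j + 1) * (1 - ω * ξ j) ≤ ξ (j + 1) * 1 :=
    mul_le_mul_of_nonneg_left (by linarith) h2
  nlinarith

/-- Reversing time together with ξ ↦ 1/ω - ξ exchanges the factors ξ_{j+1} and 1 - ω ξ_j of the
nonlinear term up to the scale ω, so the recursion is preserved. This is the source of the symmetry
between past and future. -/
theorem Block.reverse {δ ω : ℝ} {k : ℕ} {ξ : ℕ → ℝ} (h : Block δ ω k ξ) (hω : 0 < ω) :
    Block δ ω k (fun j => 1 / ω - ξ (k - j)) where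
  nonneg j hj := by
    have := h.le (k - j) (by omega)
    rw [sub_nonneg, le_div_iff₀ hω]; linarith
  le j hj := by
    have := h.nonneg (k - j) (by omega)
    have : ω * (1 / ω - ξ (k - j)) = 1 - ω * ξ (k - j) := by field_simp
    rw [this]; nlinarith
  step j hj := by
    obtain ⟨i, rfl⟩ : ∃ i, k = j + 1 + i := ⟨k - j - 1, by omega⟩
    have := h.step i (by omega)
    have e1 : j + 1 + i - j = i + 1 := by omega
    have e2 : j + 1 + i - (j + 1) = i := by omega
    simp only [e1, e2]
    have e3 : 1 - ω * (1 / ω - ξ (i + 1)) = ω * ξ (i + 1) := by field_simp; ring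
    rw [e3]
    have e4 : δ * (1 / ω - ξ i) * (ω * ξ (i + 1)) = δ * ξ (i + 1) * (1 - ω * ξ i) := by
      field_simp
    rw [e4]; linarith

/-- Subtracting two consecutive steps expresses each difference as a positive multiple of the next
one, so the sign propagates backwards from the last difference, which is positive because ξ_k ≤ 1.
The case j = 0 yields the inequality a + v > c - 1 in `Block.height`. -/
theorem Block.strictAnti {δ ω : ℝ} {k : ℕ} {ξ : ℕ → ℝ} (h : Block δ ω k ξ) (hω : 0 ≤ ω)
    (hδ : δ ≤ 1 / 2) (hs : ξ k ≤ 1) {j : ℕ} (hj : j < k) : ξ (j + 1) < ξ j := by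
  obtain ⟨i, rfl⟩ : ∃ i, k = j + 1 + i := ⟨k - j - 1, by omega⟩
  induction i generalizing j with
  | zero =>
    have := h.lower hω hδ hj
    simp only [add_zero] at *
    have := h.nonneg (j + 1) le_rfl
    linarith
  | succ i ih =>
    have e : j + 1 + (i + 1) = j + 1 + 1 + i := by omega
    rw [e] at h hs
    have h1 := ih h hs (j := j + 1) (by omega)
    have h2 := h.step j (by omega)
    have h3 := h.step (j + 1) (by omega)
    have n1 := h.nonneg (j + 1) (by omega)
    have n2 := h.nonneg (j + 2) (by omega)
    have n0 := h.nonneg j (by omega)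
    have l1 := h.le (j + 1) (by omega)
    have l2 := h.le (j + 2) (by omega)
    have l0 := h.le j (by omega)
    set a := ξ j
    set b := ξ (j + 1)
    set d := ξ (j + 1 + 1)
    have p1 : 0 < 1 - δ * (ω * b) := by
      have : 0 ≤ ω * b := mul_nonneg hω n1
      nlinarith
    have p2 : 0 ≤ ω * d := mul_nonneg hω n2
    -- subtract the two steps
    have key : (a - b) * (1 - δ * (ω * b)) = (b - d) * (1 - δ * (1 - ω * b)) := by
      linear_combination h2 - h3
    have p3 : 0 < 1 - δ * (1 - ω * b) := by
      have : 0 ≤ ω * b := mul_nonneg hω n1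
      nlinarith
    have : 0 < (a - b) * (1 - δ * (ω * b)) := by
      rw [key]; exact mul_pos (by linarith) p3
    have := (pos_iff_pos_of_mul_pos this).2 p1
    linarith

/-! ### Comparison of two blocks -/

/-- For d = -δ ≥ 0 one backward step is ξ = S(1 + (1+d)s)/(S + ds) with S = 1/ω. It is increasing in
s and S, and sublinear after the shifts 1 + ξ, 1 + s and S + 2, so a common ratio L is not exceeded.
-/
theorem neg_step_mono {d S S' s s' ξ ξ' L : ℝ} (hd0 : 0 ≤ d) (hd1 : d ≤ 1) (hL : 1 ≤ L)
    (hs : 0 ≤ s) (hs' : 0 ≤ s') (hξ : 1 + s ≤ ξ) (hS : ξ ≤ S) (hS1 : 1 ≤ S')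
    (h : S * (ξ - s - 1) = d * s * (S - ξ)) (h' : S' * (ξ' - s' - 1) = d * s' * (S' - ξ'))
    (hSS : S' + 2 ≤ L * (S + 2)) (hss : 1 + s' ≤ L * (1 + s)) : 1 + ξ' ≤ L * (1 + ξ) := by
  have e' : ξ' = S' * (1 + (1 + d) * s') / (S' + d * s') := by
    rw [eq_div_iff (by positivity)]; linear_combination h'
  -- `S2` and `s2` are the largest values allowed for S' and s'. Monotonicity in s, then in S,
  -- reduces the claim to these extremes, where it is the scaling estimate `a3`.
  set S2 := L * (S + 2) - 2 with hS2
  set s2 := L * (1 + s) - 1 with hs2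
  have hS2' : 0 < S2 := by nlinarith
  have hs2' : 0 ≤ s2 := by nlinarith
  have a1 : S' * (1 + (1 + d) * s') / (S' + d * s') ≤ S' * (1 + (1 + d) * s2) / (S' + d * s2) := by
    rw [div_le_div_iff₀ (by positivity) (by positivity)]
    have : 0 ≤ S' * ((s2 - s') * ((1 + d) * S' - d)) := by
      apply mul_nonneg (by linarith)
      apply mul_nonneg (by linarith)
      nlinarith
    nlinarith
  have a2 : S' * (1 + (1 + d) * s2) / (S' + d * s2) ≤ S2 * (1 + (1 + d) * s2) / (S2 + d * s2) := by
    rw [div_le_div_iff₀ (by positivity) (by positivity)]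
    have : 0 ≤ (1 + (1 + d) * s2) * ((S2 - S') * (d * s2)) := by
      apply mul_nonneg (by positivity)
      apply mul_nonneg (by linarith)
      positivity
    nlinarith
  have a3 : S2 * (1 + (1 + d) * s2) / (S2 + d * s2) ≤ L * (1 + ξ) - 1 := by
    rw [div_le_iff₀ (by positivity)]
    obtain ⟨b, rfl⟩ : ∃ b, L = 1 + b := ⟨L - 1, by ring⟩
    have hb : 0 ≤ b := by linarith
    obtain ⟨t, rfl⟩ : ∃ t, S = ξ + t := ⟨S - ξ, by ring⟩
    obtain ⟨m, rfl⟩ : ∃ m, ξ = s + m := ⟨ξ - s, by ring⟩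
    have ht : 0 ≤ t := by linarith
    have hm : 0 ≤ m - 1 := by linarith
    have key : 0 ≤ 2 * (1 + b) * b * (m - 1) + b * (1 + b) * (m + (1 - d) * (s + t))
        + (2 - d) * b ^ 2 := by
      have : 0 ≤ 1 - d := by linarith
      have : 0 ≤ 2 - d := by linarith
      have : 0 ≤ m := by linarith
      positivity
    rw [hS2, hs2]
    have : ((1 + b) * (1 + (s + m)) - 1) * ((1 + b) * (s + m + t + 2) - 2
          + d * ((1 + b) * (1 + s) - 1))
        - ((1 + b) * (s + m + t + 2) - 2) * (1 + (1 + d) * ((1 + b) * (1 + s) - 1))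
        = 2 * (1 + b) * b * (m - 1) + b * (1 + b) * (m + (1 - d) * (s + t)) + (2 - d) * b ^ 2 := by
      linear_combination (1 + b) ^ 2 * h
    linarith
  rw [e']
  linarith

/-- One step written symmetrically: s = ξ_1, t = 1/ω - ξ_0, and m = ξ_0 - ξ_1 solves (m - 1)(m + s +
t) = d s t. The solution grows with s and t; the gain (1 - d)(L - 1) over plain scaling is what
later turns non-expansion into contraction. -/
theorem neg_cross_strict {d s s' t t' m m' L : ℝ} (hd0 : 0 ≤ d) (hL : 1 ≤ L)
    (hs : 0 ≤ s) (hs' : 0 ≤ s') (ht : 0 ≤ t) (ht' : 0 ≤ t') (hm : 1 ≤ m)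
    (h : (m - 1) * (m + s + t) = d * s * t) (h' : (m' - 1) * (m' + s' + t') = d * s' * t')
    (hss : 1 + s' ≤ L * (1 + s)) (htt : 1 + t' ≤ L * (1 + t)) :
    m' ≤ L * m - (1 - d) * (L - 1) := by
  by_contra hcon
  push Not at hcon
  obtain ⟨b, rfl⟩ : ∃ b, L = 1 + b := ⟨L - 1, by ring⟩
  have hb : 0 ≤ b := by linarith
  -- `n` is the claimed bound and `u`, `w` are the largest allowed s', t'. By `c2` the left side of
  -- the equation at (n, u, w) already dominates the right side, so a solution m' > n with s' ≤ u,
  -- t' ≤ w is impossible.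
  set n := (1 + b) * m - (1 - d) * (1 + b - 1) with hn
  set u := (1 + b) * s + b with hu
  set w := (1 + b) * t + b with hw
  have hu' : s' ≤ u := by linarith
  have hw' : t' ≤ w := by linarith
  have hu0 : 0 ≤ u := by positivity
  have hw0 : 0 ≤ w := by positivity
  have hn1 : 1 ≤ n := by nlinarith
  have c1 : s' * t' * (n + u + w) ≤ u * w * (m' + s' + t') := by
    have i1 : s' * t' ≤ u * w := mul_le_mul hu' hw' ht' hu0
    have i2 : s' * t' * n ≤ u * w * m' := mul_le_mul i1 hcon.le (by linarith) (by positivity)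
    have i3 : s' * u * t' ≤ s' * u * w := mul_le_mul_of_nonneg_left hw' (by positivity)
    have i4 : t' * w * s' ≤ t' * w * u := mul_le_mul_of_nonneg_left hu' (by positivity)
    nlinarith
  have c2 : d * (u * w) ≤ (n - 1) * (n + u + w) := by
    have hm0 : 0 ≤ m - 1 := by linarith
    have key : 0 ≤ (1 + d) * (1 + b) * b * (m - 1) + d * b * (1 + b) * m + d ^ 2 * b ^ 2 := by
      positivity
    rw [hn, hu, hw]
    have : ((1 + b) * m - (1 - d) * (1 + b - 1) - 1) * ((1 + b) * m - (1 - d) * (1 + b - 1)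
          + ((1 + b) * s + b) + ((1 + b) * t + b)) - d * (((1 + b) * s + b) * ((1 + b) * t + b))
        = (1 + d) * (1 + b) * b * (m - 1) + d * b * (1 + b) * m + d ^ 2 * b ^ 2 := by
      linear_combination (1 + b) ^ 2 * h
    linarith
  have pos1 : 0 < n + u + w := by linarith
  have pos2 : 0 < m' + s' + t' := by linarith
  have c3 : (m' - 1) * (m' + s' + t') * (n + u + w) ≤ (n - 1) * (n + u + w) * (m' + s' + t') := by
    rw [h']
    calc d * s' * t' * (n + u + w) = d * (s' * t' * (n + u + w)) := by ring
      _ ≤ d * (u * w * (m' + s' + t')) := mul_le_mul_of_nonneg_left c1 hd0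
      _ = d * (u * w) * (m' + s' + t') := by ring
      _ ≤ _ := mul_le_mul_of_nonneg_right c2 pos2.le
  have : (m' - 1 - (n - 1)) * ((m' + s' + t') * (n + u + w)) ≤ 0 := by linarith
  have := mul_pos (show 0 < m' - 1 - (n - 1) by linarith) (mul_pos pos2 pos1)
  linarith

/-- For δ ≥ 0 additive errors replace ratios: if S grows by at least A while s grows by at most A,
one backward step increases ξ by at most A. -/
theorem pos_step_mono {δ S S' s s' ξ ξ' A : ℝ} (h0 : 0 ≤ δ) (h1 : δ ≤ 1 / 2) (hA : 0 ≤ A)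
    (hs : 0 ≤ s) (hsS : s ≤ S) (hξ : ξ ≤ S) (hS0 : 0 < S)
    (h : S * (ξ - s - 1) = -δ * s * (S - ξ)) (h' : S' * (ξ' - s' - 1) = -δ * s' * (S' - ξ'))
    (hSS : S + A ≤ S') (hss : s' ≤ s + A) : ξ' ≤ ξ + A := by
  have hS' : 0 < S' := by linarith
  have hden' : 0 < S' - δ * s' := by nlinarith
  have e' : ξ' = S' * (1 + (1 - δ) * s') / (S' - δ * s') := by
    rw [eq_div_iff hden'.ne']; linear_combination h'
  have hden2 : 0 < S' - δ * (s + A) := by nlinarith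
  have hden3 : 0 < S + A - δ * (s + A) := by nlinarith
  have hδ' : 0 ≤ 1 - δ := by linarith
  have a1 : S' * (1 + (1 - δ) * s') / (S' - δ * s')
      ≤ S' * (1 + (1 - δ) * (s + A)) / (S' - δ * (s + A)) := by
    apply div_le_div₀ (by positivity) _ hden2 (by nlinarith)
    apply mul_le_mul_of_nonneg_left _ hS'.le
    nlinarith
  have a2 : S' * (1 + (1 - δ) * (s + A)) / (S' - δ * (s + A))
      ≤ (S + A) * (1 + (1 - δ) * (s + A)) / (S + A - δ * (s + A)) := by
    rw [div_le_div_iff₀ hden2 hden3]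
    have : 0 ≤ (1 + (1 - δ) * (s + A)) * ((S' - (S + A)) * (δ * (s + A))) := by
      apply mul_nonneg (by positivity)
      apply mul_nonneg (by linarith)
      positivity
    nlinarith
  have a3 : (S + A) * (1 + (1 - δ) * (s + A)) / (S + A - δ * (s + A)) ≤ ξ + A := by
    rw [div_le_iff₀ hden3]
    -- `ξ - s - 1 + δ (S - ξ) ≥ 0`
    have k1 : 0 ≤ S * (ξ - s - 1 + δ * (S - ξ)) := by
      have : S * (ξ - s - 1 + δ * (S - ξ)) = δ * (S - ξ) * (S - s) := by linear_combination h
      rw [this]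
      apply mul_nonneg (mul_nonneg h0 (by linarith)) (by linarith)
    have k2 : 0 ≤ ξ - s - 1 + δ * (S - ξ) := nonneg_of_mul_nonneg_right k1 hS0
    nlinarith [mul_nonneg hA k2]
  rw [e']
  linarith

theorem Block.stepS {δ ω : ℝ} {k : ℕ} {ξ : ℕ → ℝ} (h : Block δ ω k ξ) (hω : 0 < ω) {j : ℕ}
    (hj : j < k) : 1 / ω * (ξ j - ξ (j + 1) - 1) = -δ * ξ (j + 1) * (1 / ω - ξ j) := by
  have := h.step j hj
  field_simp
  linear_combination this

theorem Block.leS {δ ω : ℝ} {k : ℕ} {ξ : ℕ → ℝ} (h : Block δ ω k ξ) (hω : 0 < ω) {j : ℕ}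
    (hj : j ≤ k) : ξ j ≤ 1 / ω := by
  rw [le_div_iff₀ hω]; linarith [h.le j hj]

theorem Block.lower_neg {δ ω : ℝ} {k : ℕ} {ξ : ℕ → ℝ} (h : Block δ ω k ξ)
    (hδ : δ ≤ 0) {j : ℕ} (hj : j < k) : 1 + ξ (j + 1) ≤ ξ j := by
  have h2 := h.nonneg (j + 1) hj
  have h3 := h.le j hj.le
  have h4 := h.step j hj
  have : 0 ≤ -δ * (ξ (j + 1) * (1 - ω * ξ j)) :=
    mul_nonneg (by linarith) (mul_nonneg h2 (by linarith))
  nlinarith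

section compare

variable {δ ω ω' : ℝ} {k : ℕ} {ξ ξ' : ℕ → ℝ}

/-- Negative `δ`: the sum `1 / ω = ξ_0 + t` scales sublinearly. -/
theorem Block.neg_compare (h : Block δ ω k ξ) (h' : Block δ ω' k ξ') (hω : 0 < ω) (hω' : 0 < ω')
    (hδ0 : δ ≤ 0) (hδ1 : -1 ≤ δ) (hk : 1 ≤ k) {L : ℝ} (hL : 1 ≤ L)
    (hs : 1 + ξ' k ≤ L * (1 + ξ k))
    (ht : 1 + (1 / ω' - ξ' 0) ≤ L * (1 + (1 / ω - ξ 0))) :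
    1 + ξ' 1 ≤ L * (1 + ξ 1) := by
  have chain : ∀ M, L ≤ M → 1 / ω' + 2 ≤ M * (1 / ω + 2) → ∀ i j, j + i = k →
      1 + ξ' j ≤ M * (1 + ξ j) := by
    intro M hLM hM i
    induction i with
    | zero =>
      intro j hj
      have : j = k := by omega
      subst this
      have := h.nonneg j le_rfl
      nlinarith
    | succ i ih =>
      intro j hj
      have hjk : j < k := by omega
      refine neg_step_mono (d := -δ) (S := 1 / ω) (S' := 1 / ω') (by linarith) (by linarith)
        (hL.trans hLM) (h.nonneg (j + 1) hjk) (h'.nonneg (j + 1) hjk) (h.lower_neg hδ0 hjk)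
        (h.leS hω hjk.le) ?_ (h.stepS hω hjk) (h'.stepS hω' hjk) hM (ih (j + 1) (by omega))
      have := h'.lower_neg hδ0 hjk
      have := h'.leS hω' hjk.le
      have := h'.nonneg (j + 1) hjk
      linarith
  have hS0 : 0 < 1 / ω := by positivity
  by_cases hM : 1 / ω' + 2 ≤ L * (1 / ω + 2)
  · exact chain L le_rfl hM (k - 1) 1 (by omega)
  · exfalso
    push Not at hM
    -- If 1/ω grows by more than the ratio L, take its actual ratio M > L. The chain then bounds
    -- ξ'_0 with ratio M, while t' = 1/ω' - ξ'_0 has the smaller ratio L; their sum contradicts the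
    -- definition of M.
    set M := (1 / ω' + 2) / (1 / ω + 2) with hMdef
    have e : M * (1 / ω + 2) = 1 / ω' + 2 := div_mul_cancel₀ _ (by positivity)
    have hLM : L < M := by
      rw [hMdef, lt_div_iff₀ (by positivity)]; exact hM
    have c := chain M hLM.le e.ge k 0 (by omega)
    have t0 := h.leS hω (Nat.zero_le k)
    have : L * (1 + (1 / ω - ξ 0)) < M * (1 + (1 / ω - ξ 0)) :=
      mul_lt_mul_of_pos_right hLM (by linarith)
    nlinarith

/-- `neg_compare` carries the ratio back to ξ_1. The first step is then treated symmetrically in ξ_1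
and t by `neg_cross_strict`, and the bounds for ξ'_1 and m' = ξ'_0 - ξ'_1 add up to the claim. -/
theorem Block.neg_contract (h : Block δ ω k ξ) (h' : Block δ ω' k ξ') (hω : 0 < ω) (hω' : 0 < ω')
    (hδ0 : δ ≤ 0) (hδ1 : -1 ≤ δ) (hk : 1 ≤ k) {b : ℝ} (hb : 0 ≤ b)
    (hs : 1 + ξ' k ≤ (1 + b) * (1 + ξ k))
    (ht : 1 + (1 / ω' - ξ' 0) ≤ (1 + b) * (1 + (1 / ω - ξ 0))) :
    ξ' 0 - ξ 0 ≤ b * (ξ 0 - δ) := by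
  have c := h.neg_compare h' hω hω' hδ0 hδ1 hk (by linarith) hs ht
  have l0 := h.lower_neg hδ0 (j := 0) (by omega)
  have l0' := h'.lower_neg hδ0 (j := 0) (by omega)
  have e := h.stepS hω (j := 0) (by omega)
  have e' := h'.stepS hω' (j := 0) (by omega)
  simp only [zero_add] at *
  have := neg_cross_strict (d := -δ) (s := ξ 1) (s' := ξ' 1) (t := 1 / ω - ξ 0)
    (t' := 1 / ω' - ξ' 0) (m := ξ 0 - ξ 1) (m' := ξ' 0 - ξ' 1) (L := 1 + b) (by linarith)
    (by linarith) (h.nonneg 1 hk) (h'.nonneg 1 hk)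
    (by have := h.leS hω (Nat.zero_le k); linarith)
    (by have := h'.leS hω' (Nat.zero_le k); linarith) (by linarith)
    (by linear_combination e) (by linear_combination e') c ht
  linarith

/-- Positive `δ`. -/
theorem Block.pos_compare (h : Block δ ω k ξ) (h' : Block δ ω' k ξ') (hω : 0 < ω) (hω' : 0 < ω')
    (hδ0 : 0 ≤ δ) (hδ1 : δ ≤ 1 / 2) {A B : ℝ} (hA : 0 ≤ A) (hB : 0 ≤ B)
    (hs : ξ' k ≤ ξ k + A) (ht : 1 / ω - ξ 0 ≤ 1 / ω' - ξ' 0 + B) : ξ' 0 ≤ ξ 0 + A + B := by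
  by_contra hcon
  push Not at hcon
  -- Should the bound fail, 1/ω would grow by at least A, so the errors would propagate back through
  -- the whole block without growing: ξ'_0 ≤ ξ_0 + A, a contradiction.
  have hS : 1 / ω + A ≤ 1 / ω' := by linarith
  have chain : ∀ i j, j + i = k → ξ' j ≤ ξ j + A := by
    intro i
    induction i with
    | zero =>
      intro j hj
      have : j = k := by omega
      subst this
      exact hs
    | succ i ih =>
      intro j hj
      have hjk : j < k := by omega
      exact pos_step_mono hδ0 hδ1 hA (h.nonneg (j + 1) hjk)
        (h.leS hω hjk) (h.leS hω hjk.le) (by positivity) (h.stepS hω hjk)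
        (h'.stepS hω' hjk) hS (ih (j + 1) (by omega))
  have := chain k 0 (by omega)
  linarith

/-- For k = 1 the additive bound of `pos_compare` is too weak, since ξ_0 may equal 1. Subtracting
the two one-step equations shows that an error in t reaches ξ_0 only through the factor δ ξ'_1 ≤
ξ'_1/2. -/
theorem Block.pos_contract_one (h : Block δ ω 1 ξ) (h' : Block δ ω' 1 ξ') (hω : 0 < ω)
    (hω' : 0 < ω') (hδ0 : 0 ≤ δ) (hδ1 : δ ≤ 1 / 2) {A b : ℝ} (hA : 0 ≤ A) (hb : 0 ≤ b)
    (hs : ξ' 1 ≤ ξ 1 + A)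
    (ht : 1 + (1 / ω - ξ 0) ≤ (1 + b) * (1 + (1 / ω' - ξ' 0))) (hlt : ξ 0 ≤ ξ' 0) :
    ξ' 0 - ξ 0 ≤ A + b * (ξ' 1 / 2) := by
  have e := h.stepS hω (j := 0) (by omega)
  have e' := h'.stepS hω' (j := 0) (by omega)
  have l := h.lower hω.le hδ1 (j := 0) (by omega)
  have l' := h'.lower hω'.le hδ1 (j := 0) (by omega)
  have n := h.nonneg 1 le_rfl
  have n' := h'.nonneg 1 le_rfl
  have t0 := h.leS hω (Nat.zero_le 1)
  have t0' := h'.leS hω' (Nat.zero_le 1)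
  have sS := h.leS hω (le_refl 1)
  simp only [zero_add] at *
  obtain ⟨t, ht1⟩ : ∃ t, t = 1 / ω - ξ 0 := ⟨_, rfl⟩
  obtain ⟨t', ht1'⟩ : ∃ t, t = 1 / ω' - ξ' 0 := ⟨_, rfl⟩
  rw [← ht1, ← ht1'] at ht
  have eS : 1 / ω = ξ 0 + t := by linarith
  have eS' : 1 / ω' = ξ' 0 + t' := by linarith
  rw [eS] at e t0 sS
  rw [eS'] at e' t0'
  generalize ξ 0 = x at *
  generalize ξ' 0 = x' at *
  generalize ξ 1 = s at *
  generalize ξ' 1 = s' at *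
  have ht0 : 0 ≤ t := by linarith
  have ht0' : 0 ≤ t' := by linarith
  have hx : 0 < x := by linarith
  have hx' : 0 < x' := by linarith
  -- `x - s - 1 ≥ -δ t`
  have k1 : 0 ≤ x - s - 1 + δ * t := by
    have : 0 ≤ (x + t) * (x - s - 1 + δ * t) := by
      have : (x + t) * (x - s - 1 + δ * t) = δ * t * (x + t - s) := by linear_combination e
      rw [this]
      apply mul_nonneg (mul_nonneg hδ0 ht0) (by linarith)
    exact nonneg_of_mul_nonneg_right this (by linarith)
  have main : (x' - x) * (x' + t + x - s - 1) * (x' + t')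
      = (s' - s) * (x' + (1 - δ) * t) * (x' + t') + (t - t') * (δ * s' * x') := by
    linear_combination (x' + t' + t - t') * e' - (x' + t') * e
  have hP : x' + (1 - δ) * t ≤ x' + t + x - s - 1 := by linarith
  have hP0 : 0 < x' + (1 - δ) * t := by
    have : 0 ≤ (1 - δ) * t := mul_nonneg (by linarith) ht0
    linarith
  have b1 : (t - t') * (δ * s' * x') ≤ b * (x' + t') * (δ * s' * x') := by
    apply mul_le_mul_of_nonneg_right _ (by positivity)
    nlinarith
  have b2 : (s' - s) * (x' + (1 - δ) * t) * (x' + t') ≤ A * (x' + t + x - s - 1) * (x' + t') := by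
    apply mul_le_mul_of_nonneg_right _ (by linarith)
    calc (s' - s) * (x' + (1 - δ) * t) ≤ A * (x' + (1 - δ) * t) :=
          mul_le_mul_of_nonneg_right (by linarith) hP0.le
      _ ≤ _ := mul_le_mul_of_nonneg_left hP hA
  have b3 : b * (x' + t') * (δ * s' * x') ≤ b * (s' / 2) * (x' + t + x - s - 1) * (x' + t') := by
    have q1 : x' ≤ x' + t + x - s - 1 := by
      have : 0 ≤ (1 - δ) * t := mul_nonneg (by linarith) ht0
      linarith
    have q2 : δ * s' * x' ≤ s' / 2 * (x' + t + x - s - 1) := by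
      calc δ * s' * x' ≤ s' / 2 * x' := by
            apply mul_le_mul_of_nonneg_right _ hx'.le; nlinarith
        _ ≤ _ := mul_le_mul_of_nonneg_left q1 (by linarith)
    have := mul_le_mul_of_nonneg_left q2 (show 0 ≤ b * (x' + t') by positivity)
    linarith
  have pos : 0 < (x' + t + x - s - 1) * (x' + t') := by
    apply mul_pos (by linarith) (by linarith)
  have fin : (x' - x) * ((x' + t + x - s - 1) * (x' + t'))
      ≤ (A + b * (s' / 2)) * ((x' + t + x - s - 1) * (x' + t')) := by linarith
  exact le_of_mul_le_mul_right fin pos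

/-- The block map `(ξ_k, t) ↦ 1 / ξ_0` contracts ratios. -/
theorem Block.contract (h : Block δ ω k ξ) (h' : Block δ ω' k ξ') (hω : 0 < ω) (hω' : 0 < ω')
    (hk : 1 ≤ k) (hδ1 : δ ≤ 1 / 2) (hδ2 : -1 ≤ δ) {Λ b : ℝ} (hΛ : 9 / 10 ≤ Λ)
    (hΛδ : 1 - δ ≤ 2 * Λ) (hb : 0 ≤ b)
    (hs : 1 + ξ' k ≤ (1 + b) * (1 + ξ k))
    (ht : 1 + (1 / ω - ξ 0) ≤ (1 + b) * (1 + (1 / ω' - ξ' 0)))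
    (ht' : 1 + (1 / ω' - ξ' 0) ≤ (1 + b) * (1 + (1 / ω - ξ 0)))
    (bs : (ξ k ≤ 1 ∧ ξ' k ≤ 1) ∨ ξ' k = ξ k)
    (bt : (1 / ω - ξ 0 ≤ 1 ∧ 1 / ω' - ξ' 0 ≤ 1) ∨ 1 / ω' - ξ' 0 = 1 / ω - ξ 0) :
    ξ' 0 - ξ 0 ≤ Λ * b * (ξ 0 * (1 + ξ' 0)) := by
  have l0 := h.lower hω.le hδ1 (j := 0) (by omega)
  have l0' := h'.lower hω'.le hδ1 (j := 0) (by omega)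
  have n1 := h.nonneg 1 hk
  have n1' := h'.nonneg 1 hk
  simp only [zero_add] at l0 l0'
  have x1 : 1 ≤ ξ 0 := by linarith
  have x1' : 1 ≤ ξ' 0 := by linarith
  have hΛ0 : 0 ≤ Λ * b := by positivity
  rcases le_or_gt (ξ' 0) (ξ 0) with hle | hlt
  · have : 0 ≤ Λ * b * (ξ 0 * (1 + ξ' 0)) := by positivity
    linarith
  rcases le_or_gt δ 0 with hneg | hpos
  · have := h.neg_contract h' hω hω' hneg hδ2 hk hb hs ht'
    refine this.trans ?_
    rw [mul_assoc, mul_left_comm]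
    apply mul_le_mul_of_nonneg_left _ hb
    -- The worst case is ξ_0 = 1, where this reads 1 - δ ≤ 2Λ. With 1 - δ = 1/c it requires Λ ≥
    -- 1/(2c).
    have : ξ 0 - δ ≤ Λ * (ξ 0 * (1 + ξ 0)) := by
      nlinarith [mul_nonneg (show 0 ≤ ξ 0 - 1 by linarith) (show 0 ≤ ξ 0 by linarith)]
    refine this.trans ?_
    apply mul_le_mul_of_nonneg_left _ (by linarith)
    apply mul_le_mul_of_nonneg_left _ (by linarith)
    linarith
  have nk := h.nonneg k le_rfl
  have nk' := h'.nonneg k le_rfl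
  have hA : ∃ A, 0 ≤ A ∧ ξ' k ≤ ξ k + A ∧ ((A ≤ b * (1 + ξ k) ∧ ξ k ≤ 1 ∧ ξ' k ≤ 1) ∨
      (A = 0 ∧ ξ' k = ξ k)) := by
    rcases bs with ⟨b1, b2⟩ | b3
    · exact ⟨b * (1 + ξ k), by positivity, by linarith, Or.inl ⟨le_rfl, b1, b2⟩⟩
    · exact ⟨0, le_rfl, by linarith, Or.inr ⟨rfl, b3⟩⟩
  obtain ⟨A, hA0, hsA, hA⟩ := hA
  -- For k ≥ 2 one has ξ_0 ≥ 3/2, hence ξ_0(1 + ξ_0) ≥ 15/4, enough to absorb the additive errors A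
  -- + B ≤ (3 + ξ_k) b with the factor 9/10. The case k = 1 uses `pos_contract_one`.
  rcases hk.lt_or_eq with hk2 | rfl
  · have h1 : ∀ i, i < k → 1 ≤ ξ i := fun i h2 => by
      have := h.lower hω.le hδ1 h2
      have := h.nonneg (i + 1) h2
      linarith
    have x15 : 3 / 2 ≤ ξ 0 := by linarith [h1 1 hk2]
    have hB : ∃ B, 0 ≤ B ∧ 1 / ω - ξ 0 ≤ 1 / ω' - ξ' 0 + B ∧ B ≤ 2 * b := by
      rcases bt with ⟨b1, b2⟩ | b3
      · exact ⟨2 * b, by positivity, by nlinarith, le_rfl⟩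
      · exact ⟨0, le_rfl, by linarith, by positivity⟩
    obtain ⟨B, hB0, htB, hB⟩ := hB
    have := h.pos_compare h' hω hω' hpos.le hδ1 hA0 hB0 hsA htB
    have goal : A + B ≤ Λ * b * (ξ 0 * (1 + ξ 0)) := by
      rcases hA with ⟨a1, a2, -⟩ | ⟨a1, -⟩
      · have l1k : 1 + ξ k / 2 ≤ ξ 1 := by
          rcases Nat.lt_or_ge 2 k with h3 | h3
          · have l1 := h.lower hω.le hδ1 (j := 1) (by omega)
            have := h1 2 h3
            simp only [Nat.reduceAdd] at l1
            linarith
          · have : k = 2 := by omega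
            subst this
            exact h.lower hω.le hδ1 (j := 1) (by omega)
        have : 3 + ξ k ≤ 9 / 10 * (ξ 0 * (1 + ξ 0)) := by
          have : (3 / 2 + ξ k / 4) * (5 / 2 + ξ k / 4) ≤ ξ 0 * (1 + ξ 0) :=
            mul_le_mul (by linarith) (by linarith) (by linarith) (by linarith)
          nlinarith
        have := mul_le_mul_of_nonneg_left this hb
        have : 9 / 10 * (b * (ξ 0 * (1 + ξ 0))) ≤ Λ * (b * (ξ 0 * (1 + ξ 0))) :=
          mul_le_mul_of_nonneg_right hΛ (by positivity)
        linarith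
      · have : 2 ≤ 9 / 10 * (ξ 0 * (1 + ξ 0)) := by nlinarith
        have := mul_le_mul_of_nonneg_left this hb
        have : 9 / 10 * (b * (ξ 0 * (1 + ξ 0))) ≤ Λ * (b * (ξ 0 * (1 + ξ 0))) :=
          mul_le_mul_of_nonneg_right hΛ (by positivity)
        linarith
    have : Λ * b * (ξ 0 * (1 + ξ 0)) ≤ Λ * b * (ξ 0 * (1 + ξ' 0)) := by
      apply mul_le_mul_of_nonneg_left _ hΛ0
      apply mul_le_mul_of_nonneg_left _ (by linarith)
      linarith
    linarith
  · have := h.pos_contract_one h' hω hω' hpos.le hδ1 hA0 hb hsA ht hlt.le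
    refine this.trans ?_
    have : A + b * (ξ' 1 / 2) ≤ Λ * b * ((1 + ξ 1 / 2) * (2 + ξ' 1 / 2)) := by
      rcases hA with ⟨a1, a2, a3⟩ | ⟨a1, a2⟩
      · have : 1 + ξ 1 + ξ' 1 / 2 ≤ 9 / 10 * ((1 + ξ 1 / 2) * (2 + ξ' 1 / 2)) := by nlinarith
        have := mul_le_mul_of_nonneg_left this hb
        have : 9 / 10 * (b * ((1 + ξ 1 / 2) * (2 + ξ' 1 / 2)))
          ≤ Λ * (b * ((1 + ξ 1 / 2) * (2 + ξ' 1 / 2))) :=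
          mul_le_mul_of_nonneg_right hΛ (by positivity)
        nlinarith
      · rw [a1, a2]
        have : ξ 1 / 2 ≤ 9 / 10 * ((1 + ξ 1 / 2) * (2 + ξ 1 / 2)) := by nlinarith
        have := mul_le_mul_of_nonneg_left this hb
        have : 9 / 10 * (b * ((1 + ξ 1 / 2) * (2 + ξ 1 / 2)))
          ≤ Λ * (b * ((1 + ξ 1 / 2) * (2 + ξ 1 / 2))) :=
          mul_le_mul_of_nonneg_right hΛ (by positivity)
        nlinarith
    refine this.trans ?_
    apply mul_le_mul_of_nonneg_left _ hΛ0
    apply mul_le_mul (by linarith) (by linarith) (by positivity) (by linarith)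

end compare

/-! ### Links: one renormalization in the coordinates x, y -/

/-- One renormalization step in the coordinates `x = a / c`, `y = c (c - 1 - v) / (a v)`. -/
def Link (δ : ℝ) (k : ℕ) (x y x' y' : ℝ) : Prop :=
  ∃ (ω : ℝ) (ξ : ℕ → ℝ), Block δ ω k ξ ∧ 0 < ω ∧ ξ k = x' ∧ x * ξ 0 = 1 ∧ ω * (ξ 0 + y) = 1 ∧
    y' * (1 - ω * x') = ω

namespace Link

variable {δ : ℝ} {k : ℕ} {x y x' y' u v u' v' : ℝ}

/-- The reversed block starts at 1/ω - x' = 1/y' and ends at 1/ω - ξ_0 = y; the scale ω is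
unchanged. -/
theorem symm (h : Link δ k x y x' y') : Link δ k y' x' y x := by
  obtain ⟨ω, ξ, hB, hω, h1, h2, h3, h4⟩ := h
  have e : 1 / ω - ξ 0 = y := by
    rw [sub_eq_iff_eq_add, div_eq_iff hω.ne']; linear_combination -h3
  refine ⟨ω, _, hB.reverse hω, hω, ?_, ?_, ?_, ?_⟩
  · simpa using e
  · have : y' * (1 / ω - x') = (y' * (1 - ω * x')) / ω := by field_simp
    simp only [Nat.sub_zero, h1]
    rw [this, h4, div_self hω.ne']
  · simp only [Nat.sub_zero, h1]
    field_simp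
    ring
  · have : 1 - ω * y = ω * ξ 0 := by linear_combination -h3
    rw [this]; linear_combination ω * h2

theorem bounds (h : Link δ k x y x' y') (hδ : δ ≤ 1 / 2) (hk : 1 ≤ k) :
    0 < x ∧ x ≤ 1 ∧ 0 ≤ y ∧ 0 ≤ x' ∧ (0 < x' → x < 1) := by
  obtain ⟨ω, ξ, hB, hω, h1, h2, h3, h4⟩ := h
  have l0 := hB.lower hω.le hδ (j := 0) (by omega)
  have n1 := hB.nonneg 1 hk
  simp only [zero_add] at l0
  have hξ : 1 ≤ ξ 0 := by linarith
  have e : x = 1 / ξ 0 := by rw [eq_div_iff (by linarith)]; exact h2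
  refine ⟨by rw [e]; positivity, ?_, ?_, h1 ▸ hB.nonneg k le_rfl, fun hx' => ?_⟩
  · rw [e, div_le_one (by linarith)]; exact hξ
  · have := hB.le 0 (by omega)
    have : 0 ≤ ω * y := by linarith
    exact nonneg_of_mul_nonneg_right this hω
  · rw [e, div_lt_one (by linarith)]
    have : 0 < ξ 1 := by
      rcases hk.lt_or_eq with hk | rfl
      · have := hB.lower hω.le hδ (j := 1) hk
        have := hB.nonneg 2 hk
        simp only [Nat.reduceAdd] at *
        linarith
      · rw [h1]; exact hx'
    linarith

theorem bounds' (h : Link δ k x y x' y') (hδ : δ ≤ 1 / 2) (hk : 1 ≤ k) :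
    0 < y' ∧ y' ≤ 1 ∧ (0 < y → y' < 1) :=
  have := h.symm.bounds hδ hk
  ⟨this.1, this.2.1, this.2.2.2.2⟩

end Link

/-! ### The contracting distance -/

/-- The distance in which the block maps are contracting. -/
def ld (x x' : ℝ) : ℝ := |Real.log (1 + x) - Real.log (1 + x')|

theorem ld_nonneg (x x' : ℝ) : 0 ≤ ld x x' := abs_nonneg _

theorem ld_comm (x x' : ℝ) : ld x x' = ld x' x := abs_sub_comm _ _

theorem ld_self (x : ℝ) : ld x x = 0 := by simp [ld]

theorem eq_of_ld {x x' : ℝ} (hx : 0 ≤ x) (hx' : 0 ≤ x') (h : ld x x' ≤ 0) : x = x' := by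
  have h0 : Real.log (1 + x) - Real.log (1 + x') = 0 :=
    abs_eq_zero.1 (le_antisymm h (abs_nonneg _))
  have := Real.log_injOn_pos (show (0 : ℝ) < 1 + x by linarith)
    (show (0 : ℝ) < 1 + x' by linarith) (sub_eq_zero.1 h0)
  linarith

theorem ld_le_log_two {x x' : ℝ} (hx : 0 ≤ x) (hx1 : x ≤ 1) (hx' : 0 ≤ x') (hx1' : x' ≤ 1) :
    ld x x' ≤ Real.log 2 := by
  have a1 := Real.log_nonneg (show (1 : ℝ) ≤ 1 + x by linarith)
  have a2 := Real.log_nonneg (show (1 : ℝ) ≤ 1 + x' by linarith)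
  have a3 := Real.log_le_log (show (0 : ℝ) < 1 + x by linarith) (show 1 + x ≤ 2 by linarith)
  have a4 := Real.log_le_log (show (0 : ℝ) < 1 + x' by linarith) (show 1 + x' ≤ 2 by linarith)
  rw [ld, abs_le]
  constructor <;> linarith

theorem le_of_ld {x x' D : ℝ} (hx : 0 ≤ x) (hx' : 0 ≤ x') (h : ld x x' ≤ D) :
    1 + x ≤ Real.exp D * (1 + x') := by
  have h1 := (abs_le.1 h).2
  have : Real.log (1 + x) ≤ D + Real.log (1 + x') := by linarith
  rw [← Real.log_exp D, ← Real.log_mul (Real.exp_pos _).ne' (by linarith)] at this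
  exact (Real.log_le_log_iff (by linarith) (by positivity)).1 this

theorem sub_le_of_le {x x' b : ℝ} (hx : 0 ≤ x) (hx' : 0 ≤ x') (hb : 0 ≤ b)
    (h : 1 + x ≤ (1 + b) * (1 + x')) : Real.log (1 + x) - Real.log (1 + x') ≤ Real.log (1 + b) := by
  have := Real.log_le_log (by linarith) h
  rw [Real.log_mul (by linarith) (by linarith)] at this
  linarith

/-- Since log u ≤ u - 1 at u = (1+Λb)/(1+b), the logarithm drops by at least (1-Λ)b/(1+b). For b ≤ 1
this is at least (1-Λ)b/2 ≥ (1-Λ)/2 · log(1+b). -/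
theorem log_one_add_mul_le {Λ b : ℝ} (hΛ0 : 0 ≤ Λ) (hΛ : Λ ≤ 1) (hb : 0 ≤ b) (hb1 : b ≤ 1) :
    Real.log (1 + Λ * b) ≤ (1 + Λ) / 2 * Real.log (1 + b) := by
  have h1 : Real.log (1 + Λ * b) = Real.log (1 + b) + Real.log ((1 + Λ * b) / (1 + b)) := by
    rw [Real.log_div (by positivity) (by positivity)]; ring
  have h2 := Real.log_le_sub_one_of_pos (show 0 < (1 + Λ * b) / (1 + b) by positivity)
  have h3 : (1 + Λ * b) / (1 + b) - 1 ≤ -((1 - Λ) / 2 * b) := by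
    rw [div_sub_one (by positivity), div_le_iff₀ (by positivity)]
    nlinarith [mul_nonneg (mul_nonneg (sub_nonneg.2 hΛ) hb) (sub_nonneg.2 hb1)]
  have h4 : Real.log (1 + b) ≤ b := by
    have := Real.log_le_sub_one_of_pos (show 0 < 1 + b by positivity)
    linarith
  nlinarith

/-- With 1 + b = exp D for the larger distance D, the restriction of the data to [0, 1] (or their
equality) gives D ≤ log 2, so b ≤ 1. `Block.contract`, used in both directions, bounds the ratios of
1 + x and 1 + u by 1 + Λb, because x = 1/ξ_0. The alternative of equal data serves links whose
coordinate y exceeds 1. -/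
theorem Link.contract_fst {δ Λ : ℝ} {k : ℕ} {x y x' y' u v u' v' : ℝ} (hk : 1 ≤ k)
    (hδ1 : δ ≤ 1 / 2) (hδ2 : -1 ≤ δ) (hΛ : 9 / 10 ≤ Λ) (hΛ1 : Λ ≤ 1) (hΛδ : 1 - δ ≤ 2 * Λ)
    (h : Link δ k x y x' y') (h' : Link δ k u v u' v')
    (bs : (x' ≤ 1 ∧ u' ≤ 1) ∨ x' = u') (bt : (y ≤ 1 ∧ v ≤ 1) ∨ y = v) :
    ld x u ≤ (1 + Λ) / 2 * max (ld x' u') (ld y v) := by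
  obtain ⟨px, -, py, px', -⟩ := h.bounds hδ1 hk
  obtain ⟨pu, -, pv, pu', -⟩ := h'.bounds hδ1 hk
  set D := max (ld x' u') (ld y v) with hD
  have hD2 : D ≤ Real.log 2 := by
    have hl2 : 0 ≤ Real.log 2 := Real.log_nonneg (by norm_num)
    apply max_le
    · rcases bs with ⟨b1, b2⟩ | rfl
      · exact ld_le_log_two px' b1 pu' b2
      · rw [ld_self]; exact hl2
    · rcases bt with ⟨b1, b2⟩ | rfl
      · exact ld_le_log_two py b1 pv b2
      · rw [ld_self]; exact hl2
  have hD0 : 0 ≤ D := (ld_nonneg _ _).trans (le_max_left _ _)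
  obtain ⟨b, hb⟩ : ∃ b, 1 + b = Real.exp D := ⟨Real.exp D - 1, by ring⟩
  have hb0 : 0 ≤ b := by have := Real.add_one_le_exp D; linarith
  have hb1 : b ≤ 1 := by
    have := Real.exp_le_exp.2 hD2
    rw [Real.exp_log (by norm_num)] at this
    linarith
  have hlog : Real.log (1 + b) = D := by rw [hb, Real.log_exp]
  have i1 : 1 + x' ≤ (1 + b) * (1 + u') := hb ▸ le_of_ld px' pu' (le_max_left _ _)
  have i2 : 1 + u' ≤ (1 + b) * (1 + x') :=
    hb ▸ le_of_ld pu' px' (by rw [ld_comm]; exact le_max_left _ _)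
  have i3 : 1 + y ≤ (1 + b) * (1 + v) := hb ▸ le_of_ld py pv (le_max_right _ _)
  have i4 : 1 + v ≤ (1 + b) * (1 + y) :=
    hb ▸ le_of_ld pv py (by rw [ld_comm]; exact le_max_right _ _)
  have hfin := log_one_add_mul_le (by linarith : 0 ≤ Λ) hΛ1 hb0 hb1
  rw [hlog] at hfin
  obtain ⟨ω, ξ, hB, hω, h1, h2, h3, h4⟩ := h
  obtain ⟨ω', ξ', hB', hω', h1', h2', h3', h4'⟩ := h'
  have e : 1 / ω - ξ 0 = y := by
    rw [sub_eq_iff_eq_add, div_eq_iff hω.ne']; linear_combination -h3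
  have e' : 1 / ω' - ξ' 0 = v := by
    rw [sub_eq_iff_eq_add, div_eq_iff hω'.ne']; linear_combination -h3'
  have c1 := hB.contract hB' hω hω' hk hδ1 hδ2 hΛ hΛδ hb0 (by rwa [h1, h1']) (by rwa [e, e'])
    (by rwa [e, e']) (by rw [h1, h1']; exact bs.imp id Eq.symm)
    (by rw [e, e']; exact bt.imp id Eq.symm)
  have c2 := hB'.contract hB hω' hω hk hδ1 hδ2 hΛ hΛδ hb0 (by rwa [h1, h1']) (by rwa [e, e'])
    (by rwa [e, e']) (by rw [h1, h1']; exact bs.imp And.symm id)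
    (by rw [e, e']; exact bt.imp And.symm id)
  have p0 : 0 < ξ 0 := by
    by_contra hcon
    have : x * ξ 0 ≤ 0 := mul_nonpos_of_nonneg_of_nonpos px.le (not_lt.1 hcon)
    linarith
  have p0' : 0 < ξ' 0 := by
    by_contra hcon
    have : u * ξ' 0 ≤ 0 := mul_nonpos_of_nonneg_of_nonpos pu.le (not_lt.1 hcon)
    linarith
  have ex : x = 1 / ξ 0 := by rw [eq_div_iff p0.ne']; exact h2
  have eu : u = 1 / ξ' 0 := by rw [eq_div_iff p0'.ne']; exact h2'
  have hΛb : 0 ≤ Λ * b := mul_nonneg (by linarith) hb0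
  have d1 : 1 + x ≤ (1 + Λ * b) * (1 + u) := by
    rw [ex, eu]
    have : (1 + Λ * b) * (1 + 1 / ξ' 0) - (1 + 1 / ξ 0)
        = (Λ * b * (ξ 0 * (1 + ξ' 0)) - (ξ' 0 - ξ 0)) / (ξ 0 * ξ' 0) := by
      field_simp; ring
    have : 0 ≤ (Λ * b * (ξ 0 * (1 + ξ' 0)) - (ξ' 0 - ξ 0)) / (ξ 0 * ξ' 0) :=
      div_nonneg (by linarith) (by positivity)
    linarith
  have d2 : 1 + u ≤ (1 + Λ * b) * (1 + x) := by
    rw [ex, eu]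
    have : (1 + Λ * b) * (1 + 1 / ξ 0) - (1 + 1 / ξ' 0)
        = (Λ * b * (ξ' 0 * (1 + ξ 0)) - (ξ 0 - ξ' 0)) / (ξ 0 * ξ' 0) := by
      field_simp; ring
    have : 0 ≤ (Λ * b * (ξ' 0 * (1 + ξ 0)) - (ξ 0 - ξ' 0)) / (ξ 0 * ξ' 0) :=
      div_nonneg (by linarith) (by positivity)
    linarith
  have f1 := sub_le_of_le px.le pu.le hΛb d1
  have f2 := sub_le_of_le pu.le px.le hΛb d2
  rw [ld, abs_le]
  constructor <;> linarith

theorem Link.contract_snd {δ Λ : ℝ} {k : ℕ} {x y x' y' u v u' v' : ℝ} (hk : 1 ≤ k)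
    (hδ1 : δ ≤ 1 / 2) (hδ2 : -1 ≤ δ) (hΛ : 9 / 10 ≤ Λ) (hΛ1 : Λ ≤ 1) (hΛδ : 1 - δ ≤ 2 * Λ)
    (h : Link δ k x y x' y') (h' : Link δ k u v u' v')
    (bs : (x' ≤ 1 ∧ u' ≤ 1) ∨ x' = u') (bt : (y ≤ 1 ∧ v ≤ 1) ∨ y = v) :
    ld y' v' ≤ (1 + Λ) / 2 * max (ld x' u') (ld y v) := by
  rw [max_comm]
  exact h.symm.contract_fst hk hδ1 hδ2 hΛ hΛ1 hΛδ h'.symm bt bs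

/-! ### Existence of blocks -/

/-- The inverse of `F` in the coordinate `ξ`, truncated at `S = 1 / ω`. -/
def backStep (δ S ξ : ℝ) : ℝ := S * (1 + (1 - δ) * min ξ S) / (S - δ * min ξ S)

theorem backStep_den {δ S ξ : ℝ} (hδ : δ ≤ 1 / 2) (hS : 0 < S) (hξ : 0 ≤ ξ) :
    S / 2 ≤ S - δ * min ξ S := by
  have h1 : min ξ S ≤ S := min_le_right _ _
  have h2 : 0 ≤ min ξ S := le_min hξ hS.le
  nlinarith

theorem one_le_backStep {δ S ξ : ℝ} (hδ : δ ≤ 1 / 2) (hS : 1 ≤ S) (hξ : 0 ≤ ξ) :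
    1 ≤ backStep δ S ξ := by
  have h0 := backStep_den hδ (by linarith : 0 < S) hξ
  have h2 : 0 ≤ min ξ S := le_min hξ (by linarith)
  rw [backStep, le_div_iff₀ (by linarith)]
  have h3 : 0 ≤ S + δ * (1 - S) := by nlinarith
  nlinarith [mul_nonneg h2 h3]

theorem backStep_le {δ S ξ : ℝ} (hδ : δ ≤ 1 / 2) (hδ' : -1 ≤ δ) (hS : 0 < S) (hξ : 0 ≤ ξ) :
    backStep δ S ξ ≤ 2 + 4 * ξ := by
  have h0 := backStep_den hδ hS hξ
  have h1 : min ξ S ≤ ξ := min_le_left _ _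
  have h2 : 0 ≤ min ξ S := le_min hξ hS.le
  rw [backStep, div_le_iff₀ (by linarith)]
  calc S * (1 + (1 - δ) * min ξ S) ≤ S * (1 + 2 * ξ) := by
        apply mul_le_mul_of_nonneg_left _ hS.le
        nlinarith
    _ = (2 + 4 * ξ) * (S / 2) := by ring
    _ ≤ _ := mul_le_mul_of_nonneg_left h0 (by linarith)

/-- Going backwards from ξ_k = s, the block is determined by S = 1/ω. The remaining condition S =
ξ_0(S) + t is solved by the intermediate value theorem, ξ_0 being continuous, bounded, and at least
1. -/
theorem exists_block {δ : ℝ} (hδ : δ ≤ 1 / 2) (hδ' : -1 ≤ δ) {k : ℕ} (hk : 1 ≤ k) {s t : ℝ}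
    (hs : 0 ≤ s) (ht : 0 ≤ t) :
    ∃ (ω : ℝ) (ξ : ℕ → ℝ), Block δ ω k ξ ∧ 0 < ω ∧ ξ k = s ∧ ω * (ξ 0 + t) = 1 := by
  let e : ℕ → ℝ → ℝ := fun i S => (backStep δ S)^[i] s
  have es : ∀ i S, e (i + 1) S = backStep δ S (e i S) := fun i S =>
    Function.iterate_succ_apply' _ _ _
  have e1 : ∀ i S, 1 ≤ S → 0 ≤ e i S ∧ (1 ≤ i → 1 ≤ e i S) := by
    intro i S hS
    induction i with
    | zero => exact ⟨hs, fun h => by omega⟩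
    | succ i ih =>
      have := one_le_backStep hδ hS ih.1
      rw [es]
      exact ⟨by linarith, fun _ => this⟩
  have bnd : ∀ i, ∃ C, ∀ S, 1 ≤ S → e i S ≤ C := by
    intro i
    induction i with
    | zero => exact ⟨s, fun _ _ => le_rfl⟩
    | succ i ih =>
      obtain ⟨C, hC⟩ := ih
      refine ⟨2 + 4 * C, fun S hS => ?_⟩
      rw [es]
      have := backStep_le hδ hδ' (by linarith : 0 < S) (e1 i S hS).1
      linarith [hC S hS]
  have cont : ∀ i, ContinuousOn (e i) (Set.Ici 1) := by
    intro i
    induction i with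
    | zero => exact continuousOn_const
    | succ i ih =>
      have : e (i + 1) = fun S => backStep δ S (e i S) := funext (es i)
      rw [this]
      unfold backStep
      refine ContinuousOn.div (by fun_prop) (by fun_prop) ?_
      intro S hS
      have hS : (1 : ℝ) ≤ S := hS
      have := backStep_den hδ (by linarith : 0 < S) (e1 i S hS).1
      linarith
  obtain ⟨C, hC⟩ := bnd k
  have hC0 : 0 ≤ C := (e1 k 1 le_rfl).1.trans (hC 1 le_rfl)
  have ivt := intermediate_value_Icc (show t + 1 ≤ t + 1 + C by linarith)
    (f := fun S => S - t - e k S) (by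
      apply ContinuousOn.sub (by fun_prop)
      exact (cont k).mono fun S hS => by
        have := hS.1
        change 1 ≤ S
        linarith)
  obtain ⟨S, ⟨hS1, -⟩, hS⟩ := ivt (show (0 : ℝ) ∈ _ by
    constructor
    · have := (e1 k (t + 1) (by linarith)).2 hk
      linarith
    · have := hC (t + 1 + C) (by linarith)
      linarith)
  simp only at hS
  have hS0 : 0 < S := by linarith
  have hS1' : 1 ≤ S := by linarith
  -- The truncation at S is inactive at the solution: an iterate above S would keep all later ones
  -- above S, while the last one is S - t ≤ S.
  have le : ∀ i ≤ k, e i S ≤ S := by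
    intro i hi
    by_contra hcon
    push Not at hcon
    have : ∀ n, S < e (i + n) S := by
      intro n
      induction n with
      | zero => exact hcon
      | succ n ih =>
        rw [← add_assoc, es, backStep, min_eq_right ih.le, lt_div_iff₀ (by nlinarith)]
        nlinarith
    have := this (k - i)
    rw [Nat.add_sub_cancel' hi] at this
    linarith
  refine ⟨1 / S, fun j => e (k - j) S, ⟨fun j _ => (e1 _ S hS1').1, fun j hj => ?_, fun j hj => ?_⟩,
    by positivity, ?_, ?_⟩
  · rw [one_div_mul_eq_div, div_le_one hS0]; exact le _ (by omega)
  · obtain ⟨i, rfl⟩ : ∃ i, k = j + 1 + i := ⟨k - j - 1, by omega⟩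
    have e1' : j + 1 + i - j = i + 1 := by omega
    have e2' : j + 1 + i - (j + 1) = i := by omega
    simp only [e1', e2']
    have h1 := es i S
    have h2 := backStep_den hδ hS0 (e1 i S hS1').1
    rw [backStep, min_eq_left (le i (by omega)), eq_div_iff (by
      rw [min_eq_left (le i (by omega))] at h2; linarith)] at h1
    field_simp
    linear_combination h1
  · simp [e]
  · simp only [Nat.sub_zero]
    field_simp
    linarith

theorem exists_link {δ : ℝ} (hδ : δ ≤ 1 / 2) (hδ' : -1 ≤ δ) {k : ℕ} (hk : 1 ≤ k) {x' y : ℝ}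
    (hx' : 0 ≤ x') (hy : 0 ≤ y) : ∃ x y', Link δ k x y x' y' := by
  obtain ⟨ω, ξ, hB, hω, h1, h2⟩ := exists_block hδ hδ' hk hx' hy
  have l0 := hB.lower hω.le hδ (j := 0) (by omega)
  have n1 := hB.nonneg 1 hk
  simp only [zero_add] at l0
  -- If ω ξ_k were 1, the last step would force ω ξ_{k-1} > 1.
  have hpos : 0 < 1 - ω * x' := by
    by_contra hcon
    have c1 := hB.le k le_rfl
    rw [h1] at c1
    have c2 : ω * x' = 1 := by linarith
    have c3 := hB.step (k - 1) (by omega)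
    rw [Nat.sub_add_cancel hk, h1] at c3
    have c4 := hB.le (k - 1) (by omega)
    have c5 : ω * (ξ (k - 1) * (1 - δ)) = 1 * (1 - δ) + ω := by
      linear_combination ω * c3 + (1 - δ + δ * ω * ξ (k - 1)) * c2
    nlinarith
  refine ⟨1 / ξ 0, ω / (1 - ω * x'), ω, ξ, hB, hω, h1, ?_, h2, ?_⟩
  · rw [one_div_mul_cancel]; linarith
  · rw [div_mul_cancel₀]; exact hpos.ne'

/-! ### Sequences with a contracting cross form -/



/-- Here d is controlled from the future and e from the past. In the inductive step, d_1 ≤ κ e_1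
excludes d_1 > e_0, as e_1 ≤ κ d_1 would then follow; so d_0 is governed by the far end d_n or by
e_0. -/
theorem cross_decay {κ : ℝ} (h0 : 0 ≤ κ) (h1 : κ < 1) (n : ℕ) {d e : ℕ → ℝ} (hd : ∀ i, 0 ≤ d i) (he : ∀ i, 0 ≤ e i)
    (hs : ∀ i < n, d i ≤ κ * max (d (i + 1)) (e i) ∧ e (i + 1) ≤ κ * max (d (i + 1)) (e i)) :
    d 0 ≤ max (κ ^ n * d n) (κ * e 0) := by
  induction n generalizing d e with
  | zero => simp
  | succ n ih =>
    have IH := ih (d := fun i => d (i + 1)) (e := fun i => e (i + 1)) (fun i => hd _)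
      (fun i => he _) (fun i hi => hs (i + 1) (by omega))
    obtain ⟨s1, s2⟩ := hs 0 (by omega)
    simp only [zero_add] at *
    rcases le_max_iff.1 IH with c | c
    · have := mul_le_mul_of_nonneg_left c h0
      rcases max_cases (d 1) (e 0) with ⟨m, -⟩ | ⟨m, -⟩ <;> rw [m] at s1
      · refine le_max_of_le_left ?_
        rw [pow_succ]; linarith
      · exact le_max_of_le_right s1
    · have hle : d 1 ≤ e 0 := by
        by_contra hcon
        rw [max_eq_left (not_le.1 hcon).le] at s2
        have := mul_le_mul_of_nonneg_left s2 h0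
        have := he 0
        nlinarith [mul_nonneg h0 (hd 1)]
      rw [max_eq_right hle] at s1
      exact le_max_of_le_right s1

theorem cross_decay' {κ : ℝ} (h0 : 0 ≤ κ) (h1 : κ < 1) (n : ℕ) {d e : ℕ → ℝ} (hd : ∀ i, 0 ≤ d i) (he : ∀ i, 0 ≤ e i)
    (hs : ∀ i < n, d i ≤ κ * max (d (i + 1)) (e i) ∧ e (i + 1) ≤ κ * max (d (i + 1)) (e i)) :
    e n ≤ max (κ ^ n * e 0) (κ * d n) := by
  have := cross_decay h0 h1 n (d := fun i => e (n - i)) (e := fun i => d (n - i))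
    (fun i => he _) (fun i => hd _) (fun i hi => by
      obtain ⟨j, rfl⟩ : ∃ j, n = i + 1 + j := ⟨n - i - 1, by omega⟩
      have e1 : i + 1 + j - i = j + 1 := by omega
      have e2 : i + 1 + j - (i + 1) = j := by omega
      simp only [e1, e2]
      have := hs j (by omega)
      rw [max_comm] at this
      exact this.symm)
  simpa using this

/-- As d is bounded, letting the horizon in `cross_decay` tend to infinity removes its future term.
Thus d_i ≤ κ e_i, and then e itself decays geometrically. -/
theorem cross_future {κ : ℝ} (h0 : 0 ≤ κ) (h1 : κ < 1) {B : ℝ} {d e : ℕ → ℝ} (hd : ∀ i, 0 ≤ d i) (he : ∀ i, 0 ≤ e i)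
    (hB : ∀ i, d i ≤ B)
    (hs : ∀ i, d i ≤ κ * max (d (i + 1)) (e i) ∧ e (i + 1) ≤ κ * max (d (i + 1)) (e i)) :
    (∀ i, d i ≤ κ * e i) ∧ ∀ i, e i ≤ κ ^ i * e 0 := by
  have A : ∀ i, d i ≤ κ * e i := by
    intro i
    have : ∀ n, d i ≤ max (κ ^ n * B) (κ * e i) := by
      intro n
      have := cross_decay h0 h1 n (d := fun j => d (i + j)) (e := fun j => e (i + j))
        (fun j => hd _) (fun j => he _) (fun j _ => hs (i + j))
      refine this.trans (max_le_max ?_ le_rfl)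
      exact mul_le_mul_of_nonneg_left (hB _) (by positivity)
    have lim : Tendsto (fun n : ℕ => max (κ ^ n * B) (κ * e i)) atTop (𝓝 (max (0 * B) (κ * e i))) :=
      ((tendsto_pow_atTop_nhds_zero_of_lt_one h0 h1).mul_const B).max tendsto_const_nhds
    have := ge_of_tendsto' lim this
    rwa [zero_mul, max_eq_right (mul_nonneg h0 (he i))] at this
  refine ⟨A, fun i => ?_⟩
  induction i with
  | zero => simp
  | succ i ih =>
    have : e (i + 1) ≤ κ * e i := by
      have s2 := (hs i).2
      rcases le_total (d (i + 1)) (e i) with hle | hle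
      · rwa [max_eq_right hle] at s2
      · rw [max_eq_left hle] at s2
        have := A (i + 1)
        have p := he (i + 1)
        have q := mul_nonneg h0 (he i)
        have : e (i + 1) ≤ κ * (κ * e (i + 1)) := s2.trans (mul_le_mul_of_nonneg_left this h0)
        have : κ * (κ * e (i + 1)) ≤ κ * e (i + 1) := by
          apply mul_le_mul_of_nonneg_left _ h0
          nlinarith
        nlinarith
    calc e (i + 1) ≤ κ * e i := this
      _ ≤ κ * (κ ^ i * e 0) := mul_le_mul_of_nonneg_left ih h0
      _ = _ := by rw [pow_succ]; ring


/-- Fixed points of sup-norm contractions of a box, in coordinates. -/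
theorem exists_fixed {ι : Type*} (Φ : (ι → ℝ) → ι → ℝ) {B κ : ℝ} (hB : 0 ≤ B) (h0 : 0 ≤ κ)
    (h1 : κ < 1) (hmap : ∀ u, (∀ i, 0 ≤ u i ∧ u i ≤ B) → ∀ i, 0 ≤ Φ u i ∧ Φ u i ≤ B)
    (hc : ∀ u v, (∀ i, 0 ≤ u i ∧ u i ≤ B) → (∀ i, 0 ≤ v i ∧ v i ≤ B) →
      ∀ D, (∀ i, |u i - v i| ≤ D) → ∀ i, |Φ u i - Φ v i| ≤ κ * D) :
    ∃ u, (∀ i, 0 ≤ u i ∧ u i ≤ B) ∧ Φ u = u := by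
  let a : ℕ → ι → ℝ := fun n => Φ^[n] 0
  have as : ∀ n, a (n + 1) = Φ (a n) := fun n => Function.iterate_succ_apply' _ _ _
  have box : ∀ n i, 0 ≤ a n i ∧ a n i ≤ B := by
    intro n
    induction n with
    | zero => intro i; simp [a, hB]
    | succ n ih => rw [as]; exact hmap _ ih
  have geo : ∀ n i, dist (a n i) (a (n + 1) i) ≤ B * κ ^ n := by
    intro n
    induction n with
    | zero =>
      intro i
      obtain ⟨p, q⟩ := box 1 i
      have : a 0 i = 0 := rfl
      rw [Real.dist_eq, this, abs_le]
      constructor <;> simp <;> linarith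
    | succ n ih =>
      intro i
      have := hc (a n) (a (n + 1)) (box n) (box (n + 1)) (B * κ ^ n)
        (fun i => by have := ih i; rwa [Real.dist_eq] at this) i
      rw [Real.dist_eq, as, as (n + 1), pow_succ]
      linarith
  have lim : ∀ i, ∃ l, Tendsto (fun n => a n i) atTop (𝓝 l) := fun i =>
    cauchySeq_tendsto_of_complete (cauchySeq_of_le_geometric κ B h1 (fun n => geo n i))
  choose u hu using lim
  have ub : ∀ i, 0 ≤ u i ∧ u i ≤ B := fun i =>
    ⟨ge_of_tendsto' (hu i) fun n => (box n i).1, le_of_tendsto' (hu i) fun n => (box n i).2⟩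
  refine ⟨u, ub, funext fun i => ?_⟩
  have est : ∀ n, |Φ u i - a (n + 1) i| ≤ κ * (B * κ ^ n / (1 - κ)) := by
    intro n
    rw [as]
    refine hc u (a n) ub (box n) _ (fun j => ?_) i
    have := dist_le_of_le_geometric_of_tendsto κ B h1 (fun n => geo n j) (hu j) n
    rwa [Real.dist_eq, abs_sub_comm] at this
  have z : Tendsto (fun n : ℕ => κ * (B * κ ^ n / (1 - κ))) atTop (𝓝 (κ * (B * 0 / (1 - κ)))) :=
    (((tendsto_pow_atTop_nhds_zero_of_lt_one h0 h1).const_mul B).div_const _).const_mul _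
  have w : Tendsto (fun n : ℕ => |Φ u i - a (n + 1) i|) atTop (𝓝 |Φ u i - u i|) :=
    (tendsto_const_nhds.sub ((hu i).comp (tendsto_add_atTop_nat 1))).abs
  have := le_of_tendsto_of_tendsto' w z est
  simp only [mul_zero, zero_div] at this
  exact sub_eq_zero.1 (abs_eq_zero.1 (le_antisymm this (abs_nonneg _)))

/-- Two-sided orbits of a sequence of relations with a contracting cross form. -/
theorem exists_orbit (R : ℤ → ℝ → ℝ → ℝ → ℝ → Prop) {κ : ℝ} (h0 : 0 ≤ κ) (h1 : κ < 1)
    (hex : ∀ i x' y, 0 ≤ x' → x' ≤ 1 → 0 ≤ y → y ≤ 1 →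
      ∃ x y', (0 ≤ x ∧ x ≤ 1) ∧ (0 ≤ y' ∧ y' ≤ 1) ∧ R i x y x' y')
    (hc : ∀ i x y x' y' u v u' v', (0 ≤ x' ∧ x' ≤ 1) → (0 ≤ y ∧ y ≤ 1) → (0 ≤ u' ∧ u' ≤ 1) →
      (0 ≤ v ∧ v ≤ 1) → R i x y x' y' → R i u v u' v' →
      ld x u ≤ κ * max (ld x' u') (ld y v) ∧ ld y' v' ≤ κ * max (ld x' u') (ld y v)) :
    ∃ x y : ℤ → ℝ, ∀ i, (0 ≤ x i ∧ x i ≤ 1) ∧ (0 ≤ y i ∧ y i ≤ 1) ∧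
      R i (x i) (y i) (x (i + 1)) (y (i + 1)) := by
  -- The value 0 outside the unit box makes the chosen solutions total functions.
  have hex' : ∀ i x' y, ∃ x y', 0 ≤ x' → x' ≤ 1 → 0 ≤ y → y ≤ 1 →
      (0 ≤ x ∧ x ≤ 1) ∧ (0 ≤ y' ∧ y' ≤ 1) ∧ R i x y x' y' := by
    intro i x' y
    by_cases h : 0 ≤ x' ∧ x' ≤ 1 ∧ 0 ≤ y ∧ y ≤ 1
    · obtain ⟨x, y', H⟩ := hex i x' y h.1 h.2.1 h.2.2.1 h.2.2.2
      exact ⟨x, y', fun _ _ _ _ => H⟩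
    · exact ⟨0, 0, fun a b c d => absurd ⟨a, b, c, d⟩ h⟩
  choose X Y hXY using hex'
  let val : ℝ → ℝ := fun p => Real.exp p - 1
  have hval : ∀ p, 0 ≤ p ∧ p ≤ Real.log 2 → 0 ≤ val p ∧ val p ≤ 1 := by
    intro p hp
    have a1 := Real.add_one_le_exp p
    have a2 := Real.exp_le_exp.2 hp.2
    rw [Real.exp_log (by norm_num)] at a2
    simp only [val]
    constructor <;> linarith
  have hlog : ∀ x : ℝ, 0 ≤ x ∧ x ≤ 1 → 0 ≤ Real.log (1 + x) ∧ Real.log (1 + x) ≤ Real.log 2 :=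
    fun x hx => ⟨Real.log_nonneg (by linarith), Real.log_le_log (by linarith) (by linarith)⟩
  have hlv : ∀ p, Real.log (1 + val p) = p := fun p => by simp [val]
  have hvl : ∀ x : ℝ, 0 ≤ x → val (Real.log (1 + x)) = x := fun x hx => by
    simp only [val]; rw [Real.exp_log (by linarith)]; ring
  have hld : ∀ p q, ld (val p) (val q) = |p - q| := fun p q => by simp only [ld, hlv]
  -- The unknowns are log(1 + x_i) on the left copy of ℤ and log(1 + y_i) on the right. The new x_i
  -- solves relation i from x_{i+1} and y_i, the new y_i solves relation i - 1 from x_i and y_{i-1}.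
  -- A fixed point is an orbit because both solutions come from the same choice for each relation.
  let Φ : (ℤ ⊕ ℤ → ℝ) → ℤ ⊕ ℤ → ℝ := fun u => Sum.elim
    (fun i => Real.log (1 + X i (val (u (.inl (i + 1)))) (val (u (.inr i)))))
    (fun i => Real.log (1 + Y (i - 1) (val (u (.inl i))) (val (u (.inr (i - 1))))))
  have spec : ∀ u : ℤ ⊕ ℤ → ℝ, (∀ i, 0 ≤ u i ∧ u i ≤ Real.log 2) → ∀ i s : ℤ, s = i + 1 →
      _ := fun u hu i s _ =>
    hXY i (val (u (.inl s))) (val (u (.inr i))) (hval _ (hu _)).1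
      (hval _ (hu _)).2 (hval _ (hu _)).1 (hval _ (hu _)).2
  obtain ⟨u, hu, hfix⟩ := exists_fixed Φ (B := Real.log 2) (Real.log_nonneg (by norm_num)) h0 h1
    (by
      intro u hu
      rintro (i | i)
      · exact hlog _ (spec u hu i (i + 1) rfl).1
      · exact hlog _ (spec u hu (i - 1) i (by ring)).2.1)
    (by
      intro u v hu hv D hD
      have hm : ∀ a b, max (ld (val (u a)) (val (v a))) (ld (val (u b)) (val (v b))) ≤ D := by
        intro a b
        rw [hld, hld]
        exact max_le (hD a) (hD b)
      rintro (i | i)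
      · have := (hc i _ _ _ _ _ _ _ _ (hval _ (hu _)) (hval _ (hu _)) (hval _ (hv _))
          (hval _ (hv _)) (spec u hu i (i + 1) rfl).2.2 (spec v hv i (i + 1) rfl).2.2).1
        exact this.trans (mul_le_mul_of_nonneg_left (hm _ _) h0)
      · have := (hc (i - 1) _ _ _ _ _ _ _ _ (hval _ (hu _)) (hval _ (hu _)) (hval _ (hv _))
          (hval _ (hv _)) (spec u hu (i - 1) i (by ring)).2.2
          (spec v hv (i - 1) i (by ring)).2.2).2
        exact this.trans (mul_le_mul_of_nonneg_left (hm _ _) h0))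
  refine ⟨fun i => val (u (.inl i)), fun i => val (u (.inr i)), fun i =>
    ⟨hval _ (hu _), hval _ (hu _), ?_⟩⟩
  have S := spec u hu i (i + 1) rfl
  have e1 : val (u (.inl i)) = X i (val (u (.inl (i + 1)))) (val (u (.inr i))) := by
    conv_lhs => rw [← hfix]
    exact hvl _ S.1.1
  have e2 : val (u (.inr (i + 1))) = Y i (val (u (.inl (i + 1)))) (val (u (.inr i))) := by
    conv_lhs => rw [← hfix]
    simp only [Φ, Sum.elim_inr, add_sub_cancel_right]
    exact hvl _ S.2.1.1
  beta_reduce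
  rw [e1, e2]
  exact S.2.2

/-! ### Admissible break parameters and contraction rates -/

/-- The range of the break parameter. -/
structure Adm (c : ℝ) : Prop where
  lo : 1 / 2 < c
  hi : c < 2
  ne : c ≠ 1

theorem Adm.pos {c : ℝ} (h : Adm c) : 0 < c := by linarith [h.lo]

theorem Adm.sub_ne {c : ℝ} (h : Adm c) : c - 1 ≠ 0 := sub_ne_zero.2 h.ne

theorem Adm.inv {c : ℝ} (h : Adm c) : Adm (1 / c) := by
  have := h.pos
  refine ⟨?_, ?_, ?_⟩
  · rw [lt_div_iff₀ this]; linarith [h.hi]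
  · rw [div_lt_iff₀ this]; linarith [h.lo]
  · rw [ne_eq, div_eq_iff this.ne', one_mul]; exact h.ne.symm

/-- The parameter `δ = 1 - 1 / c` of the block maps. -/
def dl (c : ℝ) : ℝ := 1 - 1 / c

theorem Adm.dl_le {c : ℝ} (h : Adm c) : dl c ≤ 1 / 2 := by
  have := h.pos
  have : 1 / 2 ≤ 1 / c := by rw [div_le_div_iff₀ (by norm_num) this]; linarith [h.hi]
  rw [dl]; linarith

theorem Adm.le_dl {c : ℝ} (h : Adm c) : -1 ≤ dl c := by
  have := h.pos
  have : 1 / c ≤ 2 := by rw [div_le_iff₀ this]; linarith [h.lo]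
  rw [dl]; linarith

/-- The contraction rate of the block maps. -/
def rate (c : ℝ) : ℝ := max (9 / 10) (max (1 / c / 2) (c / 2))

theorem rate_inv (c : ℝ) : rate (1 / c) = rate c := by
  rw [rate, rate, one_div_one_div, max_comm (c / 2)]

theorem le_rate (c : ℝ) : 9 / 10 ≤ rate c := le_max_left _ _

theorem Adm.rate_lt {c : ℝ} (h : Adm c) : rate c < 1 := by
  have := h.inv.hi
  have := h.hi
  refine max_lt (by norm_num) (max_lt (by linarith) (by linarith))

/-- As 1 - δ = 1/c, this bound is the purpose of the term 1/c/2 in `rate`; the term c/2 does the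
same at level 1/c. -/
theorem dl_rate (c : ℝ) : 1 - dl c ≤ 2 * rate c := by
  have : 1 / c / 2 ≤ rate c := (le_max_left _ _).trans (le_max_right _ _)
  rw [dl]; linarith

/-- The logarithmic contraction rate of the block maps. -/
def lrate (c : ℝ) : ℝ := (1 + rate c) / 2

theorem lrate_inv (c : ℝ) : lrate (1 / c) = lrate c := by rw [lrate, lrate, rate_inv]

theorem lrate_nonneg (c : ℝ) : 0 ≤ lrate c := by
  have := le_rate c
  rw [lrate]; linarith

theorem Adm.lrate_lt {c : ℝ} (h : Adm c) : lrate c < 1 := by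
  have := h.rate_lt
  rw [lrate]; linarith

theorem Link.contract {c : ℝ} (hc : Adm c) {k : ℕ} (hk : 1 ≤ k) {x y x' y' u v u' v' : ℝ}
    (h : Link (dl c) k x y x' y') (h' : Link (dl c) k u v u' v')
    (bs : (x' ≤ 1 ∧ u' ≤ 1) ∨ x' = u') (bt : (y ≤ 1 ∧ v ≤ 1) ∨ y = v) :
    ld x u ≤ lrate c * max (ld x' u') (ld y v) ∧
      ld y' v' ≤ lrate c * max (ld x' u') (ld y v) :=
  ⟨h.contract_fst hk hc.dl_le hc.le_dl (le_rate c) hc.rate_lt.le (dl_rate c) h' bs bt,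
    h.contract_snd hk hc.dl_le hc.le_dl (le_rate c) hc.rate_lt.le (dl_rate c) h' bs bt⟩

/-! ### Coordinates -/

/-- The point with coordinates `x = a / c` and `y = c (c - 1 - v) / (a v)`. -/
def pt (c x y : ℝ) : ℝ × ℝ := (c * x, (c - 1) / (1 + x * y))

/-- The coordinate `x`. -/
def xc (c : ℝ) (q : ℝ × ℝ) : ℝ := q.1 / c

/-- The coordinate `y`. -/
def yc (c : ℝ) (q : ℝ × ℝ) : ℝ := c * (c - 1 - q.2) / (q.1 * q.2)

theorem xc_pt {c : ℝ} (hc : c ≠ 0) (x y : ℝ) : xc c (pt c x y) = x := by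
  simp [xc, pt, hc]

theorem yc_pt {c : ℝ} (hc : Adm c) {x y : ℝ} (hx : 0 < x) (hy : 0 ≤ y) :
    yc c (pt c x y) = y := by
  have h0 := hc.pos
  have h1 := hc.sub_ne
  have h2 : 0 < 1 + x * y := by positivity
  simp only [yc, pt]
  field_simp
  ring

theorem pt_xc_yc {c : ℝ} (hc : Adm c) {q : ℝ × ℝ} (h1 : q.1 ≠ 0) (h2 : q.2 ≠ 0) :
    pt c (xc c q) (yc c q) = q := by
  have h0 := hc.pos
  have h3 := hc.sub_ne
  have e : 1 + xc c q * yc c q = (c - 1) / q.2 := by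
    simp only [xc, yc]
    field_simp
    ring
  ext
  · simp only [pt, xc]; field_simp
  · simp only [pt]; rw [e]; field_simp

/-- The parameter σ = v/(c - 1) treats c < 1 and c > 1 together. In terms of it ω = aσ/c and y = c(1
- σ)/(aσ). -/
theorem Del_iff {c : ℝ} (hc : Adm c) {q : ℝ × ℝ} :
    q ∈ Del c ↔ q ∈ D c ∧ ∃ σ, 0 ≤ σ ∧ σ ≤ 1 ∧ q.2 = (c - 1) * σ := by
  constructor
  · rintro ⟨h, h1, h2⟩
    refine ⟨h, q.2 / (c - 1), ?_, ?_, ?_⟩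
    · rcases hc.sub_ne.lt_or_gt with h' | h'
      · rw [max_eq_left h'.le] at h2
        exact div_nonneg_of_nonpos h2 h'.le
      · rw [min_eq_left h'.le] at h1
        exact div_nonneg h1 h'.le
    · rcases hc.sub_ne.lt_or_gt with h' | h'
      · rw [min_eq_right h'.le] at h1
        rw [div_le_one_of_neg h']; exact h1
      · rw [max_eq_right h'.le] at h2
        rw [div_le_one h']; exact h2
    · rw [mul_div_cancel₀ _ hc.sub_ne]
  · rintro ⟨h, σ, h0, h1, h2⟩
    refine ⟨h, ?_, ?_⟩ <;> rw [h2]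
    · rcases le_total 0 (c - 1) with h' | h'
      · exact (min_le_left _ _).trans (mul_nonneg h' h0)
      · refine (min_le_right _ _).trans ?_; nlinarith
    · rcases le_total 0 (c - 1) with h' | h'
      · refine le_trans ?_ (le_max_right _ _); nlinarith
      · exact (mul_nonpos_of_nonpos_of_nonneg h' h0).trans (le_max_left _ _)

theorem one_sub_mul_pos {v X : ℝ} (hv : -1 < v) (h1 : -1 ≤ X) (h0 : X ≤ 0) : 0 < 1 - v * X := by
  rcases le_total 0 v with h | h <;> nlinarith

theorem one_le_height {c : ℝ} (hc : 0 < c) {q : ℝ × ℝ} (hq : q ∈ D c) {k : ℕ}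
    (hk : HasHeight c q k) : 1 ≤ k := by
  by_contra hcon
  have : k = 0 := by omega
  subst this
  have h2 := hk.1.2
  rw [G_zero hc hq] at h2
  simp only [zero_add, Function.iterate_one, F] at h2
  have hv := neg_one_lt hq
  have h3 := hq.2.1
  have : (q.1 + c * -1) / (1 - q.2 * -1) ≤ 0 :=
    div_nonpos_of_nonpos_of_nonneg (by linarith) (by linarith)
  linarith

/-- The orbit of a renormalizable point of `Δ_c` in the coordinate `ξ`. -/
theorem exists_block_of_height {c : ℝ} (hc : Adm c) {q : ℝ × ℝ} (hq : q ∈ Del c) {k : ℕ}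
    (hk : HasHeight c q k) (hq' : renorm c q ∈ D (1 / c)) :
    ∃ ξ : ℕ → ℝ, Block (dl c) (q.1 * q.2 / (c * (c - 1))) k ξ ∧ ξ 0 = c / q.1 ∧
      renorm c q = (ξ k / c, (1 / c - 1) * (1 - q.1 * q.2 / (c * (c - 1)) * ξ k)) ∧
      0 < ξ k ∧ ξ k < 1 := by
  have hcp := hc.pos
  have hc1 := hc.sub_ne
  obtain ⟨hD, σ, hσ0, hσ1, hσ⟩ := (Del_iff hc).1 hq
  have hv := neg_one_lt hD
  have ha := hD.1
  obtain ⟨hb, -, hr⟩ := renorm_eq hcp hD hk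
  have hk2 := hk.1.2
  rw [G_zero hcp hD, Function.iterate_succ_apply'] at hk2
  rw [hr] at hq'
  have hX := hq'.1
  simp only at hX
  refine ⟨fun j => -c * (F c q)^[j] (-1) / q.1, ⟨?_, ?_, ?_⟩, ?_, ?_, ?_, ?_⟩
  · intro j hj
    apply div_nonneg _ ha.le
    nlinarith [(hb j hj).2]
  · intro j hj
    obtain ⟨b1, b2⟩ := hb j hj
    have : q.1 * q.2 / (c * (c - 1)) * (-c * (F c q)^[j] (-1) / q.1)
        = σ * (-(F c q)^[j] (-1)) := by rw [hσ]; field_simp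
    rw [this]; nlinarith
  · intro j hj
    obtain ⟨b1, b2⟩ := hb j hj.le
    rw [Function.iterate_succ_apply']
    set X := (F c q)^[j] (-1)
    have hV := one_sub_mul_pos hv b1 b2
    have hY : F c q X * (1 - q.2 * X) = q.1 + c * X := div_mul_cancel₀ _ hV.ne'
    generalize F c q X = Y at *
    have e : q.1 * q.2 / (c * (c - 1)) * (-c * X / q.1) = - q.2 * X / (c - 1) := by field_simp
    rw [e, dl]
    field_simp
    linear_combination hY
  · simp
  · rw [hr]
    ext
    · simp only; field_simp
    · simp only; field_simp; ring
  · have : -c * (F c q)^[k] (-1) / q.1 = c * (-(F c q)^[k] (-1) / q.1) := by ring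
    beta_reduce
    rw [this]; positivity
  · obtain ⟨b1, b2⟩ := hb k le_rfl
    have hV := one_sub_mul_pos hv b1 b2
    have : 0 < q.1 + c * (F c q)^[k] (-1) := by
      have h := mul_pos hk2 hV
      rwa [F, div_mul_cancel₀ _ hV.ne'] at h
    beta_reduce
    rw [div_lt_one ha]; linarith

/-- Every block is the orbit of a renormalizable point of `Δ_c`. -/
theorem Block.height {c : ℝ} (hc : Adm c) {ω : ℝ} {k : ℕ} {ξ : ℕ → ℝ} (h : Block (dl c) ω k ξ)
    (hω : 0 ≤ ω) (hk : 1 ≤ k) (h0 : 0 < ξ k) (h1 : ξ k < 1) :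
    (c / ξ 0, (c - 1) * (ω * ξ 0)) ∈ Del c ∧ HasHeight c (c / ξ 0, (c - 1) * (ω * ξ 0)) k ∧
      renorm c (c / ξ 0, (c - 1) * (ω * ξ 0)) = (ξ k / c, (1 / c - 1) * (1 - ω * ξ k)) := by
  have hcp := hc.pos
  have hl := h.lower hω hc.dl_le (j := 0) (by omega)
  have n1 := h.nonneg 1 hk
  have anti := h.strictAnti hω hc.dl_le h1.le (j := 0) (by omega)
  have le0 := h.le 0 (by omega)
  simp only [zero_add] at hl anti
  have hξ0 : 1 ≤ ξ 0 := by linarith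
  have hξp : 0 < ξ 0 := by linarith
  have hσ : 0 ≤ ω * ξ 0 := mul_nonneg hω hξp.le
  set q : ℝ × ℝ := (c / ξ 0, (c - 1) * (ω * ξ 0)) with hq
  have ha : 0 < q.1 := div_pos hcp hξp
  have hv : -1 < q.2 := by
    have hlo := hc.lo
    change -1 < (c - 1) * (ω * ξ 0)
    nlinarith
  have den : ∀ ζ, 0 ≤ ζ → ω * ζ ≤ 1 → 0 < 1 + (c - 1) * (ω * ζ) := by
    intro ζ hζ hζ1
    have hlo := hc.lo
    have : 0 ≤ ω * ζ := mul_nonneg hω hζ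
    nlinarith
  have hF : ∀ ζ ζ', 0 ≤ ζ → ω * ζ ≤ 1 → ζ = ζ' + 1 - dl c * ζ' * (1 - ω * ζ) →
      F c q (-ζ / ξ 0) = -ζ' / ξ 0 := by
    intro ζ ζ' hζ hζ1 e
    have hd := den ζ hζ hζ1
    have e1 : 1 - q.2 * (-ζ / ξ 0) = 1 + (c - 1) * (ω * ζ) := by
      rw [hq]; field_simp; ring
    rw [F, e1, hq]
    rw [dl] at e
    rw [div_eq_div_iff hd.ne' hξp.ne']
    field_simp
    field_simp at e
    linear_combination -e
  have hX : ∀ j ≤ k, (F c q)^[j] (-1) = -ξ j / ξ 0 := by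
    intro j
    induction j with
    | zero => intro _; simp [neg_div, div_self hξp.ne']
    | succ j ih =>
      intro hj
      rw [Function.iterate_succ_apply', ih (by omega)]
      exact hF _ _ (h.nonneg j (by omega)) (h.le j (by omega)) (h.step j (by omega))
  have hD : q ∈ D c := by
    refine ⟨ha, ?_, ?_⟩
    · rw [hq]; exact div_le_self hcp.le hξ0
    · have e := hX 1 hk
      rw [Function.iterate_one, F, div_eq_div_iff (by linarith) hξp.ne'] at e
      have : ξ 0 * (q.1 + q.2 - (c - 1)) = (1 + q.2) * (ξ 0 - ξ 1) := by linear_combination e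
      have := mul_pos (show 0 < 1 + q.2 by linarith) (show 0 < ξ 0 - ξ 1 by linarith)
      have : 0 < ξ 0 * (q.1 + q.2 - (c - 1)) := by linarith
      have := (pos_iff_pos_of_mul_pos this).1 hξp
      linarith
  have hH : HasHeight c q k := by
    refine ⟨⟨?_, ?_⟩, ?_⟩
    · rw [G_zero hcp hD, hX k le_rfl]
      exact div_nonpos_of_nonpos_of_nonneg (by linarith) hξp.le
    · rw [G_zero hcp hD, Function.iterate_succ_apply', hX k le_rfl]
      have hk1 := h.le k le_rfl
      have e1 : 1 - q.2 * (-ξ k / ξ 0) = 1 + (c - 1) * (ω * ξ k) := by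
        rw [hq]; field_simp; ring
      rw [F, e1]
      apply div_pos _ (den _ h0.le hk1)
      have : q.1 + c * (-ξ k / ξ 0) = c * (1 - ξ k) / ξ 0 := by rw [hq]; field_simp; ring
      rw [this]
      apply div_pos (mul_pos hcp (by linarith)) hξp
    · rintro j ⟨-, hj⟩
      rw [G_zero hcp hD] at hj
      by_contra hcon
      rw [hX (j + 1) (by omega)] at hj
      have := h.nonneg (j + 1) (by omega)
      have : -ξ (j + 1) / ξ 0 ≤ 0 := div_nonpos_of_nonpos_of_nonneg (by linarith) hξp.le
      linarith
  refine ⟨(Del_iff hc).2 ⟨hD, ω * ξ 0, hσ, le0, rfl⟩, hH, ?_⟩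
  rw [(renorm_eq hcp hD hH).2.2, hX k le_rfl, hq]
  ext
  · simp only; field_simp
  · simp only; field_simp; ring

/-- The condition v ≠ 0 makes ω positive. On v = 0 the coordinate y is morally infinite, while `yc`
takes the junk value 0. -/
theorem link_of_height {c : ℝ} (hc : Adm c) {q : ℝ × ℝ} (hq : q ∈ Del c) (hv : q.2 ≠ 0) {k : ℕ}
    (hk : HasHeight c q k) (hq' : renorm c q ∈ D (1 / c)) :
    Link (dl c) k (xc c q) (yc c q) (xc (1 / c) (renorm c q)) (yc (1 / c) (renorm c q)) := by
  have hcp := hc.pos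
  have hc1 := hc.sub_ne
  obtain ⟨ξ, hB, e0, er, p0, p1⟩ := exists_block_of_height hc hq hk hq'
  obtain ⟨hD, σ, hσ0, hσ1, hσ⟩ := (Del_iff hc).1 hq
  have ha := hD.1
  have hσ' : 0 < σ := by
    rcases hσ0.lt_or_eq with h | h
    · exact h
    · exact absurd (by rw [hσ, ← h, mul_zero]) hv
  have eω : q.1 * q.2 / (c * (c - 1)) = q.1 * σ / c := by rw [hσ]; field_simp
  set ω := q.1 * q.2 / (c * (c - 1))
  have hω : 0 < ω := by rw [eω]; positivity
  have hωx : 0 < 1 - ω * ξ k := by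
    have l := hB.le 0 (by omega)
    have hl : ξ k < ξ 0 := by
      have := one_le_height hcp hD hk
      have := hB.lower hω.le hc.dl_le (j := 0) (by omega)
      have := hB.nonneg 1 (by omega)
      simp only [zero_add] at *
      linarith
    nlinarith
  have e1 : xc (1 / c) (renorm c q) = ξ k := by rw [er, xc]; field_simp
  refine ⟨ω, ξ, hB, hω, e1.symm, ?_, ?_, ?_⟩
  · rw [e0, xc]; field_simp
  · rw [e0, yc, eω, hσ]; field_simp; ring
  · rw [e1, er, yc]
    simp only
    have : (1 / c - 1) ≠ 0 := by
      intro h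
      apply hc1
      field_simp at h
      linarith
    have hx := p0.ne'
    have : 1 - c ≠ 0 := by intro h; apply hc1; linarith
    generalize ξ k = X at *
    have := hωx.ne'
    field_simp
    ring

/-- Converse to `link_of_height`, by which abstract solutions of the link relation become genuine
renormalizations. Strictness 0 < x' < 1 is what the definition of the height and the domain require.
-/
theorem Link.height {c : ℝ} (hc : Adm c) {k : ℕ} (hk : 1 ≤ k) {x y x' y' : ℝ}
    (h : Link (dl c) k x y x' y') (h0 : 0 < x') (h1 : x' < 1) :
    pt c x y ∈ Del c ∧ HasHeight c (pt c x y) k ∧ renorm c (pt c x y) = pt (1 / c) x' y' := by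
  obtain ⟨px, -, py, -, -⟩ := h.bounds hc.dl_le hk
  obtain ⟨py', -, -⟩ := h.bounds' hc.dl_le hk
  obtain ⟨ω, ξ, hB, hω, e1, e2, e3, e4⟩ := h
  have hcp := hc.pos
  have := hB.height hc hω.le hk (e1.symm ▸ h0) (e1.symm ▸ h1)
  have hx0 : ξ 0 ≠ 0 := by rintro h; rw [h] at e2; simp at e2
  have E : pt c x y = (c / ξ 0, (c - 1) * (ω * ξ 0)) := by
    have hp : 0 < 1 + x * y := by positivity
    ext
    · simp only [pt]; field_simp; linear_combination e2
    · simp only [pt]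
      rw [div_eq_iff hp.ne']
      have : ω * ξ 0 * (1 + x * y) = 1 := by linear_combination ω * y * e2 + e3
      linear_combination (-(c - 1)) * this
  rw [E]
  refine ⟨this.1, this.2.1, this.2.2.trans ?_⟩
  rw [e1]
  ext
  · simp only [pt]; ring
  · simp only [pt]
    have hp : 0 < 1 + x' * y' := by positivity
    rw [eq_div_iff hp.ne']
    have : (1 - ω * x') * (1 + x' * y') = 1 := by linear_combination x' * e4
    linear_combination (1 / c - 1) * this

theorem pt_mem_Del {c : ℝ} (hc : Adm c) {x y : ℝ} (hx : 0 < x) (hx1 : x ≤ 1) (hy : 0 ≤ y)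
    (hy1 : y ≤ 1) : pt c x y ∈ Del c := by
  have hcp := hc.pos
  have hp : 0 < 1 + x * y := by positivity
  have hxy : 0 ≤ x * y := by positivity
  refine (Del_iff hc).2 ⟨⟨?_, ?_, ?_⟩, 1 / (1 + x * y), by positivity, ?_, ?_⟩
  · exact mul_pos hcp hx
  · simp only [pt]; nlinarith
  · simp only [pt]
    have : c * x + (c - 1) / (1 + x * y) - (c - 1) = x * (c + c * x * y - (c - 1) * y) / (1 + x * y) := by
      field_simp; ring
    have h2 : 0 < c + c * x * y - (c - 1) * y := by
      have := mul_nonneg hcp.le hxy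
      nlinarith [hc.hi, hc.lo]
    have : 0 < x * (c + c * x * y - (c - 1) * y) / (1 + x * y) := by positivity
    linarith
  · rw [div_le_one hp]; linarith
  · simp only [pt]; ring

/-! ### Orbits of renormalizations and their levels -/

/-- The successive renormalizations. -/
def orb : ℝ → ℝ × ℝ → ℕ → ℝ × ℝ
  | _, q, 0 => q
  | c, q, n + 1 => orb (1 / c) (renorm c q) n

/-- The break parameters of the successive renormalizations. -/
def lev : ℝ → ℕ → ℝ
  | c, 0 => c
  | c, n + 1 => lev (1 / c) n

theorem lev_zero (c : ℝ) : lev c 0 = c := rfl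

theorem lev_succ (c : ℝ) (n : ℕ) : lev c (n + 1) = lev (1 / c) n := rfl

theorem lev_inv (c : ℝ) (n : ℕ) : lev (1 / c) n = 1 / lev c n := by
  induction n generalizing c with
  | zero => rfl
  | succ n ih => rw [lev_succ, lev_succ, ih]

theorem lev_add (c : ℝ) (m n : ℕ) : lev c (m + n) = lev (lev c m) n := by
  induction m generalizing c with
  | zero => rw [zero_add]; rfl
  | succ m ih => rw [Nat.add_right_comm, lev_succ, ih, lev_succ]

theorem lev_two_mul (c : ℝ) (n : ℕ) : lev c (2 * n) = c := by
  induction n with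
  | zero => rfl
  | succ n ih => rw [Nat.mul_succ, lev_succ, lev_succ, one_div_one_div, ih]

theorem Adm.lev {c : ℝ} (hc : Adm c) (n : ℕ) : Adm (lev c n) := by
  induction n generalizing c with
  | zero => exact hc
  | succ n ih => exact ih hc.inv

theorem lrate_lev (c : ℝ) (n : ℕ) : lrate (lev c n) = lrate c := by
  induction n generalizing c with
  | zero => rfl
  | succ n ih => rw [lev_succ, ih, lrate_inv]

theorem orb_succ (c : ℝ) (q : ℝ × ℝ) (n : ℕ) : orb c q (n + 1) = orb (1 / c) (renorm c q) n := rfl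

theorem orb_add (c : ℝ) (q : ℝ × ℝ) (m n : ℕ) :
    orb c q (m + n) = orb (lev c m) (orb c q m) n := by
  induction m generalizing c q with
  | zero => rw [zero_add]; rfl
  | succ m ih => rw [Nat.add_right_comm, orb_succ, ih, orb_succ, lev_succ]

theorem orb_succ' (c : ℝ) (q : ℝ × ℝ) (n : ℕ) :
    orb c q (n + 1) = renorm (lev c n) (orb c q n) := orb_add c q n 1

theorem T_iterate (c : ℝ) (q : ℝ × ℝ) (n : ℕ) : (T c)^[n] q = orb c q (2 * n) := by
  induction n generalizing q with
  | zero => rfl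
  | succ n ih =>
    rw [Function.iterate_succ_apply, ih, Nat.mul_succ, orb_succ, orb_succ, one_div_one_div]
    rfl

theorem HasHeights.head {n : ℕ} {c : ℝ} {q : ℝ × ℝ} {s : ℕ → ℕ} (h : HasHeights n c q s) :
    q ∈ D c := by
  cases n with
  | zero => exact h
  | succ n => exact h.1

theorem hasHeights_iff {n : ℕ} {c : ℝ} {q : ℝ × ℝ} {s : ℕ → ℕ} :
    HasHeights n c q s ↔ (∀ i < n, HasHeight (lev c i) (orb c q i) (s i)) ∧
      ∀ i ≤ n, orb c q i ∈ D (lev c i) := by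
  induction n generalizing c q s with
  | zero => simp [HasHeights, orb, lev]
  | succ n ih =>
    simp only [HasHeights, ih]
    constructor
    · rintro ⟨h1, h2, h3, h4⟩
      refine ⟨fun i hi => ?_, fun i hi => ?_⟩
      · rcases i with _ | i
        · exact h2
        · exact h3 i (by omega)
      · rcases i with _ | i
        · exact h1
        · exact h4 i (by omega)
    · rintro ⟨h1, h2⟩
      exact ⟨h2 0 (by omega), h1 0 (by omega), fun i hi => h1 (i + 1) (by omega),
        fun i hi => h2 (i + 1) (by omega)⟩

theorem HasHeights.mono {m n : ℕ} (hmn : m ≤ n) {c : ℝ} {q : ℝ × ℝ} {s : ℕ → ℕ}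
    (h : HasHeights n c q s) : HasHeights m c q s := by
  rw [hasHeights_iff] at *
  exact ⟨fun i hi => h.1 i (by omega), fun i hi => h.2 i (by omega)⟩

theorem HasHeights.congr {n : ℕ} {c : ℝ} {q : ℝ × ℝ} {s s' : ℕ → ℕ}
    (h : HasHeights n c q s) (hs : ∀ i < n, s i = s' i) : HasHeights n c q s' := by
  rw [hasHeights_iff] at *
  exact ⟨fun i hi => hs i hi ▸ h.1 i hi, h.2⟩

theorem HasHeight.unique {c : ℝ} {q : ℝ × ℝ} {k l : ℕ} (h : HasHeight c q k)
    (h' : HasHeight c q l) : k = l := IsLeast.unique h h'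

/-! ### Points of `Δ_c` -/

/-- Δ is absorbing and one renormalization regularizes: whatever the point of Δ_c, its image has v ≠
0, 0 < x < 1 and 0 ≤ y ≤ 1, the range where `Link.contract` applies. -/
theorem step_Del {c : ℝ} (hc : Adm c) {q : ℝ × ℝ} (hq : q ∈ Del c) {k : ℕ}
    (hk : HasHeight c q k) (hq' : renorm c q ∈ D (1 / c)) :
    renorm c q ∈ Del (1 / c) ∧ (renorm c q).2 ≠ 0 ∧ 0 < xc (1 / c) (renorm c q) ∧
      xc (1 / c) (renorm c q) < 1 ∧ 0 ≤ yc (1 / c) (renorm c q) ∧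
      yc (1 / c) (renorm c q) ≤ 1 := by
  have hcp := hc.pos
  obtain ⟨ξ, hB, e0, er, p0, p1⟩ := exists_block_of_height hc hq hk hq'
  obtain ⟨hD, σ, hσ0, hσ1, hσ⟩ := (Del_iff hc).1 hq
  have ha := hD.1
  have hc1 := hc.sub_ne
  have hk1 := one_le_height hcp hD hk
  have eω : q.1 * q.2 / (c * (c - 1)) = q.1 * σ / c := by rw [hσ]; field_simp
  have hω : 0 ≤ q.1 * q.2 / (c * (c - 1)) := by rw [eω]; positivity
  have l0 := hB.le 0 (by omega)
  have lk := hB.le k le_rfl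
  have hl : ξ k < ξ 0 := by
    have := hB.lower hω hc.dl_le (j := 0) (by omega)
    have := hB.nonneg 1 (by omega)
    simp only [zero_add] at *
    linarith
  have hpos : 0 < 1 - q.1 * q.2 / (c * (c - 1)) * ξ k := by
    rcases hω.lt_or_eq with h | h
    · nlinarith
    · rw [← h]; norm_num
  have hne : (renorm c q).2 ≠ 0 := by
    rw [er]; exact mul_ne_zero hc.inv.sub_ne hpos.ne'
  have hx : xc (1 / c) (renorm c q) = ξ k := by rw [er, xc]; field_simp
  have hy : 0 ≤ yc (1 / c) (renorm c q) ∧ yc (1 / c) (renorm c q) ≤ 1 := by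
    -- On v = 0 the image has second parameter exactly 1/c - 1, so its y vanishes.
    by_cases hv : q.2 = 0
    · have : yc (1 / c) (renorm c q) = 0 := by rw [er, hv, yc]; simp
      rw [this]; norm_num
    · have := (link_of_height hc hq hv hk hq').bounds' hc.dl_le hk1
      exact ⟨this.1.le, this.2.1⟩
  refine ⟨(Del_iff hc.inv).2 ⟨hq', _, hpos.le, ?_, by rw [er]⟩, hne, hx ▸ p0, hx ▸ p1, hy⟩
  have := mul_nonneg hω p0.le
  linarith

theorem xc_bounds {c : ℝ} (hc : Adm c) {q : ℝ × ℝ} (hq : q ∈ D c) : 0 < xc c q ∧ xc c q ≤ 1 :=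
  ⟨div_pos hq.1 hc.pos, (div_le_one hc.pos).2 hq.2.1⟩

theorem yc_nonneg {c : ℝ} (hc : Adm c) {q : ℝ × ℝ} (hq : q ∈ Del c) : 0 ≤ yc c q := by
  obtain ⟨hD, σ, hσ0, hσ1, hσ⟩ := (Del_iff hc).1 hq
  have ha := hD.1
  have hcp := hc.pos
  have : yc c q = c * (1 - σ) * (c - 1) / ((q.1 * σ) * (c - 1)) := by rw [yc, hσ]; ring
  rw [this, mul_div_mul_right _ _ hc.sub_ne]
  exact div_nonneg (mul_nonneg hcp.le (by linarith)) (by positivity)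

theorem orb_Del {c : ℝ} (hc : Adm c) {q : ℝ × ℝ} (hq : q ∈ Del c) {n : ℕ} {s : ℕ → ℕ}
    (h : HasHeights n c q s) : ∀ i ≤ n, orb c q i ∈ Del (lev c i) := by
  rw [hasHeights_iff] at h
  intro i
  induction i with
  | zero => intro _; exact hq
  | succ i ih =>
    intro hi
    rw [orb_succ', lev_succ, lev_inv]
    refine (step_Del (hc.lev i) (ih (by omega)) (h.1 i (by omega)) ?_).1
    rw [← orb_succ', ← lev_inv]
    exact h.2 (i + 1) hi

theorem orb_facts {c : ℝ} (hc : Adm c) {q : ℝ × ℝ} (hq : q ∈ Del c) {n : ℕ} {s : ℕ → ℕ}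
    (h : HasHeights n c q s) {i : ℕ} (hi : i < n) : (orb c q (i + 1)).2 ≠ 0 ∧
      0 < xc (lev c (i + 1)) (orb c q (i + 1)) ∧ xc (lev c (i + 1)) (orb c q (i + 1)) < 1 ∧
      0 ≤ yc (lev c (i + 1)) (orb c q (i + 1)) ∧ yc (lev c (i + 1)) (orb c q (i + 1)) ≤ 1 := by
  have hd := orb_Del hc hq h i hi.le
  rw [hasHeights_iff] at h
  have := h.2 (i + 1) hi
  rw [orb_succ', lev_succ, lev_inv] at *
  exact (step_Del (hc.lev i) hd (h.1 i hi) this).2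

theorem orb_link {c : ℝ} (hc : Adm c) {q : ℝ × ℝ} (hq : q ∈ Del c) (hv : q.2 ≠ 0) {n : ℕ}
    {s : ℕ → ℕ} (h : HasHeights n c q s) {i : ℕ} (hi : i < n) :
    1 ≤ s i ∧ Link (dl (lev c i)) (s i) (xc (lev c i) (orb c q i)) (yc (lev c i) (orb c q i))
      (xc (lev c (i + 1)) (orb c q (i + 1))) (yc (lev c (i + 1)) (orb c q (i + 1))) := by
  have hd := orb_Del hc hq h i hi.le
  have hne : (orb c q i).2 ≠ 0 := by
    rcases i with _ | i
    · exact hv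
    · exact (orb_facts hc hq h (by omega : i < n)).1
  rw [hasHeights_iff] at h
  have := h.2 (i + 1) hi
  refine ⟨one_le_height (hc.lev i).pos hd.1 (h.1 i hi), ?_⟩
  rw [orb_succ', lev_succ, lev_inv] at *
  exact link_of_height (hc.lev i) hd hne (h.1 i hi) this

/-- Two points with the same heights. -/
theorem orb_cross {c : ℝ} (hc : Adm c) {q q' : ℝ × ℝ} (hq : q ∈ Del c) (hq' : q' ∈ Del c)
    (hv : q.2 ≠ 0) (hv' : q'.2 ≠ 0) (hy : yc c q ≤ 1) (hy' : yc c q' ≤ 1) {n : ℕ} {s : ℕ → ℕ}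
    (h : HasHeights n c q s) (h' : HasHeights n c q' s) {i : ℕ} (hi : i < n) :
    ld (xc (lev c i) (orb c q i)) (xc (lev c i) (orb c q' i)) ≤ lrate c *
      max (ld (xc (lev c (i + 1)) (orb c q (i + 1))) (xc (lev c (i + 1)) (orb c q' (i + 1))))
        (ld (yc (lev c i) (orb c q i)) (yc (lev c i) (orb c q' i))) ∧
    ld (yc (lev c (i + 1)) (orb c q (i + 1))) (yc (lev c (i + 1)) (orb c q' (i + 1))) ≤ lrate c *
      max (ld (xc (lev c (i + 1)) (orb c q (i + 1))) (xc (lev c (i + 1)) (orb c q' (i + 1))))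
        (ld (yc (lev c i) (orb c q i)) (yc (lev c i) (orb c q' i))) := by
  have l := orb_link hc hq hv h hi
  have l' := orb_link hc hq' hv' h' hi
  rw [← lrate_lev c i]
  refine l.2.contract (hc.lev i) l.1 l'.2 (Or.inl ⟨?_, ?_⟩) (Or.inl ⟨?_, ?_⟩)
  · exact (orb_facts hc hq h hi).2.2.1.le
  · exact (orb_facts hc hq' h' hi).2.2.1.le
  · rcases i with _ | i
    · exact hy
    · exact (orb_facts hc hq h (by omega : i < n)).2.2.2.2
  · rcases i with _ | i
    · exact hy'
    · exact (orb_facts hc hq' h' (by omega : i < n)).2.2.2.2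

/-- All later x lie in (0, 1], so their distances are bounded and `cross_future` applies to the pair
of orbits. -/
theorem future_contract {c : ℝ} (hc : Adm c) {q q' : ℝ × ℝ} (hq : q ∈ Del c) (hq' : q' ∈ Del c)
    (hv : q.2 ≠ 0) (hv' : q'.2 ≠ 0) (hy : yc c q ≤ 1) (hy' : yc c q' ≤ 1) {s : ℕ → ℕ}
    (h : ∀ n, HasHeights n c q s) (h' : ∀ n, HasHeights n c q' s) (i : ℕ) :
    ld (xc (lev c i) (orb c q i)) (xc (lev c i) (orb c q' i))
      ≤ lrate c * ld (yc (lev c i) (orb c q i)) (yc (lev c i) (orb c q' i)) ∧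
    ld (yc (lev c i) (orb c q i)) (yc (lev c i) (orb c q' i))
      ≤ lrate c ^ i * ld (yc c q) (yc c q') := by
  have := cross_future (lrate_nonneg c) hc.lrate_lt (B := Real.log 2)
    (d := fun i => ld (xc (lev c i) (orb c q i)) (xc (lev c i) (orb c q' i)))
    (e := fun i => ld (yc (lev c i) (orb c q i)) (yc (lev c i) (orb c q' i)))
    (fun _ => ld_nonneg _ _) (fun _ => ld_nonneg _ _) (fun i => by
      have b := xc_bounds (hc.lev i) (orb_Del hc hq (h i) i le_rfl).1
      have b' := xc_bounds (hc.lev i) (orb_Del hc hq' (h' i) i le_rfl).1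
      exact ld_le_log_two b.1.le b.2 b'.1.le b'.2)
    (fun i => orb_cross hc hq hq' hv hv' hy hy' (h (i + 1)) (h' (i + 1)) (Nat.lt_succ_self i))
  exact ⟨this.1 i, this.2 i⟩

theorem eq_of_coords {c : ℝ} (hc : Adm c) {q q' : ℝ × ℝ} (hq : q ∈ Del c) (hq' : q' ∈ Del c)
    (hv : q.2 ≠ 0) (hv' : q'.2 ≠ 0) (hx : ld (xc c q) (xc c q') ≤ 0)
    (hy : ld (yc c q) (yc c q') ≤ 0) : q = q' := by
  rw [← pt_xc_yc hc hq.1.1.ne' hv, ← pt_xc_yc hc hq'.1.1.ne' hv',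
    eq_of_ld (xc_bounds hc hq.1).1.le (xc_bounds hc hq'.1).1.le hx,
    eq_of_ld (yc_nonneg hc hq) (yc_nonneg hc hq') hy]

/-! ### Existence of orbits -/

/-- A chain of links with x in (0, 1) and y in [0, 1] is the coordinate form of an actual orbit of
renormalizations; `Link.height` is applied step by step. -/
theorem hasHeights_pt (n : ℕ) {c : ℝ} (hc : Adm c) {x y : ℕ → ℝ} {s : ℕ → ℕ}
    (hx : ∀ i ≤ n, 0 < x i ∧ x i < 1) (hy : ∀ i ≤ n, 0 ≤ y i ∧ y i ≤ 1)
    (hs : ∀ i < n, 1 ≤ s i)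
    (hl : ∀ i < n, Link (dl (lev c i)) (s i) (x i) (y i) (x (i + 1)) (y (i + 1))) :
    HasHeights n c (pt c (x 0) (y 0)) s ∧
      ∀ i ≤ n, orb c (pt c (x 0) (y 0)) i = pt (lev c i) (x i) (y i) := by
  induction n generalizing c x y s with
  | zero =>
    have hx := hx 0 le_rfl
    have hy := hy 0 le_rfl
    refine ⟨(pt_mem_Del hc hx.1 hx.2.le hy.1 hy.2).1, fun i hi => ?_⟩
    have : i = 0 := by omega
    subst this
    rfl
  | succ n ih =>
    have h0 := (hl 0 (by omega)).height hc (hs 0 (by omega)) (hx 1 (by omega)).1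
      (hx 1 (by omega)).2
    have IH := ih hc.inv (x := fun i => x (i + 1)) (y := fun i => y (i + 1))
      (s := fun i => s (i + 1)) (fun i hi => hx _ (by omega)) (fun i hi => hy _ (by omega))
      (fun i hi => hs _ (by omega)) (fun i hi => hl (i + 1) (by omega))
    simp only [zero_add] at IH
    rw [← h0.2.2] at IH
    refine ⟨⟨h0.1.1, h0.2.1, IH.1⟩, fun i hi => ?_⟩
    rcases i with _ | i
    · rfl
    · exact IH.2 i (by omega)

/-- The break parameter at time `i` of a two-sided orbit. -/
def levZ (c : ℝ) (i : ℤ) : ℝ := if Even i then c else 1 / c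

theorem levZ_cases (c : ℝ) (i : ℤ) : levZ c i = c ∨ levZ c i = 1 / c := by
  by_cases h : Even i <;> simp [levZ, h]

theorem Adm.levZ {c : ℝ} (hc : Adm c) (i : ℤ) : Adm (levZ c i) := by
  rcases levZ_cases c i with h | h <;> rw [h]
  exacts [hc, hc.inv]

theorem lrate_levZ (c : ℝ) (i : ℤ) : lrate (levZ c i) = lrate c := by
  rcases levZ_cases c i with h | h <;> rw [h]
  exact lrate_inv c

theorem lev_eq (c : ℝ) (n : ℕ) : lev c n = if Even n then c else 1 / c := by
  induction n with
  | zero => simp [lev]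
  | succ n ih =>
    rw [lev_succ, lev_inv, ih]
    by_cases h : Even n <;> simp [h, Nat.even_add_one]

theorem levZ_add (c : ℝ) (k n : ℕ) : levZ c ((n : ℤ) - 2 * k) = lev c n := by
  rw [levZ, lev_eq]
  have : Even ((n : ℤ) - 2 * k) ↔ Even n := by
    rw [Int.even_sub]
    simp
  simp [this]

/-- Two-sided orbits with given heights. -/
theorem exists_full {c : ℝ} (hc : Adm c) (r : ℤ → ℕ) (hr : ∀ i, 1 ≤ r i) :
    ∃ x y : ℤ → ℝ, ∀ i, (0 < x i ∧ x i < 1) ∧ (0 < y i ∧ y i < 1) ∧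
      Link (dl (levZ c i)) (r i) (x i) (y i) (x (i + 1)) (y (i + 1)) := by
  obtain ⟨x, y, h⟩ := exists_orbit (fun i => Link (dl (levZ c i)) (r i)) (lrate_nonneg c)
    hc.lrate_lt (fun i x' y h0 _ h2 _ => by
      obtain ⟨x, y', hl⟩ := exists_link (hc.levZ i).dl_le (hc.levZ i).le_dl (hr i) h0 h2
      have b := hl.bounds (hc.levZ i).dl_le (hr i)
      have b' := hl.bounds' (hc.levZ i).dl_le (hr i)
      exact ⟨x, y', ⟨b.1.le, b.2.1⟩, ⟨b'.1.le, b'.2.1⟩, hl⟩)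
    (fun i x y x' y' u v u' v' h1 h2 h3 h4 l l' => by
      rw [← lrate_levZ c i]
      exact l.contract (hc.levZ i) (hr i) l' (Or.inl ⟨h1.2, h3.2⟩) (Or.inl ⟨h2.2, h4.2⟩))
  have px : ∀ i, 0 < x i := fun i => ((h i).2.2.bounds (hc.levZ i).dl_le (hr i)).1
  have py' : ∀ i, 0 < y (i + 1) := fun i => ((h i).2.2.bounds' (hc.levZ i).dl_le (hr i)).1
  have py : ∀ i, 0 < y i := fun i => by simpa using py' (i - 1)
  refine ⟨x, y, fun i => ⟨⟨px i, ?_⟩, ⟨py i, ?_⟩, (h i).2.2⟩⟩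
  · exact ((h i).2.2.bounds (hc.levZ i).dl_le (hr i)).2.2.2.2 (px _)
  · have := ((h (i - 1)).2.2.bounds' (hc.levZ (i - 1)).dl_le (hr (i - 1))).2.2 (py _)
    simpa using this

/-- One-sided orbits with given heights and initial coordinate `y`. -/
theorem exists_future {c : ℝ} (hc : Adm c) (s : ℕ → ℕ) (hs : ∀ i, 1 ≤ s i) {y₀ : ℝ}
    (h0 : 0 ≤ y₀) (h1 : y₀ ≤ 1) :
    ∃ x y : ℕ → ℝ, y 0 = y₀ ∧ ∀ i, (0 < x i ∧ x i < 1) ∧ (0 ≤ y i ∧ y i ≤ 1) ∧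
      (0 < y₀ → y₀ < 1 → 0 < y i ∧ y i < 1) ∧
      Link (dl (lev c i)) (s i) (x i) (y i) (x (i + 1)) (y (i + 1)) := by
  have L : ∀ i : ℤ, Adm (lev c i.toNat) := fun i => hc.lev _
  -- At negative times the relation is the constant one, x = 0 and y' = y₀. It is trivially
  -- contracting, and at time -1 it prescribes y_0 = y₀.
  obtain ⟨x, y, h⟩ := exists_orbit (fun i x y x' y' =>
      (0 ≤ i → Link (dl (lev c i.toNat)) (s i.toNat) x y x' y') ∧ (i < 0 → x = 0 ∧ y' = y₀))
    (lrate_nonneg c) hc.lrate_lt (fun i x' y h0' _ h2 _ => by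
      by_cases hi : 0 ≤ i
      · obtain ⟨x, y', hl⟩ := exists_link (L i).dl_le (L i).le_dl (hs i.toNat) h0' h2
        have b := hl.bounds (L i).dl_le (hs _)
        have b' := hl.bounds' (L i).dl_le (hs _)
        exact ⟨x, y', ⟨b.1.le, b.2.1⟩, ⟨b'.1.le, b'.2.1⟩, fun _ => hl, fun h => by omega⟩
      · exact ⟨0, y₀, ⟨le_rfl, zero_le_one⟩, ⟨h0, h1⟩, fun h => absurd h hi, fun _ => ⟨rfl, rfl⟩⟩)
    (fun i x y x' y' u v u' v' h1 h2 h3 h4 l l' => by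
      by_cases hi : 0 ≤ i
      · rw [← lrate_lev c i.toNat]
        exact (l.1 hi).contract (L i) (hs _) (l'.1 hi) (Or.inl ⟨h1.2, h3.2⟩)
          (Or.inl ⟨h2.2, h4.2⟩)
      · obtain ⟨rfl, rfl⟩ := l.2 (by omega)
        obtain ⟨rfl, rfl⟩ := l'.2 (by omega)
        have : 0 ≤ lrate c * max (ld x' u') (ld y v) :=
          mul_nonneg (lrate_nonneg c) ((ld_nonneg _ _).trans (le_max_left _ _))
        rw [ld_self, ld_self]
        exact ⟨this, this⟩)
  have hy0 : y 0 = y₀ := by simpa using ((h (-1)).2.2.2 (by norm_num)).2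
  have hL : ∀ i : ℕ, Link (dl (lev c i)) (s i) (x i) (y i) (x (i + 1)) (y (i + 1)) := fun i => by
    have := (h i).2.2.1 (by omega)
    simpa using this
  have px : ∀ i : ℕ, 0 < x i := fun i => ((hL i).bounds (hc.lev i).dl_le (hs i)).1
  refine ⟨fun i => x i, fun i => y i, hy0, fun i => ⟨⟨px i, ?_⟩, (h i).2.1, ?_, ?_⟩⟩
  · have := px (i + 1)
    push_cast at this
    exact ((hL i).bounds (hc.lev i).dl_le (hs i)).2.2.2.2 this
  · intro p0 p1
    induction i with
    | zero => simp only [Nat.cast_zero, hy0]; exact ⟨p0, p1⟩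
    | succ i ih =>
      have := (hL i).bounds' (hc.lev i).dl_le (hs i)
      push_cast
      exact ⟨this.1, this.2.2 ih.1⟩
  · have := hL i
    push_cast
    exact this

/-! ### The local stable graph -/

theorem continuousOn_of_ld {h : ℝ → ℝ} {s : Set ℝ} {κ : ℝ} (hs : ∀ y ∈ s, 0 ≤ y)
    (hp : ∀ y ∈ s, 0 ≤ h y) (hl : ∀ y ∈ s, ∀ y' ∈ s, ld (h y) (h y') ≤ κ * ld y y') :
    ContinuousOn h s := by
  have hL : ContinuousOn (fun y => Real.log (1 + h y)) s := by
    intro y hy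
    rw [ContinuousWithinAt, tendsto_iff_dist_tendsto_zero]
    have hlog : ContinuousWithinAt (fun y' => Real.log (1 + y')) s y := by
      apply ContinuousAt.continuousWithinAt
      have := hs y hy
      apply ContinuousAt.log (by fun_prop)
      linarith
    have lim : Tendsto (fun y' => κ * dist (Real.log (1 + y')) (Real.log (1 + y))) (𝓝[s] y)
        (𝓝 (κ * 0)) := (tendsto_iff_dist_tendsto_zero.1 hlog).const_mul κ
    rw [mul_zero] at lim
    refine squeeze_zero' (Eventually.of_forall fun _ => dist_nonneg) ?_ lim
    filter_upwards [self_mem_nhdsWithin] with y' hy'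
    exact hl y' hy' y hy
  refine (hL.rexp.sub (continuousOn_const (c := (1 : ℝ)))).congr fun y hy => ?_
  have := hp y hy
  simp only [Pi.sub_apply]
  rw [Real.exp_log (by linarith)]
  ring

theorem pt_snd_ne {c : ℝ} (hc : Adm c) {x y : ℝ} (hx : 0 < x) (hy : 0 ≤ y) : (pt c x y).2 ≠ 0 := by
  have : 0 < 1 + x * y := by positivity
  exact div_ne_zero hc.sub_ne this.ne'

/-- The points with given heights and `0 ≤ y ≤ 1` form a graph. -/
theorem exists_stable_graph {c : ℝ} (hc : Adm c) (s : ℕ → ℕ) (hs : ∀ i, 1 ≤ s i) :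
    ∃ h : ℝ → ℝ, (∀ y, 0 ≤ y → y ≤ 1 → 0 < h y ∧ h y < 1 ∧
        ∀ n, HasHeights n c (pt c (h y) y) s) ∧
      (∀ x y, 0 < x → x ≤ 1 → 0 ≤ y → y ≤ 1 → (∀ n, HasHeights n c (pt c x y) s) → x = h y) ∧
      (∀ y y', 0 ≤ y → y ≤ 1 → 0 ≤ y' → y' ≤ 1 → ld (h y) (h y') ≤ lrate c * ld y y') ∧
      ContinuousOn h (Set.Icc 0 1) := by
  have ex : ∀ y, ∃ x, 0 ≤ y → y ≤ 1 → 0 < x ∧ x < 1 ∧ ∀ n, HasHeights n c (pt c x y) s := by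
    intro y
    by_cases hy : 0 ≤ y ∧ y ≤ 1
    · obtain ⟨x, Y, h0, h⟩ := exists_future hc s hs hy.1 hy.2
      refine ⟨x 0, fun _ _ => ⟨(h 0).1.1, (h 0).1.2, fun n => ?_⟩⟩
      rw [← h0]
      exact (hasHeights_pt n hc (fun i _ => (h i).1) (fun i _ => (h i).2.1) (fun i _ => hs i)
        (fun i _ => (h i).2.2.2)).1
    · exact ⟨0, fun a b => absurd ⟨a, b⟩ hy⟩
  choose h hh using ex
  have con : ∀ x y x' y', 0 < x → x ≤ 1 → 0 ≤ y → y ≤ 1 → 0 < x' → x' ≤ 1 → 0 ≤ y' → y' ≤ 1 →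
      (∀ n, HasHeights n c (pt c x y) s) → (∀ n, HasHeights n c (pt c x' y') s) →
      ld x x' ≤ lrate c * ld y y' := by
    intro x y x' y' a1 a2 a3 a4 b1 b2 b3 b4 H H'
    have ey := yc_pt hc a1 a3
    have ey' := yc_pt hc b1 b3
    have := (future_contract hc (pt_mem_Del hc a1 a2 a3 a4) (pt_mem_Del hc b1 b2 b3 b4)
      (pt_snd_ne hc a1 a3) (pt_snd_ne hc b1 b3) (ey.trans_le a4) (ey'.trans_le b4) H H' 0).1
    simpa only [lev, orb, ey, ey', xc_pt hc.pos.ne'] using this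
  have lip : ∀ y y', 0 ≤ y → y ≤ 1 → 0 ≤ y' → y' ≤ 1 → ld (h y) (h y') ≤ lrate c * ld y y' := by
    intro y y' a1 a2 b1 b2
    obtain ⟨p1, p2, p3⟩ := hh y a1 a2
    obtain ⟨q1, q2, q3⟩ := hh y' b1 b2
    exact con _ _ _ _ p1 p2.le a1 a2 q1 q2.le b1 b2 p3 q3
  refine ⟨h, hh, ?_, lip, continuousOn_of_ld (κ := lrate c) (fun y hy => hy.1)
    (fun y hy => (hh y hy.1 hy.2).1.le)
    (fun y hy y' hy' => lip y y' hy.1 hy.2 hy'.1 hy'.2)⟩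
  intro x y a1 a2 a3 a4 H
  obtain ⟨q1, q2, q3⟩ := hh y a3 a4
  have := con _ _ _ _ a1 a2 a3 a4 q1 q2.le a3 a4 H q3
  rw [ld_self, mul_zero] at this
  exact eq_of_ld a1.le q1.le this

/-! ### Time reversal -/

/-- The time reversal. -/
def dual (c : ℝ) (q : ℝ × ℝ) : ℝ × ℝ := pt (1 / c) (yc c q) (xc c q)

theorem dual_dual {c : ℝ} (hc : Adm c) {q : ℝ × ℝ} (h1 : 0 < q.1) (h2 : q.2 ≠ 0)
    (hy : 0 < yc c q) : dual (1 / c) (dual c q) = q := by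
  have hx : 0 < xc c q := div_pos h1 hc.pos
  rw [dual, dual, yc_pt hc.inv hy hx.le, xc_pt hc.inv.pos.ne', one_div_one_div,
    pt_xc_yc hc h1.ne' h2]

theorem lev_lev_sub (c : ℝ) {i n : ℕ} (hi : i ≤ n) : lev (lev c n) i = lev c (n - i) := by
  obtain ⟨j, rfl⟩ : ∃ j, n = j + i := ⟨n - i, by omega⟩
  rw [lev_add, ← lev_add, ← two_mul, lev_two_mul, Nat.add_sub_cancel]

/-- Apply `Link.symm` to every step. In the reversed orbit y plays the part of x, which must lie in
(0, 1); hence the strict bounds on the initial y. The reversal begins at level 1/lev c n since the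
i-th reversed step keeps the δ of level lev c (n - 1 - i). -/
theorem reverse_heights {c : ℝ} (hc : Adm c) {q : ℝ × ℝ} (hq : q ∈ Del c) (hv : q.2 ≠ 0) {n : ℕ}
    {s : ℕ → ℕ} (h : HasHeights n c q s) (hx : xc c q < 1) (hy0 : 0 < yc c q) (hy1 : yc c q < 1) :
    HasHeights n (1 / lev c n) (dual (lev c n) (orb c q n)) (fun i => s (n - 1 - i)) ∧
      orb (1 / lev c n) (dual (lev c n) (orb c q n)) n = dual c q ∧
      0 < yc (lev c n) (orb c q n) ∧ yc (lev c n) (orb c q n) < 1 := by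
  have hY : ∀ i ≤ n, 0 < yc (lev c i) (orb c q i) ∧ yc (lev c i) (orb c q i) < 1 := by
    intro i
    induction i with
    | zero => intro _; exact ⟨hy0, hy1⟩
    | succ i ih =>
      intro hi
      have l := orb_link hc hq hv h (by omega : i < n)
      have b := l.2.bounds' (hc.lev i).dl_le l.1
      exact ⟨b.1, b.2.2 (ih (by omega)).1⟩
  have hX : ∀ i ≤ n, 0 < xc (lev c i) (orb c q i) ∧ xc (lev c i) (orb c q i) < 1 := by
    intro i hi
    rcases i with _ | i
    · exact ⟨(xc_bounds hc hq.1).1, hx⟩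
    · have := orb_facts hc hq h (by omega : i < n)
      exact ⟨this.2.1, this.2.2.1⟩
  have key := hasHeights_pt n (hc.lev n).inv (x := fun i => yc (lev c (n - i)) (orb c q (n - i)))
    (y := fun i => xc (lev c (n - i)) (orb c q (n - i))) (s := fun i => s (n - 1 - i))
    (fun i hi => hY _ (by omega)) (fun i hi => ⟨(hX (n - i) (by omega)).1.le,
      (hX (n - i) (by omega)).2.le⟩)
    (fun i hi => (orb_link hc hq hv h (by omega : n - 1 - i < n)).1)
    (fun i hi => by
      have l := (orb_link hc hq hv h (by omega : n - 1 - i < n)).2.symm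
      have e1 : n - 1 - i + 1 = n - i := by omega
      have e2 : n - (i + 1) = n - 1 - i := by omega
      rw [e1] at l
      rw [e2]
      have : lev (1 / lev c n) i = lev c (n - 1 - i) := by
        rw [lev_inv, lev_lev_sub c hi.le, ← e1, lev_succ, lev_inv, one_div_one_div]
      rw [this]
      exact l)
  refine ⟨key.1, ?_, hY n le_rfl⟩
  have := key.2 n le_rfl
  simp only [Nat.sub_zero, Nat.sub_self] at this
  rw [dual, this, lev_inv, lev_lev_sub c le_rfl, Nat.sub_self]
  rfl

/-- The points with an infinite past with heights `…, s 1, s 0`. -/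
def Past (c : ℝ) (s : ℕ → ℕ) : Set (ℝ × ℝ) :=
  {q | ∃ x y, (0 < x ∧ x < 1) ∧ (0 < y ∧ y < 1) ∧ q = pt c x y ∧
    ∀ n, HasHeights n (1 / c) (pt (1 / c) y x) s}

theorem past_spec {c : ℝ} (hc : Adm c) {s : ℕ → ℕ} {q : ℝ × ℝ} (hq : q ∈ Past c s) :
    q ∈ Del c ∧ (0 < xc c q ∧ xc c q < 1) ∧ (0 < yc c q ∧ yc c q < 1) ∧ q.2 ≠ 0 ∧
      dual c q ∈ Del (1 / c) ∧ (dual c q).2 ≠ 0 ∧ xc (1 / c) (dual c q) = yc c q ∧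
      yc (1 / c) (dual c q) = xc c q ∧ ∀ n, HasHeights n (1 / c) (dual c q) s := by
  obtain ⟨x, y, hx, hy, rfl, h⟩ := hq
  rw [dual, xc_pt hc.pos.ne', yc_pt hc hx.1 hy.1.le, xc_pt hc.inv.pos.ne',
    yc_pt hc.inv hy.1 hx.1.le]
  exact ⟨pt_mem_Del hc hx.1 hx.2.le hy.1.le hy.2.le, hx, hy, pt_snd_ne hc hx.1 hy.1.le,
    pt_mem_Del hc.inv hy.1 hy.2.le hx.1.le hx.2.le, pt_snd_ne hc.inv hy.1 hx.1.le, rfl, rfl, h⟩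

/-- A point 2k steps in the past is obtained by dualizing, renormalizing 2k times, and dualizing
back; the remaining heights of the dual orbit give its own past. -/
theorem past_preimage {c : ℝ} (hc : Adm c) {s : ℕ → ℕ} {q : ℝ × ℝ} (hq : q ∈ Past c s) (k : ℕ) :
    ∃ w ∈ Past c (fun i => s (i + 2 * k)), HasHeights (2 * k) c w (fun i => s (2 * k - 1 - i)) ∧
      orb c w (2 * k) = q ∧ w = dual (1 / c) (orb (1 / c) (dual c q) (2 * k)) := by
  obtain ⟨h1, h2, h3, h4, h5, h6, h7, h8, h9⟩ := past_spec hc hq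
  obtain ⟨r1, r2, r3⟩ := reverse_heights hc.inv h5 h6 (h9 (2 * k)) (by rw [h7]; exact h3.2)
    (by rw [h8]; exact h2.1) (by rw [h8]; exact h2.2)
  simp only [lev_two_mul, one_div_one_div] at r1 r2 r3
  set p := orb (1 / c) (dual c q) (2 * k) with hp
  have hpH : ∀ n, HasHeights n (1 / c) p (fun i => s (i + 2 * k)) := by
    intro n
    have := hasHeights_iff.1 (h9 (2 * k + n))
    rw [hasHeights_iff]
    have e : ∀ i, orb (1 / c) p i = orb (1 / c) (dual c q) (2 * k + i) := fun i => by
      rw [orb_add, lev_two_mul]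
    have e' : ∀ i, lev (1 / c) i = lev (1 / c) (2 * k + i) := fun i => by
      rw [lev_add, lev_two_mul]
    refine ⟨fun i hi => ?_, fun i hi => ?_⟩
    · rw [e, e', add_comm i]; exact this.1 _ (by omega)
    · rw [e, e']; exact this.2 _ (by omega)
  have hpx : 0 < xc (1 / c) p ∧ xc (1 / c) p < 1 ∧ p.1 ≠ 0 ∧ p.2 ≠ 0 := by
    have hD := orb_Del hc.inv h5 (h9 (2 * k)) (2 * k) le_rfl
    rw [lev_two_mul] at hD
    refine ⟨(xc_bounds hc.inv hD.1).1, ?_, hD.1.1.ne', ?_⟩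
    · rcases k with _ | k
      · change xc (1 / c) (dual c q) < 1
        rw [h7]; exact h3.2
      · have := orb_facts hc.inv h5 (h9 (2 * (k + 1))) (i := 2 * k + 1) (by omega)
        have e : 2 * k + 1 + 1 = 2 * (k + 1) := by ring
        rw [e, lev_two_mul] at this
        exact this.2.2.1
    · rcases k with _ | k
      · exact h6
      · exact (orb_facts hc.inv h5 (h9 (2 * (k + 1))) (i := 2 * k + 1) (by omega)).1
  refine ⟨dual (1 / c) p, ⟨yc (1 / c) p, xc (1 / c) p, r3, ⟨hpx.1, hpx.2.1⟩, ?_, ?_⟩, r1, ?_, rfl⟩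
  · rw [dual, one_div_one_div]
  · rw [pt_xc_yc hc.inv hpx.2.2.1 hpx.2.2.2]
    exact hpH
  · rw [r2, dual_dual hc h1.1.1 h4 h3.1]

/-- Points with arbitrarily long pasts. -/
theorem mem_Past {c : ℝ} (hc : Adm c) {s : ℕ → ℕ} {q : ℝ × ℝ}
    (h : ∀ k, ∃ w ∈ Del c, HasHeights (2 * k) c w (fun i => s (2 * k - 1 - i)) ∧
      orb c w (2 * k) = q) : q ∈ Past c s := by
  have key : ∀ n, (0 < xc c q ∧ xc c q < 1) ∧ (0 < yc c q ∧ yc c q < 1) ∧ (q.1 ≠ 0 ∧ q.2 ≠ 0) ∧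
      HasHeights n (1 / c) (dual c q) s := by
    intro n
    obtain ⟨w, hw, hH, e⟩ := h (n + 2)
    -- drop the first three steps of the orbit
    have H := hasHeights_iff.1 hH
    have hD := orb_Del hc hw hH
    have f := fun i (hi : i < 2 * (n + 2)) => orb_facts hc hw hH hi
    have hl := fun i (hi : i + 1 < 2 * (n + 2)) =>
      link_of_height (hc.lev (i + 1)) (hD (i + 1) (by omega)) (f i (by omega)).1 (H.1 (i + 1) hi)
        (by rw [← orb_succ', ← lev_inv]; exact H.2 (i + 2) (by omega))
    have hk := fun i (hi : i < 2 * (n + 2)) =>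
      one_le_height (hc.lev i).pos (hD i hi.le).1 (H.1 i hi)
    simp only [← orb_succ', ← lev_inv] at hl
    -- At time 1 the point has v ≠ 0 and 0 ≤ y ≤ 1. The next link gives y > 0 at time 2, the one
    -- after that 0 < y < 1 at time 3; from there on the orbit can be reversed.
    have y2 : 0 < yc (lev c 2) (orb c w 2) :=
      ((hl 0 (by omega)).bounds' (hc.lev 1).dl_le (hk 1 (by omega))).1
    have y3 : 0 < yc (lev c 3) (orb c w 3) ∧ yc (lev c 3) (orb c w 3) < 1 := by
      have := (hl 1 (by omega)).bounds' (hc.lev 2).dl_le (hk 2 (by omega))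
      exact ⟨this.1, this.2.2 y2⟩
    have hH3 : HasHeights (2 * n + 1) (lev c 3) (orb c w 3) (fun i => s (2 * (n + 2) - 1 - (i + 3))) := by
      rw [hasHeights_iff]
      have e1 : ∀ i, lev (lev c 3) i = lev c (i + 3) := fun i => by rw [← lev_add, add_comm]
      have e2 : ∀ i, orb (lev c 3) (orb c w 3) i = orb c w (i + 3) := fun i => by
        rw [← orb_add, add_comm]
      refine ⟨fun i hi => ?_, fun i hi => ?_⟩
      · rw [e1, e2]; exact H.1 _ (by omega)
      · rw [e1, e2]; exact H.2 _ (by omega)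
    have f2 := f 2 (by omega)
    have R := reverse_heights (hc.lev 3) (hD 3 (by omega)) f2.1 hH3 f2.2.2.1 y3.1 y3.2
    have e3 : 3 + (2 * n + 1) = 2 * (n + 2) := by ring
    rw [← orb_add, ← lev_add, e3, lev_two_mul, e] at R
    have fl := f (2 * n + 3) (by omega)
    have e4 : 2 * n + 3 + 1 = 2 * (n + 2) := by ring
    rw [e4, lev_two_mul, e] at fl
    have hDl := hD (2 * (n + 2)) le_rfl
    rw [lev_two_mul, e] at hDl
    refine ⟨⟨fl.2.1, fl.2.2.1⟩, R.2.2, ⟨hDl.1.1.ne', fl.1⟩, ?_⟩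
    refine (R.1.mono (by omega : n ≤ 2 * n + 1)).congr fun i hi => ?_
    congr 1
    omega
  obtain ⟨k1, k2, k3, -⟩ := key 0
  exact ⟨xc c q, yc c q, k1, k2, (pt_xc_yc hc k3.1 k3.2).symm, fun n => (key n).2.2.2⟩

theorem Lpast_eq {c : ℝ} (hc : Adm c) (r : ℤ → ℕ) :
    Lpast c r = Past c (fun i => r (-1 - (i : ℤ))) := by
  have hs : ∀ k i : ℕ, i < 2 * k → r ((i : ℤ) - 2 * (k : ℤ)) = r (-1 - ((2 * k - 1 - i : ℕ) : ℤ)) := by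
    intro k i hi
    congr 1
    omega
  ext q
  constructor
  · intro hq
    apply mem_Past hc
    intro k
    obtain ⟨-, w, hw, hH, e⟩ := Set.mem_iInter.1 hq k
    rw [T_iterate] at e
    exact ⟨w, hw, hH.congr fun i hi => hs k i hi, e⟩
  · intro hq
    refine Set.mem_iInter.2 fun k => ?_
    obtain ⟨w, hw, hH, e, -⟩ := past_preimage hc hq k
    refine ⟨(past_spec hc hq).1, w, (past_spec hc hw).1, hH.congr fun i hi => (hs k i hi).symm, ?_⟩
    rw [T_iterate]
    exact e

/-- The stable graph of the dual heights at level 1/c, with the two coordinates exchanged, is a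
graph over x in (0, 1). -/
theorem isCurve_Past {c : ℝ} (hc : Adm c) {s : ℕ → ℕ} (hs : ∀ i, 1 ≤ s i) :
    ∃ γ : ℝ → ℝ × ℝ, ContinuousOn γ (Set.Ioo 0 1) ∧ Set.InjOn γ (Set.Ioo 0 1) ∧
      γ '' Set.Ioo 0 1 = Past c s := by
  obtain ⟨h, h1, h2, -, h4⟩ := exists_stable_graph hc.inv s hs
  refine ⟨fun x => pt c x (h x), ?_, ?_, ?_⟩
  · have hh : ContinuousOn h (Set.Ioo 0 1) := h4.mono Set.Ioo_subset_Icc_self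
    unfold pt
    refine ContinuousOn.prodMk (by fun_prop) (ContinuousOn.div (by fun_prop) (by fun_prop) ?_)
    intro x hx
    have := mul_pos hx.1 (h1 x hx.1.le hx.2.le).1
    linarith
  · intro x hx x' hx' e
    have := congrArg (xc c) e
    simpa only [xc_pt hc.pos.ne'] using this
  · ext q
    constructor
    · rintro ⟨x, hx, rfl⟩
      obtain ⟨p1, p2, p3⟩ := h1 x hx.1.le hx.2.le
      exact ⟨x, h x, hx, ⟨p1, p2⟩, rfl, p3⟩
    · rintro ⟨x, y, hx, hy, rfl, H⟩
      exact ⟨x, hx, by rw [h2 y x hy.1 hy.2.le hx.1.le hx.2.le H]⟩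

/-! ### Curves of points with a given future -/

/-- The backward orbit of `ξ_k = x` in the coordinate `ξ`. -/
def backOrb (δ ω x : ℝ) : ℕ → ℝ
  | 0 => x
  | j + 1 => (1 + (1 - δ) * backOrb δ ω x j) / (1 - δ * ω * backOrb δ ω x j)

theorem Block.eq_backOrb {δ ω : ℝ} {k : ℕ} {ξ : ℕ → ℝ} (h : Block δ ω k ξ) (hω : 0 ≤ ω)
    (hδ : δ ≤ 1 / 2) : ∀ j ≤ k, ξ (k - j) = backOrb δ ω (ξ k) j := by
  intro j
  induction j with
  | zero => intro _; rfl
  | succ j ih =>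
    intro hj
    have e : k - j = k - (j + 1) + 1 := by omega
    have st := h.step (k - (j + 1)) (by omega)
    have n := h.nonneg (k - j) (by omega)
    have l := h.le (k - j) (by omega)
    rw [← e] at st
    rw [backOrb, ← ih (by omega)]
    have : 0 ≤ ω * ξ (k - j) := mul_nonneg hω n
    rw [eq_div_iff (by nlinarith)]
    linear_combination st

theorem backOrb_nonneg {δ ω x : ℝ} (hω : 0 ≤ ω) (hδ : δ ≤ 1 / 2) (hx : 0 ≤ x) {k : ℕ}
    (hk : ∀ j ≤ k, ω * backOrb δ ω x j ≤ 1) : ∀ j ≤ k, 0 ≤ backOrb δ ω x j := by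
  intro j
  induction j with
  | zero => intro _; exact hx
  | succ j ih =>
    intro hj
    have n := ih (by omega)
    have l := hk j (by omega)
    have : 0 ≤ ω * backOrb δ ω x j := mul_nonneg hω n
    rw [backOrb]
    apply div_nonneg
    · have := mul_nonneg (show 0 ≤ 1 - δ by linarith) n
      linarith
    · nlinarith

theorem block_backOrb {δ ω x : ℝ} (hω : 0 ≤ ω) (hδ : δ ≤ 1 / 2) (hx : 0 ≤ x) {k : ℕ}
    (hk : ∀ j ≤ k, ω * backOrb δ ω x j ≤ 1) : Block δ ω k (fun j => backOrb δ ω x (k - j)) where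
  nonneg j _ := backOrb_nonneg hω hδ hx hk (k - j) (by omega)
  le j _ := hk (k - j) (by omega)
  step j hj := by
    have e : k - j = k - (j + 1) + 1 := by omega
    have n := backOrb_nonneg hω hδ hx hk (k - (j + 1)) (by omega)
    have l := hk (k - (j + 1)) (by omega)
    have h0 : 0 ≤ ω * backOrb δ ω x (k - (j + 1)) := mul_nonneg hω n
    have : backOrb δ ω x (k - j) * (1 - δ * ω * backOrb δ ω x (k - (j + 1)))
        = 1 + (1 - δ) * backOrb δ ω x (k - (j + 1)) := by
      rw [e, backOrb, div_mul_cancel₀]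
      nlinarith
    linear_combination this

/-- The orbit in the coordinate `ω ξ` is monotone in `ω`. -/
theorem Block.backOrb_le {δ ω ω' x : ℝ} {k : ℕ} {ξ : ℕ → ℝ} (h : Block δ ω' k ξ)
    (hω : 0 ≤ ω) (hωω : ω ≤ ω') (hω1 : ω ≤ 1) (hδ : δ ≤ 1 / 2) (hδ' : -1 ≤ δ) (hx : 0 ≤ x)
    (hk : ξ k = x) : ∀ j ≤ k, ω * backOrb δ ω x j ≤ 1 := by
  have key : ∀ j ≤ k, 0 ≤ backOrb δ ω x j ∧ ω * backOrb δ ω x j ≤ ω' * ξ (k - j) := by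
    intro j
    induction j with
    | zero =>
      intro _
      refine ⟨hx, ?_⟩
      rw [Nat.sub_zero, hk]
      exact mul_le_mul_of_nonneg_right hωω hx
    | succ j ih =>
      intro hj
      obtain ⟨n, l⟩ := ih (by omega)
      have e : k - j = k - (j + 1) + 1 := by omega
      have st := h.step (k - (j + 1)) (by omega)
      have l' := h.le (k - j) (by omega)
      have n' := h.nonneg (k - j) (by omega)
      have n'' := h.nonneg (k - (j + 1)) (by omega)
      rw [← e] at st
      have p0 : 0 ≤ ω * backOrb δ ω x j := mul_nonneg hω n
      have d1 : 0 < 1 - δ * (ω * backOrb δ ω x j) := by nlinarith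
      have d2 : 0 < 1 - δ * (ω' * ξ (k - j)) := by nlinarith
      have hb : backOrb δ ω x (j + 1)
          = (1 + (1 - δ) * backOrb δ ω x j) / (1 - δ * (ω * backOrb δ ω x j)) := by
        rw [backOrb, mul_assoc]
      refine ⟨?_, ?_⟩
      · rw [hb]
        apply div_nonneg _ d1.le
        have := mul_nonneg (show 0 ≤ 1 - δ by linarith) n
        linarith
      · have e1 : ω * backOrb δ ω x (j + 1) = (ω + (1 - δ) * (ω * backOrb δ ω x j)) /
            (1 - δ * (ω * backOrb δ ω x j)) := by rw [hb]; ring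
        have e2 : ω' * ξ (k - (j + 1)) = (ω' + (1 - δ) * (ω' * ξ (k - j))) /
            (1 - δ * (ω' * ξ (k - j))) := by
          rw [eq_div_iff d2.ne']; linear_combination ω' * st
        rw [e1, e2]
        generalize ω * backOrb δ ω x j = p at *
        generalize ω' * ξ (k - j) = p' at *
        calc (ω + (1 - δ) * p) / (1 - δ * p) ≤ (ω + (1 - δ) * p') / (1 - δ * p') := by
              rw [div_le_div_iff₀ d1 d2]
              have : 0 ≤ 1 - δ * (1 - ω) := by nlinarith
              nlinarith [mul_nonneg (show 0 ≤ p' - p by linarith) this]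
          _ ≤ _ := by
              apply div_le_div_of_nonneg_right _ d2.le
              linarith
  intro j hj
  exact (key j hj).2.trans (h.le _ (by omega))

theorem Lfuture_iff {c : ℝ} {r : ℤ → ℕ} {q : ℝ × ℝ} :
    q ∈ Lfuture c r ↔ q ∈ Del c ∧ ∀ n, HasHeights n c q (fun i => r i) := by
  simp only [Lfuture, Set.mem_iInter, cyl, Set.mem_ofPred_eq, Function.iterate_zero, id,
    Nat.cast_zero, mul_zero, sub_zero, zero_add]
  constructor
  · intro h
    refine ⟨(h 0).1, fun n => ?_⟩
    obtain ⟨-, y, -, h2, rfl⟩ := h n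
    exact h2
  · rintro ⟨h1, h2⟩ n
    exact ⟨h1, q, h1, h2 n, rfl⟩

/-- Since y may exceed 1 or be infinite (v = 0) on Δ_c, the curve is parametrized by the coordinate
y of the first renormalization, which lies in [0, 1] on the stable graph h of the shifted heights.
The points are recovered by running the block backwards from ξ_k = h(y). What needs proof is that
the admissible parameters form an interval. -/
theorem isCurve_Lfuture {c : ℝ} (hc : Adm c) {r : ℤ → ℕ} (hr : ∀ i, 1 ≤ r i) :
    IsCurve (Lfuture c r) := by
  have hcp := hc.pos
  have hδ := hc.dl_le
  have hδ' := hc.le_dl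
  obtain ⟨h, h1, h2, h3, h4⟩ := exists_stable_graph hc.inv (fun i => r ((i + 1 : ℕ) : ℤ))
    (fun i => hr _)
  set k := r 0 with hk0
  have hk : 1 ≤ k := hr 0
  -- Solution of y(1 - ω x') = ω with x' = h(y), the last equation of `Link`.
  let ω : ℝ → ℝ := fun y => y / (1 + h y * y)
  let B : ℝ → ℕ → ℝ := fun y => backOrb (dl c) (ω y) (h y)
  -- The parameters whose backward orbit stays a block, that is, whose preimage lies in Δ_c. The
  -- value y = 0 gives ω = 0 and corresponds to v = 0.
  let J : Set ℝ := {y | (0 ≤ y ∧ y ≤ 1) ∧ ∀ j ≤ k, ω y * B y j ≤ 1}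
  let γ : ℝ → ℝ × ℝ := fun y => (c / B y k, (c - 1) * (ω y * B y k))
  have den : ∀ y, 0 ≤ y → y ≤ 1 → 0 < 1 + h y * y := fun y a b => by
    have := (h1 y a b).1
    positivity
  have ω0 : ∀ y, 0 ≤ y → y ≤ 1 → 0 ≤ ω y := fun y a b => div_nonneg a (den y a b).le
  have ω1 : ∀ y, 0 ≤ y → y ≤ 1 → ω y ≤ 1 := fun y a b => by
    have := mul_nonneg (h1 y a b).1.le a
    change y / (1 + h y * y) ≤ 1
    rw [div_le_one (den y a b)]
    linarith
  have ωh : ∀ y, 0 ≤ y → y ≤ 1 → ω y * h y = 1 - 1 / (1 + h y * y) := fun y a b => by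
    change y / (1 + h y * y) * h y = _
    rw [eq_sub_iff_add_eq, div_mul_eq_mul_div, ← add_div, div_eq_one_iff_eq (den y a b).ne']
    ring
  have blk : ∀ y ∈ J, Block (dl c) (ω y) k (fun j => B y (k - j)) := fun y hy =>
    block_backOrb (ω0 y hy.1.1 hy.1.2) hδ (h1 y hy.1.1 hy.1.2).1.le hy.2
  have hγ : ∀ y ∈ J, γ y ∈ Del c ∧ HasHeight c (γ y) k ∧ renorm c (γ y) = pt (1 / c) (h y) y := by
    intro y hy
    have p := h1 y hy.1.1 hy.1.2
    have := (blk y hy).height hc (ω0 y hy.1.1 hy.1.2) hk (by simpa [B, backOrb] using p.1)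
      (by simpa [B, backOrb] using p.2.1)
    simp only [Nat.sub_zero, Nat.sub_self] at this
    refine ⟨this.1, this.2.1, this.2.2.trans ?_⟩
    have hd := den y hy.1.1 hy.1.2
    ext
    · simp only [pt, B, backOrb]; ring
    · change (1 / c - 1) * (1 - ω y * h y) = (1 / c - 1) / (1 + h y * y)
      rw [ωh y hy.1.1 hy.1.2]
      ring
  have inj : Set.InjOn γ J := by
    intro y hy y' hy' e
    have e1 := (hγ y hy).2.2
    rw [e, (hγ y' hy').2.2] at e1
    have := congrArg (yc (1 / c)) e1
    rwa [yc_pt hc.inv (h1 _ hy.1.1 hy.1.2).1 hy.1.1, yc_pt hc.inv (h1 _ hy'.1.1 hy'.1.2).1 hy'.1.1,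
      eq_comm] at this
  have img : γ '' J = Lfuture c r := by
    ext q
    rw [Lfuture_iff]
    constructor
    · rintro ⟨y, hy, rfl⟩
      obtain ⟨a1, a2, a3⟩ := hγ y hy
      refine ⟨a1, fun n => ?_⟩
      rcases n with _ | n
      · exact a1.1
      · refine ⟨a1.1, a2, ?_⟩
        rw [a3]
        exact (h1 y hy.1.1 hy.1.2).2.2 n
    · rintro ⟨a1, a2⟩
      obtain ⟨-, b2, b3⟩ := a2 1
      replace b2 : HasHeight c q k := b2
      replace b3 : renorm c q ∈ D (1 / c) := b3
      obtain ⟨ξ, hB, e0, er, p0, p1⟩ := exists_block_of_height hc a1 b2 b3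
      obtain ⟨c1, c2, c3, c4, c5, c6⟩ := step_Del hc a1 b2 b3
      have hren : renorm c q = pt (1 / c) (xc (1 / c) (renorm c q)) (yc (1 / c) (renorm c q)) :=
        (pt_xc_yc hc.inv c1.1.1.ne' c2).symm
      set y := yc (1 / c) (renorm c q)
      have ex : xc (1 / c) (renorm c q) = ξ k := by rw [er, xc]; field_simp
      rw [ex] at hren
      have hx : ξ k = h y := h2 _ _ p0 p1.le c5 c6 (fun n => by
        rw [← hren]; exact (a2 (n + 1)).2.2)
      have hd := den y c5 c6
      obtain ⟨hD, σ, hσ0, hσ1, hσ⟩ := (Del_iff hc).1 a1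
      have ha := hD.1
      have hc1 := hc.sub_ne
      have eω : q.1 * q.2 / (c * (c - 1)) = ω y := by
        have e2 := congrArg Prod.snd (er.symm.trans hren)
        simp only [pt] at e2
        rw [hx] at e2
        have hne := hc.inv.sub_ne
        have e3 : (1 - q.1 * q.2 / (c * (c - 1)) * h y) = 1 / (1 + h y * y) := by
          apply mul_left_cancel₀ hne
          rw [e2]; ring
        have hhy := (h1 y c5 c6).1
        apply mul_right_cancel₀ hhy.ne'
        rw [ωh y c5 c6]; linarith
      rw [eω] at hB
      have bo := hB.eq_backOrb (ω0 y c5 c6) hδ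
      have hyJ : y ∈ J := by
        refine ⟨⟨c5, c6⟩, fun j hj => ?_⟩
        have := hB.le (k - j) (by omega)
        rw [bo j hj, hx] at this
        exact this
      refine ⟨y, hyJ, ?_⟩
      have b0 := bo k le_rfl
      rw [Nat.sub_self, hx] at b0
      have e4 : B y k = c / q.1 := by rw [← e0, b0]
      ext
      · simp only [γ]; rw [e4]; field_simp
      · simp only [γ]; rw [e4, ← eω]; field_simp
  -- Downward closedness: compare with the link that has the same initial y-coordinate as the
  -- preimage of y' but final x-coordinate h(y).
  have ord : ∀ y' ∈ J, ∀ y, 0 ≤ y → y ≤ y' → y ∈ J := by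
    intro y' hy' y hy hyy
    have hy1 : y ≤ 1 := hyy.trans hy'.1.2
    refine ⟨⟨hy, hy1⟩, ?_⟩
    rcases hy.lt_or_eq with hy0 | hy0
    swap
    · intro j _
      have : ω y = 0 := by simp [ω, ← hy0]
      rw [this, zero_mul]; norm_num
    have hpos' : 0 < y' := hy0.trans_le hyy
    have p := h1 y hy hy1
    have p' := h1 y' hy'.1.1 hy'.1.2
    have hω' : 0 < ω y' := div_pos hpos' (den y' hy'.1.1 hy'.1.2)
    have hB' := blk y' hy'
    have hB0 : 1 ≤ B y' k := by
      have l := hB'.lower hω'.le hδ (j := 0) (by omega)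
      have n := hB'.nonneg 1 hk
      simp only [Nat.sub_zero, zero_add] at l n
      linarith
    have link' : Link (dl c) k (1 / B y' k) (1 / ω y' - B y' k) (h y') y' := by
      refine ⟨ω y', _, hB', hω', by simp [B, backOrb], ?_, ?_, ?_⟩
      · simp only [Nat.sub_zero]; rw [one_div_mul_cancel]; linarith
      · simp only [Nat.sub_zero]; field_simp; ring
      · have e2 : ω y' * (1 + h y' * y') = y' := div_mul_cancel₀ _ (den y' hy'.1.1 hy'.1.2).ne'
        linear_combination -e2
    obtain ⟨X, Y, link⟩ := exists_link hδ hδ' hk p.1.le (link'.bounds hδ hk).2.2.1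
    -- The common initial coordinate may exceed 1, so the alternative of equal data is used.
    have con := (link'.contract hc hk link (Or.inl ⟨p'.2.1.le, p.2.1.le⟩) (Or.inr rfl)).2
    rw [ld_self, max_eq_left (ld_nonneg _ _)] at con
    have lip := h3 y' y hy'.1.1 hy'.1.2 hy hy1
    have hκ0 := lrate_nonneg c
    have hκ1 := hc.lrate_lt
    rw [lrate_inv] at lip
    have Yb := link.bounds' hδ hk
    have ldY : ld y' Y ≤ ld y' y := by
      have n := ld_nonneg y' y
      have : lrate c * ld (h y') (h y) ≤ lrate c * (lrate c * ld y' y) :=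
        mul_le_mul_of_nonneg_left lip hκ0
      have m1 : lrate c * ld y' y ≤ ld y' y := mul_le_of_le_one_left n hκ1.le
      have m2 : lrate c * (lrate c * ld y' y) ≤ lrate c * ld y' y :=
        mul_le_of_le_one_left (mul_nonneg hκ0 n) hκ1.le
      linarith
    -- Contraction of the link and of h puts Y no farther from y' than y is; Y < y ≤ y' would
    -- violate this.
    have hyY : y ≤ Y := by
      by_contra hcon
      push Not at hcon
      have l1 := Real.log_lt_log (show 0 < 1 + Y by linarith [Yb.1]) (show 1 + Y < 1 + y by linarith)
      have l2 := Real.log_le_log (show 0 < 1 + y by linarith) (show 1 + y ≤ 1 + y' by linarith)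
      rw [ld, ld, abs_of_nonneg (by linarith), abs_of_nonneg (by linarith)] at ldY
      linarith
    -- Hence ω(y) is at most the scale w of the comparison block, and a smaller ω with the same ξ_k
    -- keeps the backward orbit admissible.
    obtain ⟨w, ξ, hB, hw, e1, e2, e3, e4⟩ := link
    have hωw : ω y ≤ w := by
      have : w = Y / (1 + h y * Y) := by
        rw [eq_div_iff (by have := mul_pos p.1 Yb.1; linarith)]; linear_combination -e4
      rw [this]
      change y / (1 + h y * y) ≤ _
      rw [div_le_div_iff₀ (den y hy hy1) (by have := mul_pos p.1 Yb.1; linarith)]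
      nlinarith
    exact hB.backOrb_le (ω0 y hy hy1) hωw (ω1 y hy hy1) hδ hδ' p.1.le e1
  have cont : ContinuousOn γ J := by
    have hh : ContinuousOn h J := h4.mono fun y hy => hy.1
    have cω : ContinuousOn ω J := by
      refine ContinuousOn.div (by fun_prop) (by fun_prop) ?_
      intro y hy
      exact (den y hy.1.1 hy.1.2).ne'
    have nn : ∀ y ∈ J, ∀ j ≤ k, 0 ≤ B y j := fun y hy =>
      backOrb_nonneg (ω0 y hy.1.1 hy.1.2) hδ (h1 y hy.1.1 hy.1.2).1.le hy.2
    have cB : ∀ j ≤ k, ContinuousOn (fun y => B y j) J := by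
      intro j
      induction j with
      | zero => intro _; exact hh
      | succ j ih =>
        intro hj
        have := ih (by omega)
        change ContinuousOn (fun y => (1 + (1 - dl c) * B y j) / (1 - dl c * ω y * B y j)) J
        refine ContinuousOn.div (by fun_prop) (by fun_prop) ?_
        intro y hy
        have a := nn y hy j (by omega)
        have b := hy.2 j (by omega)
        have : 0 ≤ ω y * B y j := mul_nonneg (ω0 y hy.1.1 hy.1.2) a
        have : 0 < 1 - dl c * (ω y * B y j) := by nlinarith
        rw [mul_assoc]
        exact this.ne'
    have := cB k le_rfl
    refine ContinuousOn.prodMk (ContinuousOn.div (by fun_prop) this ?_) (by fun_prop)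
    intro y hy
    have l := (blk y hy).lower (ω0 y hy.1.1 hy.1.2) hδ (j := 0) (by omega)
    have n := (blk y hy).nonneg 1 hk
    simp only [Nat.sub_zero, zero_add] at l n
    linarith
  refine ⟨J, γ, ⟨?_⟩, ?_, cont, inj, img⟩
  · intro a ha b hb x hx
    exact ord b hb x (ha.1.1.trans hx.1) hx.2
  -- A two-sided orbit supplies a positive parameter in J, and J then also contains 0.
  · obtain ⟨x, y, hxy⟩ := exists_full hc r hr
    have hL : ∀ i : ℕ, Link (dl (lev c i)) (r i) (x i) (y i) (x ((i + 1 : ℕ) : ℤ))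
        (y ((i + 1 : ℕ) : ℤ)) := fun i => by
      have := (hxy i).2.2
      have e : levZ c i = lev c i := by simpa using levZ_add c 0 i
      rw [e] at this
      exact_mod_cast this
    have H := fun n => hasHeights_pt n hc (x := fun i => x i) (y := fun i => y i)
      (s := fun i => r i) (fun i _ => (hxy i).1) (fun i _ => ⟨(hxy i).2.1.1.le, (hxy i).2.1.2.le⟩)
      (fun i _ => hr _) (fun i _ => hL i)
    have mem : pt c (x (0 : ℕ)) (y (0 : ℕ)) ∈ Lfuture c r :=
      Lfuture_iff.2 ⟨pt_mem_Del hc (hxy _).1.1 (hxy _).1.2.le (hxy _).2.1.1.le (hxy _).2.1.2.le,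
        fun n => (H n).1⟩
    rw [← img] at mem
    obtain ⟨y₁, hy₁, e⟩ := mem
    have e1 := (hγ y₁ hy₁).2.2
    have e2 := (H 1).2 1 le_rfl
    rw [e] at e1
    have e3 : pt (1 / c) (h y₁) y₁ = pt (1 / c) (x (1 : ℕ)) (y (1 : ℕ)) := e1.symm.trans e2
    have e4 := congrArg (yc (1 / c)) e3
    rw [yc_pt hc.inv (h1 _ hy₁.1.1 hy₁.1.2).1 hy₁.1.1, yc_pt hc.inv (hxy _).1.1 (hxy _).2.1.1.le] at e4
    refine ⟨0, ord _ hy₁ 0 le_rfl hy₁.1.1, y₁, hy₁, ?_⟩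
    rw [e4]
    exact (hxy _).2.1.1.ne

/-! ### Local constancy of the height -/

theorem iterate_differentiableAt (c : ℝ) {q₀ : ℝ × ℝ} : ∀ j : ℕ,
    (∀ i < j, 1 - q₀.2 * (F c q₀)^[i] (-1) ≠ 0) →
      DifferentiableAt ℝ (fun q : ℝ × ℝ => (F c q)^[j] (-1)) q₀ := by
  intro j
  induction j with
  | zero => intro _; exact differentiableAt_const _
  | succ j ih =>
    intro hj
    have h := ih (fun i hi => hj i (by omega))
    simp only [Function.iterate_succ_apply']
    have : (fun q : ℝ × ℝ => F c q ((F c q)^[j] (-1))) = fun q : ℝ × ℝ =>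
        (q.1 + c * (F c q)^[j] (-1)) / (1 - q.2 * (F c q)^[j] (-1)) := rfl
    rw [this]
    have hne := hj j (by omega)
    simp only [div_eq_mul_inv]
    refine DifferentiableAt.mul (by fun_prop) (DifferentiableAt.fun_inv (by fun_prop) hne)

theorem den_ne {c : ℝ} (hc : 0 < c) {q : ℝ × ℝ} (hq : q ∈ D c) {k : ℕ} (hk : HasHeight c q k) :
    ∀ i ≤ k, 1 - q.2 * (F c q)^[i] (-1) ≠ 0 := fun i hi =>
  (one_sub_mul_pos (neg_one_lt hq) ((renorm_eq hc hq hk).1 i hi).1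
    ((renorm_eq hc hq hk).1 i hi).2).ne'

/-- The inequalities defining the height are strict when the renormalization is in the domain: an
earlier zero of F^j(-1) would be followed by a positive value, and F^k(-1) = 0 would give a' = 0. By
continuity they persist nearby. -/
theorem eventually_height {c : ℝ} (hc : 0 < c) {q₀ : ℝ × ℝ} (hq : q₀ ∈ D c) {k : ℕ}
    (hk : HasHeight c q₀ k) (hq' : renorm c q₀ ∈ D (1 / c)) :
    ∀ᶠ q in 𝓝[D c] q₀, HasHeight c q k ∧
      renorm c q = (-(F c q)^[k] (-1) / q.1, (1 - c - q.2 * (F c q)^[k] (-1)) / c) := by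
  obtain ⟨hb, -, hr⟩ := renorm_eq hc hq hk
  have cont : ∀ j ≤ k + 1, ContinuousAt (fun q : ℝ × ℝ => (F c q)^[j] (-1)) q₀ := fun j hj =>
    (iterate_differentiableAt c j fun i hi => den_ne hc hq hk i (by omega)).continuousAt
  have ha := hq.1
  have neg : ∀ j ≤ k, (F c q₀)^[j] (-1) < 0 := by
    intro j hj
    refine lt_of_le_of_ne (hb j hj).2 fun h0 => ?_
    rcases hj.lt_or_eq with h | rfl
    · have := (hb (j + 1) h).2
      rw [Function.iterate_succ_apply', h0] at this
      simp only [F, mul_zero, add_zero, sub_zero, div_one] at this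
      linarith
    · have := hq'.1
      rw [hr, h0] at this
      simp at this
  have pos : 0 < (F c q₀)^[k + 1] (-1) := by
    have := hk.1.2
    rwa [G_zero hc hq] at this
  have ev1 : ∀ᶠ q in 𝓝 q₀, ∀ j ∈ Finset.range (k + 1), (F c q)^[j] (-1) < 0 := by
    rw [Filter.eventually_all_finset]
    intro j hj
    rw [Finset.mem_range] at hj
    exact (cont j (by omega)).eventually_lt continuousAt_const (neg j (by omega))
  have ev2 : ∀ᶠ q in 𝓝 q₀, 0 < (F c q)^[k + 1] (-1) :=
    continuousAt_const.eventually_lt (cont _ le_rfl) pos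
  filter_upwards [nhdsWithin_le_nhds ev1, nhdsWithin_le_nhds ev2, self_mem_nhdsWithin]
    with q h1 h2 h3
  have hh : HasHeight c q k := by
    refine ⟨⟨?_, ?_⟩, ?_⟩
    · rw [G_zero hc h3]; exact (h1 k (by simp)).le
    · rw [G_zero hc h3]; exact h2
    · intro j hj
      by_contra hcon
      have l := h1 (j + 1) (by simp; omega)
      have := hj.2
      rw [G_zero hc h3] at this
      linarith
  exact ⟨hh, (renorm_eq hc h3 hh).2.2⟩

theorem renorm_continuousWithinAt {c : ℝ} (hc : 0 < c) {q₀ : ℝ × ℝ} (hq : q₀ ∈ D c) {k : ℕ}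
    (hk : HasHeight c q₀ k) (hq' : renorm c q₀ ∈ D (1 / c)) :
    ContinuousWithinAt (renorm c) (D c) q₀ := by
  have ev := eventually_height hc hq hk hq'
  have hd := (iterate_differentiableAt c k
    fun i hi => den_ne hc hq hk i (by omega)).continuousAt
  have ha := hq.1.ne'
  have : ContinuousAt (fun q : ℝ × ℝ => ((-(F c q)^[k] (-1) / q.1,
      (1 - c - q.2 * (F c q)^[k] (-1)) / c) : ℝ × ℝ)) q₀ := by
    refine ContinuousAt.prodMk (ContinuousAt.div (by fun_prop) (by fun_prop) ha) ?_
    exact ContinuousAt.div_const (by fun_prop) _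
  refine this.continuousWithinAt.congr_of_eventuallyEq (ev.mono fun q h => h.2) ?_
  exact (renorm_eq hc hq hk).2.2

theorem renorm_differentiableAt {c : ℝ} (hc : 0 < c) {q₀ : ℝ × ℝ} (hq : D c ∈ 𝓝 q₀) {k : ℕ}
    (hk : HasHeight c q₀ k) (hq' : renorm c q₀ ∈ D (1 / c)) :
    DifferentiableAt ℝ (renorm c) q₀ := by
  have hq0 := mem_of_mem_nhds hq
  have ev := eventually_height hc hq0 hk hq'
  rw [nhdsWithin_eq_nhds.2 hq] at ev
  have hd := iterate_differentiableAt c k fun i hi => den_ne hc hq0 hk i (by omega)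
  have ha := hq0.1.ne'
  have : DifferentiableAt ℝ (fun q : ℝ × ℝ => ((-(F c q)^[k] (-1) / q.1,
      (1 - c - q.2 * (F c q)^[k] (-1)) / c) : ℝ × ℝ)) q₀ := by
    simp only [div_eq_mul_inv]
    exact (hd.fun_neg.mul (DifferentiableAt.fun_inv (by fun_prop) ha)).prodMk (by fun_prop)
  exact this.congr_of_eventuallyEq (ev.mono fun q h => h.2)

/-- The height is a continuous map to the discrete space ℕ, hence constant on the connected set. The
renormalization is continuous there, so the induction continues with the image. -/
theorem heights_const (m : ℕ) : ∀ {c : ℝ}, 0 < c → ∀ {C : Set (ℝ × ℝ)}, IsPreconnected C →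
    C ⊆ Ren m c → ∀ {q q' : ℝ × ℝ}, q ∈ C → q' ∈ C → ∀ {s : ℕ → ℕ}, HasHeights m c q s →
      HasHeights m c q' s := by
  induction m with
  | zero =>
    intro c _ C _ h q q' _ hq' s _
    obtain ⟨_, hs⟩ := h hq'
    exact hs
  | succ m ih =>
    intro c hc C hC h q q' hq hq' s hs
    have hD : C ⊆ D c := fun w hw => (h hw).choose_spec.1
    have hh : ∀ w ∈ C, HasHeight c w (height c w) ∧ renorm c w ∈ Ren m (1 / c) := by
      intro w hw
      obtain ⟨t, h1, h2, h3⟩ := h hw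
      rw [(renorm_eq hc h1 h2).2.1]
      exact ⟨h2, _, h3⟩
    have hR : ∀ w ∈ C, renorm c w ∈ D (1 / c) := fun w hw => (hh w hw).2.choose_spec.head
    have cont : ContinuousOn (height c) C := by
      intro w hw
      have ev := eventually_height hc (hD hw) (hh w hw).1 (hR w hw)
      have ev' := nhdsWithin_mono w hD ev
      have h0 : ContinuousWithinAt (fun _ : ℝ × ℝ => height c w) C w := continuousWithinAt_const
      refine h0.congr_of_eventuallyEq ?_ rfl
      filter_upwards [ev', self_mem_nhdsWithin] with u hu huC
      exact (renorm_eq hc (hD huC) hu.1).2.1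
    have e := hC.constant cont hq hq'
    have contR : ContinuousOn (renorm c) C := fun w hw =>
      (renorm_continuousWithinAt hc (hD hw) (hh w hw).1 (hR w hw)).mono hD
    obtain ⟨h1, h2, h3⟩ := hs
    refine ⟨hD hq', ?_, ?_⟩
    · rw [(hh q hq).1.unique h2] at e
      rw [e]
      exact (hh q' hq').1
    · refine ih (by positivity) (hC.image _ contR) ?_ (Set.mem_image_of_mem _ hq)
        (Set.mem_image_of_mem _ hq') h3
      rintro _ ⟨w, hw, rfl⟩
      exact (hh w hw).2

/-! ### Distances in the coordinates `x`, `y` -/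

theorem abs_sub_le_ld {x x' : ℝ} (h0 : 0 ≤ x) (h1 : x ≤ 1) (h0' : 0 ≤ x') (h1' : x' ≤ 1) :
    |x - x'| ≤ 2 * ld x x' := by
  wlog hle : x ≤ x' generalizing x x'
  · rw [abs_sub_comm, ld_comm]
    exact this h0' h1' h0 h1 (le_of_not_ge hle)
  have l := Real.one_sub_inv_le_log_of_pos (show 0 < (1 + x') / (1 + x) by positivity)
  rw [Real.log_div (by linarith) (by linarith), inv_div] at l
  have e : 1 - (1 + x) / (1 + x') = (x' - x) / (1 + x') := by field_simp; ring
  have : (x' - x) / 2 ≤ (x' - x) / (1 + x') := by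
    apply div_le_div_of_nonneg_left (by linarith) (by linarith) (by linarith)
  rw [abs_of_nonpos (by linarith), ld, abs_sub_comm]
  have := le_abs_self (Real.log (1 + x') - Real.log (1 + x))
  linarith

/-- Converts logarithmic distances of the coordinates into distances in the plane; the chart is
Lipschitz on the box where x and y are at most 1. -/
theorem dist_le_ld {c : ℝ} (hc : Adm c) {q q' : ℝ × ℝ} (hq : q ∈ Del c) (hq' : q' ∈ Del c)
    (hv : q.2 ≠ 0) (hv' : q'.2 ≠ 0) (hy : yc c q ≤ 1) (hy' : yc c q' ≤ 1) :
    dist q q' ≤ 4 * (ld (xc c q) (xc c q') + ld (yc c q) (yc c q')) := by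
  obtain ⟨x0, x1⟩ := xc_bounds hc hq.1
  obtain ⟨x0', x1'⟩ := xc_bounds hc hq'.1
  have y0 := yc_nonneg hc hq
  have y0' := yc_nonneg hc hq'
  have lx := abs_sub_le_ld x0.le x1 x0'.le x1'
  have ly := abs_sub_le_ld y0 hy y0' hy'
  rw [← pt_xc_yc hc hq.1.1.ne' hv, ← pt_xc_yc hc hq'.1.1.ne' hv']
  rw [xc_pt hc.pos.ne', xc_pt hc.pos.ne', yc_pt hc x0 y0, yc_pt hc x0' y0']
  generalize xc c q = x at *
  generalize xc c q' = x' at *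
  generalize yc c q = y at *
  generalize yc c q' = y' at *
  have n1 := ld_nonneg x x'
  have n2 := ld_nonneg y y'
  have hlo := hc.lo
  have hhi := hc.hi
  rw [Prod.dist_eq]
  apply max_le
  · simp only [pt]
    rw [Real.dist_eq, ← mul_sub, abs_mul, abs_of_pos hc.pos]
    have : c * |x - x'| ≤ 2 * |x - x'| := mul_le_mul_of_nonneg_right hhi.le (abs_nonneg _)
    linarith
  · simp only [pt]
    have p : 0 ≤ x * y := by positivity
    have p' : 0 ≤ x' * y' := by positivity
    have e : (c - 1) / (1 + x * y) - (c - 1) / (1 + x' * y')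
        = (c - 1) * (x' * (y' - y) + y * (x' - x)) / ((1 + x * y) * (1 + x' * y')) := by
      have d1 : (1 + x * y) ≠ 0 := by linarith
      have d2 : (1 + x' * y') ≠ 0 := by linarith
      rw [div_sub_div _ _ d1 d2]
      ring
    have b1 : |c - 1| ≤ 1 := abs_le.2 ⟨by linarith, by linarith⟩
    have b2 : |x' * (y' - y) + y * (x' - x)| ≤ |y - y'| + |x - x'| := by
      refine (abs_add_le _ _).trans ?_
      rw [abs_mul, abs_mul, abs_of_pos x0', abs_of_nonneg y0, abs_sub_comm y' y, abs_sub_comm x' x]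
      have := mul_le_of_le_one_left (abs_nonneg (y - y')) x1'
      have := mul_le_of_le_one_left (abs_nonneg (x - x')) hy
      linarith
    have b3 : 1 ≤ (1 + x * y) * (1 + x' * y') := by nlinarith
    rw [Real.dist_eq, e, abs_div, abs_mul, abs_of_pos (by linarith : 0 < (1 + x * y) * (1 + x' * y'))]
    refine (div_le_self (by positivity) b3).trans ?_
    have := mul_le_of_le_one_left (abs_nonneg (x' * (y' - y) + y * (x' - x))) b1
    linarith

theorem dist_orb_le {c : ℝ} (hc : Adm c) {q q' : ℝ × ℝ} (hq : q ∈ Del c) (hq' : q' ∈ Del c)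
    (hv : q.2 ≠ 0) (hv' : q'.2 ≠ 0) (hy : yc c q ≤ 1) (hy' : yc c q' ≤ 1) {s : ℕ → ℕ}
    (h : ∀ n, HasHeights n c q s) (h' : ∀ n, HasHeights n c q' s) (i : ℕ) :
    ld (xc (lev c i) (orb c q i)) (xc (lev c i) (orb c q' i)) +
      ld (yc (lev c i) (orb c q i)) (yc (lev c i) (orb c q' i)) ≤
        2 * (lrate c ^ i * ld (yc c q) (yc c q')) := by
  obtain ⟨h1, h2⟩ := future_contract hc hq hq' hv hv' hy hy' h h' i
  have := mul_le_of_le_one_left (ld_nonneg (yc (lev c i) (orb c q i)) (yc (lev c i) (orb c q' i)))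
    hc.lrate_lt.le
  linarith

theorem tendsto_lrate {c : ℝ} (hc : Adm c) (L : ℝ) :
    Tendsto (fun n : ℕ => 8 * (lrate c ^ n * L)) atTop (𝓝 0) := by
  have := (tendsto_pow_atTop_nhds_zero_of_lt_one (lrate_nonneg c) hc.lrate_lt).mul_const L
  simpa using this.const_mul 8

/-! ### The periodic orbit -/

/-- Shifting time by 2p gives a second orbit with the same heights. Started at time i - n, the two
y-coordinates are at most log 2 apart, so at time i they differ by at most κ^n log 2 for every n;
then x agrees too. -/
theorem exists_cycle {c : ℝ} (hc : Adm c) (r : ℤ → ℕ) (hr : ∀ i, 1 ≤ r i) {p : ℕ}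
    (hp : ∀ i, r (i + 2 * (p : ℤ)) = r i) :
    ∃ x y : ℤ → ℝ, (∀ i, (0 < x i ∧ x i < 1) ∧ (0 < y i ∧ y i < 1) ∧
      Link (dl (levZ c i)) (r i) (x i) (y i) (x (i + 1)) (y (i + 1))) ∧
      ∀ i, x (i + 2 * (p : ℤ)) = x i ∧ y (i + 2 * (p : ℤ)) = y i := by
  obtain ⟨x, y, h⟩ := exists_full hc r hr
  refine ⟨x, y, h, ?_⟩
  have hl : ∀ i : ℤ, levZ c (i + 2 * (p : ℤ)) = levZ c i := fun i => by
    simp [levZ, Int.even_add]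
  have B := lrate_nonneg c
  have hs : ∀ i : ℤ, ld (x i) (x (i + 2 * p)) ≤ lrate c *
        max (ld (x (i + 1)) (x (i + 2 * p + 1))) (ld (y i) (y (i + 2 * p))) ∧
      ld (y (i + 1)) (y (i + 2 * p + 1)) ≤ lrate c *
        max (ld (x (i + 1)) (x (i + 2 * p + 1))) (ld (y i) (y (i + 2 * p))) := by
    intro i
    have l2 := (h (i + 2 * p)).2.2
    rw [hl, hp] at l2
    have := (h i).2.2.contract (hc.levZ i) (hr i) l2
      (Or.inl ⟨(h _).1.2.le, (h _).1.2.le⟩) (Or.inl ⟨(h _).2.1.2.le, (h _).2.1.2.le⟩)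
    rwa [lrate_levZ] at this
  have key : ∀ (i : ℤ) (n : ℕ), ld (x i) (x (i + 2 * p)) ≤ lrate c * ld (y i) (y (i + 2 * p)) ∧
      ld (y i) (y (i + 2 * p)) ≤ lrate c ^ n * Real.log 2 := by
    intro i n
    have := cross_future B hc.lrate_lt (B := Real.log 2)
      (d := fun j : ℕ => ld (x (i - n + j)) (x (i - n + j + 2 * p)))
      (e := fun j : ℕ => ld (y (i - n + j)) (y (i - n + j + 2 * p)))
      (fun _ => ld_nonneg _ _) (fun _ => ld_nonneg _ _)
      (fun j => ld_le_log_two (h _).1.1.le (h _).1.2.le (h _).1.1.le (h _).1.2.le)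
      (fun j => by
        have := hs (i - n + j)
        have e1 : i - n + ((j + 1 : ℕ) : ℤ) = i - n + j + 1 := by push_cast; ring
        have e2 : i - n + ((j + 1 : ℕ) : ℤ) + 2 * p = i - n + j + 2 * p + 1 := by push_cast; ring
        simp only [e1]
        rwa [show i - n + j + 1 + 2 * (p : ℤ) = i - n + j + 2 * p + 1 by ring])
    obtain ⟨a, b⟩ := this
    have a := a n
    have b := b n
    simp only [sub_add_cancel] at a b
    refine ⟨a, b.trans ?_⟩
    exact mul_le_mul_of_nonneg_left
      (ld_le_log_two (h _).2.1.1.le (h _).2.1.2.le (h _).2.1.1.le (h _).2.1.2.le) (by positivity)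
  intro i
  have ey : ld (y i) (y (i + 2 * p)) ≤ 0 := by
    have t := (tendsto_pow_atTop_nhds_zero_of_lt_one B hc.lrate_lt).mul_const (Real.log 2)
    rw [zero_mul] at t
    exact ge_of_tendsto' t fun n => (key i n).2
  have ex : ld (x i) (x (i + 2 * p)) ≤ 0 :=
    (key i 0).1.trans (mul_nonpos_of_nonneg_of_nonpos B ey)
  exact ⟨(eq_of_ld (h i).1.1.le (h _).1.1.le ex).symm,
    (eq_of_ld (h i).2.1.1.le (h _).2.1.1.le ey).symm⟩

/-! ### Stable and unstable manifolds -/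

/-- A full orbit of the renormalizations in the coordinates `x`, `y`, of period `2 p`. -/
structure Cycle (c : ℝ) (r : ℤ → ℕ) (p : ℕ) (x y : ℤ → ℝ) : Prop where
  bds : ∀ i, (0 < x i ∧ x i < 1) ∧ (0 < y i ∧ y i < 1)
  pos : ∀ i, 1 ≤ r i
  link : ∀ i, Link (dl (levZ c i)) (r i) (x i) (y i) (x (i + 1)) (y (i + 1))
  per : ∀ i, x (i + 2 * (p : ℤ)) = x i ∧ y (i + 2 * (p : ℤ)) = y i

theorem IsCurve.isPreconnected {L : Set (ℝ × ℝ)} (h : IsCurve L) : IsPreconnected L := by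
  obtain ⟨I, γ, h1, -, h2, -, rfl⟩ := h
  exact h1.isPreconnected.image _ h2

namespace Cycle

variable {c : ℝ} {r : ℤ → ℕ} {p : ℕ} {x y : ℤ → ℝ}

theorem orbit (h : Cycle c r p x y) (hc : Adm c) (k n : ℕ) :
    HasHeights n c (pt c (x (-2 * (k : ℤ))) (y (-2 * (k : ℤ)))) (fun i => r ((i : ℤ) - 2 * k)) ∧
      ∀ i ≤ n, orb c (pt c (x (-2 * (k : ℤ))) (y (-2 * (k : ℤ)))) i =
        pt (lev c i) (x ((i : ℤ) - 2 * k)) (y ((i : ℤ) - 2 * k)) := by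
  have := hasHeights_pt n hc (x := fun i : ℕ => x ((i : ℤ) - 2 * k))
    (y := fun i : ℕ => y ((i : ℤ) - 2 * k)) (s := fun i : ℕ => r ((i : ℤ) - 2 * k))
    (fun i _ => (h.bds _).1) (fun i _ => ⟨(h.bds _).2.1.le, (h.bds _).2.2.le⟩)
    (fun i _ => h.pos _) (fun i _ => by
      have := h.link ((i : ℤ) - 2 * k)
      rw [levZ_add] at this
      rwa [show (((i + 1 : ℕ) : ℤ) - 2 * k) = (i : ℤ) - 2 * k + 1 by push_cast; ring])
  simpa using this

theorem heights (h : Cycle c r p x y) (hc : Adm c) (n : ℕ) :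
    HasHeights n c (pt c (x 0) (y 0)) (fun i => r i) := by
  simpa using (h.orbit hc 0 n).1

theorem orb_eq (h : Cycle c r p x y) (hc : Adm c) (n : ℕ) :
    orb c (pt c (x 0) (y 0)) n = pt (lev c n) (x n) (y n) := by
  simpa using (h.orbit hc 0 n).2 n le_rfl

theorem mem_Del (h : Cycle c r p x y) (hc : Adm c) (i : ℤ) : pt c (x i) (y i) ∈ Del c :=
  pt_mem_Del hc (h.bds _).1.1 (h.bds _).1.2.le (h.bds _).2.1.le (h.bds _).2.2.le

theorem snd_ne (h : Cycle c r p x y) (hc : Adm c) (i : ℤ) : (pt c (x i) (y i)).2 ≠ 0 :=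
  pt_snd_ne hc (h.bds _).1.1 (h.bds _).2.1.le

theorem per_mul (h : Cycle c r p x y) (n : ℕ) (i : ℤ) :
    x (i + 2 * (p : ℤ) * n) = x i ∧ y (i + 2 * (p : ℤ) * n) = y i := by
  induction n with
  | zero => simp
  | succ n ih =>
    have := h.per (i + 2 * (p : ℤ) * n)
    rw [show i + 2 * (p : ℤ) * ((n + 1 : ℕ) : ℤ) = i + 2 * (p : ℤ) * n + 2 * p by push_cast; ring]
    exact ⟨this.1.trans ih.1, this.2.trans ih.2⟩

/-- Two renormalizations per iterate, and 2(p - 1)n differs from -2n by the multiple 2pn of the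
period. -/
theorem T_pow (h : Cycle c r p x y) (hc : Adm c) (hp : 1 ≤ p) (n : ℕ) :
    (T c)^[(p - 1) * n] (pt c (x 0) (y 0)) = pt c (x (-2 * (n : ℤ))) (y (-2 * (n : ℤ))) := by
  rw [T_iterate, h.orb_eq hc, lev_two_mul]
  have := h.per_mul n (-2 * (n : ℤ))
  rw [show -2 * (n : ℤ) + 2 * (p : ℤ) * n = ((2 * ((p - 1) * n) : ℕ) : ℤ) by
    push_cast [hp]; ring] at this
  rw [this.1, this.2]

theorem isPeriodic (h : Cycle c r p x y) (hc : Adm c) : IsPeriodic c p (pt c (x 0) (y 0)) := by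
  refine ⟨⟨_, h.heights hc _⟩, ?_⟩
  rw [T_iterate, h.orb_eq hc, lev_two_mul]
  have := h.per 0
  rw [zero_add] at this
  push_cast
  rw [this.1, this.2]

theorem mem_Lfuture (h : Cycle c r p x y) (hc : Adm c) : pt c (x 0) (y 0) ∈ Lfuture c r :=
  Lfuture_iff.2 ⟨h.mem_Del hc 0, h.heights hc⟩

theorem Lfuture_subset (h : Cycle c r p x y) (hc : Adm c) :
    Lfuture c r ⊆ stableSet c (pt c (x 0) (y 0)) := by
  intro q hq
  obtain ⟨h1, h2⟩ := Lfuture_iff.1 hq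
  obtain ⟨g1, g2⟩ := Lfuture_iff.1 (h.mem_Lfuture hc)
  refine ⟨h1, fun n => ⟨_, h2 n⟩, ?_⟩
  generalize pt c (x 0) (y 0) = z at *
  -- The estimates start from the first renormalization, since the point itself may have y > 1 or v
  -- = 0.
  obtain ⟨a1, a2, a3, a4, a5, a6⟩ := step_Del hc h1 (h2 1).2.1 (h2 1).2.2
  obtain ⟨b1, b2, b3, b4, b5, b6⟩ := step_Del hc g1 (g2 1).2.1 (g2 1).2.2
  have key : ∀ n : ℕ, dist (orb c q (n + 1)) (orb c z (n + 1)) ≤ 8 * (lrate (1 / c) ^ n *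
      ld (yc (1 / c) (renorm c q)) (yc (1 / c) (renorm c z))) := by
    intro n
    have d := dist_orb_le hc.inv a1 b1 a2 b2 a6 b6 (fun n => (h2 (n + 1)).2.2)
      (fun n => (g2 (n + 1)).2.2) n
    have f1 := orb_Del hc h1 (h2 (n + 1)) (n + 1) le_rfl
    have f2 := orb_Del hc g1 (g2 (n + 1)) (n + 1) le_rfl
    have e1 := orb_facts hc h1 (h2 (n + 1)) (i := n) (by omega)
    have e2 := orb_facts hc g1 (g2 (n + 1)) (i := n) (by omega)
    have := dist_le_ld (hc.lev (n + 1)) f1 f2 e1.1 e2.1 e1.2.2.2.2 e2.2.2.2.2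
    simp only [orb_succ, lev_succ] at this ⊢
    linarith
  have t := tendsto_lrate hc.inv (ld (yc (1 / c) (renorm c q)) (yc (1 / c) (renorm c z)))
  have t1 := squeeze_zero (fun _ => dist_nonneg) key t
  rw [← tendsto_add_atTop_iff_nat 1]
  have t2 : Tendsto (fun n : ℕ => 2 * n + 1) atTop atTop :=
    tendsto_atTop_mono (fun n => by simp only [id]; omega) tendsto_id
  refine (t1.comp t2).congr fun n => ?_
  simp only [Function.comp, T_iterate]
  rw [show 2 * (n + 1) = 2 * n + 1 + 1 by ring]

/-- The curve is connected and asymptotic to the cycle, so it is contained in the component. The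
component consists of infinitely renormalizable points, so all of it shares the heights of the
cycle. -/
theorem Lfuture_eq_Ws (h : Cycle c r p x y) (hc : Adm c) :
    Lfuture c r = Ws c (pt c (x 0) (y 0)) := by
  have hz := h.mem_Lfuture hc
  apply Set.Subset.antisymm
  · exact (isCurve_Lfuture hc h.pos).isPreconnected.subset_connectedComponentIn hz
      (h.Lfuture_subset hc)
  · intro q hq
    have hzC := mem_connectedComponentIn (h.Lfuture_subset hc hz)
    have hsub := connectedComponentIn_subset (stableSet c (pt c (x 0) (y 0))) (pt c (x 0) (y 0))
    refine Lfuture_iff.2 ⟨(hsub hq).1, fun n => ?_⟩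
    exact heights_const n hc.pos isPreconnected_connectedComponentIn
      (fun w hw => (hsub hw).2.1 n) hzC hq (h.heights hc n)

theorem mem_Past (h : Cycle c r p x y) (hc : Adm c) :
    pt c (x 0) (y 0) ∈ Past c (fun i => r (-1 - (i : ℤ))) := by
  refine BreakPair.mem_Past hc fun k => ⟨_, h.mem_Del hc (-2 * (k : ℤ)), ?_, ?_⟩
  · refine (h.orbit hc k (2 * k)).1.congr fun i hi => ?_
    congr 1
    omega
  · have := (h.orbit hc k (2 * k)).2 _ le_rfl
    rw [this, lev_two_mul]
    simp

theorem dual_orb (h : Cycle c r p x y) (hc : Adm c) (n : ℕ) :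
    orb (1 / c) (dual c (pt c (x 0) (y 0))) (2 * n) =
      dual c (pt c (x (-2 * (n : ℤ))) (y (-2 * (n : ℤ)))) := by
  have b := h.bds (-2 * (n : ℤ))
  have := (reverse_heights hc (h.mem_Del hc (-2 * (n : ℤ))) (h.snd_ne hc _)
    (h.orbit hc n (2 * n)).1 (by rw [xc_pt hc.pos.ne']; exact b.1.2)
    (by rw [yc_pt hc b.1.1 b.2.1.le]; exact b.2.1)
    (by rw [yc_pt hc b.1.1 b.2.1.le]; exact b.2.2)).2.1
  rw [(h.orbit hc n (2 * n)).2 _ le_rfl, lev_two_mul] at this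
  simpa using this

end Cycle

/-- The backward orbit of a point with a given past. -/
theorem past_orbit {c : ℝ} (hc : Adm c) {s : ℕ → ℕ} {q : ℝ × ℝ} (hq : q ∈ Past c s) :
    ∃ w : ℕ → ℝ × ℝ, w 0 = q ∧ (∀ n, w n ∈ Past c (fun i => s (i + 2 * n))) ∧
      (∀ n, w (n + 1) ∈ Ren 2 c ∧ T c (w (n + 1)) = w n) ∧
      ∀ n, dual c (w n) = orb (1 / c) (dual c q) (2 * n) := by
  have key : ∀ k, ∃ w ∈ Past c (fun i => s (i + 2 * k)), orb c w (2 * k) = q ∧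
      w = dual (1 / c) (orb (1 / c) (dual c q) (2 * k)) ∧
      dual c w = orb (1 / c) (dual c q) (2 * k) := by
    intro k
    obtain ⟨w, h1, h2, h3, h4⟩ := past_preimage hc hq k
    refine ⟨w, h1, h3, h4, ?_⟩
    have hs := past_spec hc h1
    have ho : ∀ i, orb (1 / c) (dual c q) i ∈ Del (lev (1 / c) i) := fun i =>
      orb_Del hc.inv (past_spec hc hq).2.2.2.2.1 ((past_spec hc hq).2.2.2.2.2.2.2.2 i) i le_rfl
    have ho := ho (2 * k)
    rw [lev_two_mul] at ho
    have hv : (orb (1 / c) (dual c q) (2 * k)).2 ≠ 0 := by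
      rcases k with _ | k
      · exact (past_spec hc hq).2.2.2.2.2.1
      · have := (orb_facts hc.inv (past_spec hc hq).2.2.2.2.1
          ((past_spec hc hq).2.2.2.2.2.2.2.2 (2 * (k + 1))) (i := 2 * k + 1) (by omega)).1
        exact this
    have hx : xc c w = yc (1 / c) (orb (1 / c) (dual c q) (2 * k)) := by
      rw [h4, dual, one_div_one_div, xc_pt hc.pos.ne']
    have := dual_dual hc.inv ho.1.1 hv (by rw [← hx]; exact hs.2.1.1)
    rw [one_div_one_div] at this
    rw [h4, this]
  choose w h1 h2 h3 h4 using key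
  refine ⟨w, by simpa [orb] using h2 0, h1, fun n => ?_, h4⟩
  obtain ⟨u, g1, g2, g3, g4⟩ := past_preimage hc (h1 n) 1
  have : u = w (n + 1) := by
    rw [g4, h3 (n + 1), h4, show 2 * (n + 1) = 2 * n + 2 * 1 by ring, orb_add _ _ (2 * n), lev_two_mul]
  rw [← this]
  exact ⟨⟨_, g2⟩, g3⟩

theorem exists_past {c : ℝ} (hc : Adm c) {q : ℝ × ℝ} {w : ℕ → ℝ × ℝ} (h0 : w 0 = q)
    (hD : ∀ n, w n ∈ Del c) (hT : ∀ n, w (n + 1) ∈ Ren 2 c ∧ T c (w (n + 1)) = w n) :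
    ∃ s, q ∈ Past c s := by
  choose t ht using fun n => (hT n).1
  let s : ℕ → ℕ := fun i => if Even i then t (i / 2) 1 else t (i / 2) 0
  refine ⟨s, mem_Past hc fun k => ⟨w k, hD k, ?_⟩⟩
  have key : orb c (w k) (2 * k) = w 0 ∧ HasHeights (2 * k) c (w k) (fun i => s (2 * k - 1 - i)) := by
    induction k with
    | zero => exact ⟨rfl, (hD 0).1⟩
    | succ k ih =>
      have e : orb c (w (k + 1)) 2 = w k := (hT k).2
      refine ⟨?_, ?_⟩
      · rw [show 2 * (k + 1) = 2 + 2 * k by ring, orb_add, e]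
        have : lev c 2 = c := lev_two_mul c 1
        rw [this, ih.1]
      · obtain ⟨a1, a2, a3, a4, a5⟩ := ht k
        have e0 : s (2 * (k + 1) - 1 - 0) = t k 0 := by
          have : 2 * (k + 1) - 1 - 0 = 2 * k + 1 := by omega
          simp only [s, this]
          rw [if_neg (by simp), show (2 * k + 1) / 2 = k by omega]
        have e1 : s (2 * (k + 1) - 1 - (0 + 1)) = t k 1 := by
          have : 2 * (k + 1) - 1 - (0 + 1) = 2 * k := by omega
          simp only [s, this]
          rw [if_pos (by simp), show (2 * k) / 2 = k by omega]
        refine ⟨a1, ?_, a3, ?_, ?_⟩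
        · rw [← e0] at a2; exact a2
        · simp only [zero_add] at a4 e1; rw [← e1] at a4; exact a4
        · have ih2 := ih.2
          rw [one_div_one_div]
          change HasHeights (2 * k) c (T c (w (k + 1))) _
          rw [(hT k).2]
          refine ih2.congr fun i hi => ?_
          congr 1
          omega
  exact ⟨key.2, h0 ▸ key.1⟩

theorem Past.isPreconnected {c : ℝ} (hc : Adm c) {s : ℕ → ℕ} (hs : ∀ i, 1 ≤ s i) :
    IsPreconnected (Past c s) := by
  obtain ⟨γ, h1, -, h2⟩ := isCurve_Past hc hs
  rw [← h2]
  exact isPreconnected_Ioo.image _ h1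

namespace Cycle

variable {c : ℝ} {r : ℤ → ℕ} {p : ℕ} {x y : ℤ → ℝ}

theorem Past_subset (h : Cycle c r p x y) (hc : Adm c) (hp : 1 ≤ p) :
    Past c (fun i => r (-1 - (i : ℤ))) ⊆ unstableSet c p (pt c (x 0) (y 0)) := by
  intro q hq
  obtain ⟨w, h0, h1, h2, h3⟩ := past_orbit hc hq
  refine ⟨w, h0, fun n => (past_spec hc (h1 n)).1, h2, ?_⟩
  have sq := past_spec hc hq
  have sz := past_spec hc (h.mem_Past hc)
  refine squeeze_zero (fun _ => dist_nonneg) (fun n => ?_)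
    ((tendsto_lrate hc.inv (ld (yc (1 / c) (dual c q)) (yc (1 / c) (dual c (pt c (x 0) (y 0)))))).comp
      (tendsto_atTop_mono (fun n => by simp only [id]; omega) tendsto_id :
        Tendsto (fun n : ℕ => 2 * n) atTop atTop))
  rw [h.T_pow hc hp]
  have d := dist_orb_le hc.inv sq.2.2.2.2.1 sz.2.2.2.2.1 sq.2.2.2.2.2.1 sz.2.2.2.2.2.1
    (by rw [sq.2.2.2.2.2.2.2.1]; exact sq.2.1.2.le) (by rw [sz.2.2.2.2.2.2.2.1]; exact sz.2.1.2.le)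
    sq.2.2.2.2.2.2.2.2 sz.2.2.2.2.2.2.2.2 (2 * n)
  have sw := past_spec hc (h1 n)
  have b := h.bds (-2 * (n : ℤ))
  rw [h.dual_orb hc, ← h3 n, lev_two_mul, sw.2.2.2.2.2.2.1, sw.2.2.2.2.2.2.2.1] at d
  have hx := xc_pt hc.pos.ne' (x (-2 * (n : ℤ))) (y (-2 * (n : ℤ)))
  have hy := yc_pt hc b.1.1 b.2.1.le
  have e1 : xc (1 / c) (dual c (pt c (x (-2 * (n : ℤ))) (y (-2 * (n : ℤ))))) =
      yc c (pt c (x (-2 * (n : ℤ))) (y (-2 * (n : ℤ)))) := xc_pt hc.inv.pos.ne' _ _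
  have e2 : yc (1 / c) (dual c (pt c (x (-2 * (n : ℤ))) (y (-2 * (n : ℤ))))) =
      xc c (pt c (x (-2 * (n : ℤ))) (y (-2 * (n : ℤ)))) :=
    yc_pt hc.inv (by rw [hy]; exact b.2.1) (by rw [hx]; exact b.1.1.le)
  rw [e1, e2] at d
  have := dist_le_ld hc sw.1 (h.mem_Del hc (-2 * (n : ℤ))) sw.2.2.2.1 (h.snd_ne hc _)
    sw.2.2.1.2.le (by rw [hy]; exact b.2.2.le)
  simp only [Function.comp]
  linarith

theorem Past_eq_Wu (h : Cycle c r p x y) (hc : Adm c) (hp : 1 ≤ p) :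
    Past c (fun i => r (-1 - (i : ℤ))) = Wu c p (pt c (x 0) (y 0)) := by
  have hz := h.mem_Past hc
  have sz := past_spec hc hz
  apply Set.Subset.antisymm
  · exact (Past.isPreconnected hc fun i => h.pos _).subset_connectedComponentIn hz
      (h.Past_subset hc hp)
  · have hzC := mem_connectedComponentIn (h.Past_subset hc hp hz)
    have hsub := connectedComponentIn_subset (unstableSet c p (pt c (x 0) (y 0)))
      (pt c (x 0) (y 0))
    have hP : ∀ w ∈ connectedComponentIn (unstableSet c p (pt c (x 0) (y 0))) (pt c (x 0) (y 0)),
        ∃ s, w ∈ Past c s := by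
      intro w hw
      obtain ⟨u, u0, u1, u2, -⟩ := hsub hw
      exact exists_past hc u0 u1 u2
    have cont : ContinuousOn (dual c)
        (connectedComponentIn (unstableSet c p (pt c (x 0) (y 0))) (pt c (x 0) (y 0))) := by
      have hy : ContinuousOn (yc c)
          (connectedComponentIn (unstableSet c p (pt c (x 0) (y 0))) (pt c (x 0) (y 0))) := by
        refine ContinuousOn.div (by fun_prop) (by fun_prop) fun w hw => ?_
        obtain ⟨s, hs⟩ := hP w hw
        have := past_spec hc hs
        exact mul_ne_zero this.1.1.1.ne' this.2.2.2.1
      have hx : ContinuousOn (xc c)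
          (connectedComponentIn (unstableSet c p (pt c (x 0) (y 0))) (pt c (x 0) (y 0))) :=
        ContinuousOn.div_const (by fun_prop) _
      refine ContinuousOn.prodMk (by fun_prop) (ContinuousOn.div (by fun_prop) (by fun_prop)
        fun w hw => ?_)
      obtain ⟨s, hs⟩ := hP w hw
      have := past_spec hc hs
      have := mul_pos this.2.2.1.1 this.2.1.1
      positivity
    intro q hq
    obtain ⟨s, hs⟩ := hP q hq
    have sq := past_spec hc hs
    have hh : ∀ n, HasHeights n (1 / c) (dual c q) (fun i => r (-1 - (i : ℤ))) := fun n =>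
      heights_const n hc.inv.pos (isPreconnected_connectedComponentIn.image _ cont)
        (by
          rintro _ ⟨w, hw, rfl⟩
          obtain ⟨s', hs'⟩ := hP w hw
          exact ⟨s', (past_spec hc hs').2.2.2.2.2.2.2.2 n⟩)
        (Set.mem_image_of_mem _ hzC) (Set.mem_image_of_mem _ hq) (sz.2.2.2.2.2.2.2.2 n)
    have : s = fun i : ℕ => r (-1 - (i : ℤ)) := by
      funext i
      have a := (hasHeights_iff.1 (hh (i + 1))).1 i (by omega)
      have b := (hasHeights_iff.1 (sq.2.2.2.2.2.2.2.2 (i + 1))).1 i (by omega)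
      exact b.unique a
    rw [← this]
    exact hs

end Cycle

/-! ### Hyperbolicity -/

/-- A plane linear map with a strict horizontal cone condition has one eigenvalue inside and one
outside of the unit circle. -/
theorem exists_eigenvalues_of_pos (A : (ℝ × ℝ) →ₗ[ℝ] (ℝ × ℝ)) (α β : (ℝ × ℝ) →ₗ[ℝ] ℝ)
    (hinj : ∀ w, α w = 0 → β w = 0 → w = 0) {κ : ℝ} (h1 : κ < 1)
    {e₁ e₂ : ℝ × ℝ} (a1 : α e₁ = 1) (b1 : β e₁ = 0) (a2 : α e₂ = 0) (b2 : β e₂ = 1)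
    (hP : 0 ≤ α (A e₁))
    (h : ∀ w, |α w| ≤ κ * max |α (A w)| |β w| ∧ |β (A w)| ≤ κ * max |α (A w)| |β w|) :
    ∃ s u : ℝ, |s| < 1 ∧ 1 < |u| ∧ Module.End.HasEigenvalue A s ∧ Module.End.HasEigenvalue A u := by
  set P := α (A e₁) with hPdef
  set Q := α (A e₂) with hQdef
  set R := β (A e₁) with hRdef
  set S := β (A e₂) with hSdef
  have coord : ∀ s t : ℝ, α (s • e₁ + t • e₂) = s ∧ β (s • e₁ + t • e₂) = t ∧
      α (A (s • e₁ + t • e₂)) = P * s + Q * t ∧ β (A (s • e₁ + t • e₂)) = R * s + S * t := by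
    intro s t
    simp only [map_add, map_smul, smul_eq_mul, a1, a2, b1, b2]
    refine ⟨by ring, by ring, by ring, by ring⟩
  have ineq : ∀ s t : ℝ, |s| ≤ κ * max |P * s + Q * t| |t| ∧
      |R * s + S * t| ≤ κ * max |P * s + Q * t| |t| := by
    intro s t
    have := h (s • e₁ + t • e₂)
    obtain ⟨c1, c2, c3, c4⟩ := coord s t
    rwa [c1, c2, c3, c4] at this
  have hP0 : 0 < P := by
    refine lt_of_le_of_ne hP fun h => ?_
    have := (ineq 1 0).1
    rw [← h] at this
    simp at this
    linarith
  have cone : ∀ τ : ℝ, |τ| = 1 → |1 - Q * τ| ≤ κ * P ∧ |R / P + (S - R * Q / P) * τ| ≤ κ := by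
    intro τ hτ
    have := ineq ((1 - Q * τ) / P) τ
    have e1 : P * ((1 - Q * τ) / P) + Q * τ = 1 := by field_simp; ring
    have e2 : R * ((1 - Q * τ) / P) + S * τ = R / P + (S - R * Q / P) * τ := by ring
    rw [e1, e2, hτ, abs_one, max_self, mul_one, abs_div, abs_of_pos hP0, div_le_iff₀ hP0] at this
    exact this
  have p1 := cone 1 abs_one
  have p2 := cone (-1) (by simp)
  obtain ⟨q1, q2⟩ := abs_le.1 p1.1
  obtain ⟨q3, q4⟩ := abs_le.1 p2.1
  obtain ⟨q5, q6⟩ := abs_le.1 p1.2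
  obtain ⟨q7, q8⟩ := abs_le.1 p2.2
  set ρ := R / P with hρ
  set e := S - R * Q / P with he
  have hS : S = e + ρ * Q := by rw [he, hρ]; ring
  have hR : R = ρ * P := by rw [hρ]; field_simp
  have hκP : κ * P < P := by nlinarith
  have b1' : |ρ| < 1 - e := by rw [abs_lt]; constructor <;> linarith
  have b2' : |ρ| < 1 + e := by rw [abs_lt]; constructor <;> linarith
  have b3' : |Q| < P - 1 := by rw [abs_lt]; constructor <;> linarith
  have hρQ : |ρ * Q| ≤ |ρ| * |Q| := (abs_mul _ _).le
  have n1 := abs_nonneg ρ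
  have n2 := abs_nonneg Q
  have m1 : |ρ| * |Q| < (1 - e) * (P - 1) := mul_lt_mul'' b1' b3' n1 n2
  have m2 : |ρ| * |Q| < (1 + e) * (P + 1) := mul_lt_mul'' b2' (by linarith) n1 n2
  obtain ⟨r1, r2⟩ := abs_le.1 hρQ
  let χ : ℝ → ℝ := fun t => t ^ 2 - (P + S) * t + (P * S - Q * R)
  have χ1 : χ 1 < 0 := by
    have : χ 1 = (1 - P) * (1 - e) - ρ * Q := by simp only [χ]; rw [hS, hR]; ring
    rw [this]; linarith
  have χ2 : 0 < χ (-1) := by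
    have : χ (-1) = (1 + P) * (1 + e) + ρ * Q := by simp only [χ]; rw [hS, hR]; ring
    rw [this]; linarith
  have cχ : ContinuousOn χ (Set.Icc (-1) 1) := by fun_prop
  obtain ⟨s, ⟨hs1, hs2⟩, hs⟩ := intermediate_value_Ioo' (by norm_num) cχ
    (show (0 : ℝ) ∈ Set.Ioo (χ 1) (χ (-1)) from ⟨χ1, χ2⟩)
  have hs' : s ^ 2 - (P + S) * s + (P * S - Q * R) = 0 := hs
  have hu : 1 < P + S - s := by
    have : χ 1 = (1 - s) * (1 - (P + S - s)) := by simp only [χ]; linear_combination hs'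
    rw [this] at χ1
    by_contra hcon
    have := mul_nonneg (show 0 ≤ 1 - s by linarith) (show 0 ≤ 1 - (P + S - s) by linarith)
    linarith
  have eig : ∀ t a b : ℝ, b ≠ 0 ∨ a ≠ 0 → P * a + Q * b = t * a → R * a + S * b = t * b →
      Module.End.HasEigenvalue A t := by
    intro t a b hab h1 h2
    obtain ⟨c1, c2, c3, c4⟩ := coord a b
    apply Module.End.hasEigenvalue_of_hasEigenvector (x := a • e₁ + b • e₂)
    refine ⟨Module.End.mem_eigenspace_iff.2 (sub_eq_zero.1 (hinj _ ?_ ?_)), fun h0 => ?_⟩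
    · rw [map_sub, map_smul, c3, c1, smul_eq_mul, h1, sub_self]
    · rw [map_sub, map_smul, c4, c2, smul_eq_mul, h2, sub_self]
    · rw [h0, map_zero] at c1 c2
      rcases hab with h | h
      · exact h c2.symm
      · exact h c1.symm
  refine ⟨s, P + S - s, abs_lt.2 ⟨hs1, hs2⟩, hu.trans_le (le_abs_self _), ?_, ?_⟩
  · exact eig s (-Q) (P - s) (Or.inl (by linarith)) (by ring) (by linear_combination hs')
  · exact eig _ (P - s) R (Or.inr (by linarith)) (by linear_combination -hs') (by ring)

theorem exists_eigenvalues (A : (ℝ × ℝ) →ₗ[ℝ] (ℝ × ℝ)) (α β : (ℝ × ℝ) →ₗ[ℝ] ℝ)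
    (hinj : ∀ w, α w = 0 → β w = 0 → w = 0) {κ : ℝ} (h1 : κ < 1)
    (h : ∀ w, |α w| ≤ κ * max |α (A w)| |β w| ∧ |β (A w)| ≤ κ * max |α (A w)| |β w|) :
    ∃ s u : ℝ, |s| < 1 ∧ 1 < |u| ∧ Module.End.HasEigenvalue A s ∧ Module.End.HasEigenvalue A u := by
  have hi : Function.Injective (α.prod β) := by
    rw [injective_iff_map_eq_zero]
    intro w hw
    exact hinj w (congrArg Prod.fst hw) (congrArg Prod.snd hw)
  have hsurj := LinearMap.injective_iff_surjective.1 hi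
  obtain ⟨e₁, he₁⟩ := hsurj (1, 0)
  obtain ⟨e₂, he₂⟩ := hsurj (0, 1)
  have a1 : α e₁ = 1 := congrArg Prod.fst he₁
  have b1 : β e₁ = 0 := congrArg Prod.snd he₁
  have a2 : α e₂ = 0 := congrArg Prod.fst he₂
  have b2 : β e₂ = 1 := congrArg Prod.snd he₂
  rcases le_total 0 (α (A e₁)) with hP | hP
  · exact exists_eigenvalues_of_pos A α β hinj h1 a1 b1 a2 b2 hP h
  · obtain ⟨s, u, hs, hu, es, eu⟩ := exists_eigenvalues_of_pos (-A) α β hinj h1 a1 b1 a2 b2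
      (by simpa using hP) (by simpa using h)
    have neg : ∀ t, Module.End.HasEigenvalue (-A) t → Module.End.HasEigenvalue A (-t) := by
      intro t ht
      obtain ⟨v, hv, hv0⟩ := ht.exists_hasEigenvector
      rw [Module.End.mem_eigenspace_iff] at hv
      refine Module.End.hasEigenvalue_of_hasEigenvector (x := v)
        ⟨Module.End.mem_eigenspace_iff.2 ?_, hv0⟩
      rw [neg_smul, ← hv]
      simp
    exact ⟨-s, -u, by rwa [abs_neg], by rwa [abs_neg], neg s es, neg u eu⟩

theorem tendsto_abs_slope {f : ℝ × ℝ → ℝ} {ℓ : (ℝ × ℝ) →L[ℝ] ℝ} {z : ℝ × ℝ}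
    (hf : HasFDerivAt f ℓ z) (w : ℝ × ℝ) :
    Tendsto (fun t : ℝ => |t|⁻¹ * |f (z + t • w) - f z|) (𝓝[≠] 0) (𝓝 |ℓ w|) := by
  have := (hf.hasLineDerivAt w).tendsto_slope_zero.abs
  refine this.congr fun t => ?_
  rw [smul_eq_mul, abs_mul, abs_inv]

theorem D_mem_nhds {c : ℝ} {q : ℝ × ℝ} (hq : q ∈ D c) (h1 : q.1 < c) : D c ∈ 𝓝 q := by
  have e1 : ∀ᶠ w in 𝓝 q, 0 < w.1 := continuousAt_const.eventually_lt continuousAt_fst hq.1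
  have e2 : ∀ᶠ w in 𝓝 q, w.1 < c := continuousAt_fst.eventually_lt continuousAt_const h1
  have e3 : ∀ᶠ w in 𝓝 q, c - 1 < w.1 + w.2 :=
    continuousAt_const.eventually_lt (continuousAt_fst.add continuousAt_snd) hq.2.2
  filter_upwards [e1, e2, e3] with w h1 h2 h3 using ⟨h1, h2.le, h3⟩

theorem eventually_heights (n : ℕ) : ∀ {c : ℝ}, 0 < c → ∀ {z : ℝ × ℝ} {s : ℕ → ℕ},
    HasHeights n c z s → (∀ i ≤ n, (orb c z i).1 < lev c i) →
      (∀ᶠ q in 𝓝 z, HasHeights n c q s) ∧ DifferentiableAt ℝ (fun q => orb c q n) z := by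
  induction n with
  | zero =>
    intro c _ z s h hl
    exact ⟨D_mem_nhds h (hl 0 le_rfl), differentiableAt_id⟩
  | succ n ih =>
    intro c hc z s h hl
    obtain ⟨h1, h2, h3⟩ := h
    have hD := D_mem_nhds h1 (hl 0 (by omega))
    have hR := h3.head
    have ev := eventually_height hc h1 h2 hR
    rw [nhdsWithin_eq_nhds.2 hD] at ev
    have hd := renorm_differentiableAt hc hD h2 hR
    obtain ⟨i1, i2⟩ := ih (by positivity) h3 fun i hi => hl (i + 1) (by omega)
    refine ⟨?_, i2.comp z hd⟩
    filter_upwards [hD, ev, hd.continuousAt.eventually i1] with q a b d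
    exact ⟨a, b.1, d⟩

theorem ld_eq (x x' : ℝ) : ld x x' = |Real.log (1 + x) - Real.log (1 + x')| := rfl

namespace Cycle

variable {c : ℝ} {r : ℤ → ℕ} {p : ℕ} {x y : ℤ → ℝ}

theorem eventually_facts (h : Cycle c r p x y) (hc : Adm c) :
    ∀ᶠ q in 𝓝 (pt c (x 0) (y 0)), q ∈ Del c ∧ q.2 ≠ 0 ∧ yc c q ≤ 1 := by
  have b := h.bds 0
  have hne := h.snd_ne hc 0
  have hD := h.mem_Del hc 0
  have e0 : D c ∈ 𝓝 (pt c (x 0) (y 0)) :=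
    D_mem_nhds hD.1 (by simp only [pt]; nlinarith [hc.pos, b.1.2])
  have hxy : 0 < x 0 * y 0 := mul_pos b.1.1 b.2.1
  have e1 : ∀ᶠ q in 𝓝 (pt c (x 0) (y 0)), 0 < q.2 / (c - 1) := by
    refine continuousAt_const.eventually_lt (continuousAt_snd.div_const _) ?_
    simp only [pt]
    have := hc.sub_ne
    rw [div_right_comm, div_self this]
    positivity
  have e2 : ∀ᶠ q in 𝓝 (pt c (x 0) (y 0)), q.2 / (c - 1) < 1 := by
    refine (continuousAt_snd.div_const _).eventually_lt continuousAt_const ?_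
    simp only [pt]
    have := hc.sub_ne
    rw [div_right_comm, div_self this, div_lt_one (by linarith)]
    linarith
  have e3 : ∀ᶠ q in 𝓝 (pt c (x 0) (y 0)), yc c q < 1 := by
    refine ContinuousAt.eventually_lt ?_ continuousAt_const ?_
    · exact ContinuousAt.div (by fun_prop) (by fun_prop) (mul_ne_zero hD.1.1.ne' hne)
    · rw [yc_pt hc b.1.1 b.2.1.le]; exact b.2.2
  filter_upwards [e0, e1, e2, e3] with q h0 h1 h2 h3
  refine ⟨(Del_iff hc).2 ⟨h0, q.2 / (c - 1), h1.le, h2.le, ?_⟩, ?_, h3.le⟩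
  · rw [mul_div_cancel₀ _ hc.sub_ne]
  · intro h4
    rw [h4, zero_div] at h1
    exact lt_irrefl _ h1

theorem isHyperbolic (h : Cycle c r p x y) (hc : Adm c) (hp : 1 ≤ p) :
    IsHyperbolic c p (pt c (x 0) (y 0)) := by
  set z := pt c (x 0) (y 0) with hz
  have b := h.bds 0
  have hne := h.snd_ne hc 0
  have hD := h.mem_Del hc 0
  have hfix : orb c z (2 * p) = z := by rw [← T_iterate]; exact (h.isPeriodic hc).2
  have hlt : ∀ i ≤ 2 * p, (orb c z i).1 < lev c i := by
    intro i _
    rw [hz, h.orb_eq hc]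
    simp only [pt]
    nlinarith [(hc.lev i).pos, (h.bds i).1.2]
  obtain ⟨ev, hd⟩ := eventually_heights (2 * p) hc.pos (h.heights hc (2 * p)) hlt
  have hA := hd.hasFDerivAt
  set A := fderiv ℝ (fun q => orb c q (2 * p)) z with hAdef
  have hT : (T c)^[p] = fun q => orb c q (2 * p) := funext fun q => T_iterate c q p
  refine ⟨A, hT ▸ hA, ?_⟩
  have hxz : xc c z = x 0 := xc_pt hc.pos.ne' _ _
  have hyz : yc c z = y 0 := yc_pt hc b.1.1 b.2.1.le
  have hdx : DifferentiableAt ℝ (fun q => Real.log (1 + xc c q)) z := by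
    refine DifferentiableAt.log ?_ (by rw [hxz]; linarith)
    simp only [xc]; fun_prop
  have hdy : DifferentiableAt ℝ (fun q => Real.log (1 + yc c q)) z := by
    refine DifferentiableAt.log ?_ (by rw [hyz]; linarith)
    simp only [yc, div_eq_mul_inv]
    refine (differentiableAt_const _).add (DifferentiableAt.mul (by fun_prop) ?_)
    exact DifferentiableAt.fun_inv (by fun_prop) (mul_ne_zero hD.1.1.ne' hne)
  have hα := hdx.hasFDerivAt
  have hβ := hdy.hasFDerivAt
  set α := fderiv ℝ (fun q => Real.log (1 + xc c q)) z
  set β := fderiv ℝ (fun q => Real.log (1 + yc c q)) z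
  have hαA : HasFDerivAt (fun q => Real.log (1 + xc c (orb c q (2 * p)))) (α.comp A) z := by
    have hα' := hα
    rw [← hfix] at hα'
    exact hα'.comp z hA
  have hβA : HasFDerivAt (fun q => Real.log (1 + yc c (orb c q (2 * p)))) (β.comp A) z := by
    have hβ' := hβ
    rw [← hfix] at hβ'
    exact hβ'.comp z hA
  have κ0 := lrate_nonneg c
  have κ1 := hc.lrate_lt
  have main : ∀ᶠ q in 𝓝 z,
      |Real.log (1 + xc c q) - Real.log (1 + xc c z)| ≤ lrate c *
        max |Real.log (1 + xc c (orb c q (2 * p))) - Real.log (1 + xc c (orb c z (2 * p)))|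
          |Real.log (1 + yc c q) - Real.log (1 + yc c z)| ∧
      |Real.log (1 + yc c (orb c q (2 * p))) - Real.log (1 + yc c (orb c z (2 * p)))| ≤ lrate c *
        max |Real.log (1 + xc c (orb c q (2 * p))) - Real.log (1 + xc c (orb c z (2 * p)))|
          |Real.log (1 + yc c q) - Real.log (1 + yc c z)| := by
    filter_upwards [ev, h.eventually_facts hc] with q hq1 hq2
    have cr := fun i (hi : i < 2 * p) => orb_cross hc hq2.1 hD hq2.2.1 hne hq2.2.2
      (by rw [yc_pt hc b.1.1 b.2.1.le]; exact b.2.2.le) hq1 (h.heights hc (2 * p)) hi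
    rw [← hz] at cr
    have c1 := cross_decay κ0 κ1 (2 * p)
      (d := fun i => ld (xc (lev c i) (orb c q i)) (xc (lev c i) (orb c z i)))
      (e := fun i => ld (yc (lev c i) (orb c q i)) (yc (lev c i) (orb c z i)))
      (fun _ => ld_nonneg _ _) (fun _ => ld_nonneg _ _) cr
    have c2 := cross_decay' κ0 κ1 (2 * p)
      (d := fun i => ld (xc (lev c i) (orb c q i)) (xc (lev c i) (orb c z i)))
      (e := fun i => ld (yc (lev c i) (orb c q i)) (yc (lev c i) (orb c z i)))
      (fun _ => ld_nonneg _ _) (fun _ => ld_nonneg _ _) cr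
    simp only [lev_two_mul, lev_zero, orb] at c1 c2
    have hpow : lrate c ^ (2 * p) ≤ lrate c := by
      simpa using pow_le_pow_of_le_one κ0 κ1.le (show 1 ≤ 2 * p by omega)
    simp only [← ld_eq]
    constructor
    · refine c1.trans ?_
      rw [mul_max_of_nonneg _ _ κ0]
      exact max_le_max (mul_le_mul_of_nonneg_right hpow (ld_nonneg _ _)) le_rfl
    · refine c2.trans ?_
      rw [mul_max_of_nonneg _ _ κ0, max_comm]
      exact max_le_max le_rfl (mul_le_mul_of_nonneg_right hpow (ld_nonneg _ _))
  refine exists_eigenvalues A α β ?_ κ1 ?_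
  · intro w h1 h2
    let Ψ : ℝ × ℝ → ℝ × ℝ := fun u => pt c (Real.exp u.1 - 1) (Real.exp u.2 - 1)
    let Φ : ℝ × ℝ → ℝ × ℝ := fun q => (Real.log (1 + xc c q), Real.log (1 + yc c q))
    have hΦ : HasFDerivAt Φ (α.prod β) z := hα.prodMk hβ
    have hΨ : DifferentiableAt ℝ Ψ (Φ z) := by
      simp only [Ψ, pt, div_eq_mul_inv]
      refine DifferentiableAt.prodMk (by fun_prop) (DifferentiableAt.mul (by fun_prop)
        (DifferentiableAt.fun_inv (by fun_prop) ?_))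
      simp only [Φ, hxz, hyz]
      rw [Real.exp_log (by linarith), Real.exp_log (by linarith)]
      have := mul_pos b.1.1 b.2.1
      have e : 1 + (1 + x 0 - 1) * (1 + y 0 - 1) = 1 + x 0 * y 0 := by ring
      rw [e]
      positivity
    have comp := hΨ.hasFDerivAt.comp z hΦ
    have hid : Ψ ∘ Φ =ᶠ[𝓝 z] id := by
      filter_upwards [h.eventually_facts hc] with q hq
      obtain ⟨x0, x1⟩ := xc_bounds hc hq.1.1
      have y0 := yc_nonneg hc hq.1
      simp only [Function.comp, Ψ, Φ, id]
      rw [Real.exp_log (by linarith), Real.exp_log (by linarith), add_sub_cancel_left,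
        add_sub_cancel_left, pt_xc_yc hc hq.1.1.1.ne' hq.2.1]
    have e := (comp.congr_of_eventuallyEq hid.symm).unique (hasFDerivAt_id z)
    have := congrArg (fun f : (ℝ × ℝ) →L[ℝ] (ℝ × ℝ) => f w) e
    simp only [ContinuousLinearMap.comp_apply, ContinuousLinearMap.prod_apply,
      ContinuousLinearMap.id_apply] at this
    rw [← this]
    have h1' : α w = 0 := h1
    have h2' : β w = 0 := h2
    rw [h1', h2']
    exact map_zero _
  · intro w
    have tα := tendsto_abs_slope hα w
    have tβ := tendsto_abs_slope hβ w
    have tαA := tendsto_abs_slope hαA w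
    have tβA := tendsto_abs_slope hβA w
    have line : Tendsto (fun t : ℝ => z + t • w) (𝓝[≠] 0) (𝓝 z) := by
      have : ContinuousAt (fun t : ℝ => z + t • w) 0 := by fun_prop
      have := this.tendsto
      simp only [zero_smul, add_zero] at this
      exact this.mono_left nhdsWithin_le_nhds
    have ev2 := line.eventually main
    constructor
    · refine le_of_tendsto_of_tendsto tα ((tαA.max tβ).const_mul (lrate c)) ?_
      filter_upwards [ev2] with t ht
      have n : 0 ≤ |t|⁻¹ := by positivity
      rw [← mul_max_of_nonneg _ _ n, mul_left_comm]
      exact mul_le_mul_of_nonneg_left ht.1 n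
    · refine le_of_tendsto_of_tendsto tβA ((tαA.max tβ).const_mul (lrate c)) ?_
      filter_upwards [ev2] with t ht
      have n : 0 ≤ |t|⁻¹ := by positivity
      rw [← mul_max_of_nonneg _ _ n, mul_left_comm]
      exact mul_le_mul_of_nonneg_left ht.2 n

end Cycle

/-! ### Continued fractions -/

/-- Denominators of the convergents of `[s₀, s₁, …]`, from index `-1`. -/
def den (s : ℕ → ℕ) : ℕ → ℕ
  | 0 => 0
  | 1 => 1
  | n + 2 => s n * den s (n + 1) + den s n

/-- Numerators of the convergents of `[s₀, s₁, …]`, from index `-1`. -/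
def num (s : ℕ → ℕ) : ℕ → ℕ
  | 0 => 1
  | 1 => 0
  | n + 2 => s n * num s (n + 1) + num s n

theorem contsAux_contFract (s : ℕ → ℕ) (n : ℕ) :
    (contFract s).contsAux n = ⟨(num s n : ℝ), (den s n : ℝ)⟩ ∧
      (contFract s).contsAux (n + 1) = ⟨(num s (n + 1) : ℝ), (den s (n + 1) : ℝ)⟩ := by
  induction n with
  | zero =>
    constructor
    · simp [GenContFract.contsAux, num, den]
    · simp [GenContFract.contsAux, num, den, contFract]
  | succ n ih =>
    refine ⟨ih.2, ?_⟩
    have hg : (contFract s).s.get? n = some ⟨1, (s n : ℝ)⟩ := rfl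
    have : (contFract s).contsAux (n + 2) = GenContFract.nextConts 1 (s n : ℝ)
        ((contFract s).contsAux n) ((contFract s).contsAux (n + 1)) := by
      rw [GenContFract.contsAux]
      simp only [hg]
    rw [this, ih.1, ih.2]
    simp [GenContFract.nextConts, GenContFract.nextNum, GenContFract.nextDen, num, den]

theorem convs_contFract (s : ℕ → ℕ) (n : ℕ) :
    (contFract s).convs n = (num s (n + 1) : ℝ) / den s (n + 1) := by
  rw [GenContFract.conv_eq_conts_a_div_conts_b, GenContFract.nth_cont_eq_succ_nth_contAux,
    (contsAux_contFract s n).2]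

theorem den_pos {s : ℕ → ℕ} (hs : ∀ i, 1 ≤ s i) (n : ℕ) : 1 ≤ den s (n + 1) := by
  induction n with
  | zero => exact le_rfl
  | succ n ih =>
    rw [den]
    have := Nat.mul_le_mul (hs n) ih
    omega

theorem le_den {s : ℕ → ℕ} (hs : ∀ i, 1 ≤ s i) (n : ℕ) : n ≤ den s (n + 1) := by
  induction n with
  | zero => exact Nat.zero_le _
  | succ n ih =>
    rw [den]
    have h1 := Nat.mul_le_mul (hs n) (le_refl (den s (n + 1)))
    rcases n with _ | n
    · have := den_pos hs 0
      omega
    · have := den_pos hs n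
      omega

theorem det_conv (s : ℕ → ℕ) (n : ℕ) :
    (num s n : ℝ) * den s (n + 1) - num s (n + 1) * den s n = (-1) ^ n := by
  induction n with
  | zero => simp [num, den]
  | succ n ih =>
    rw [num, den]
    push_cast
    rw [pow_succ]
    linear_combination -ih

theorem shift_conv (s : ℕ → ℕ) (n : ℕ) :
    (num s (n + 1) = den (fun i => s (i + 1)) n ∧
      den s (n + 1) = s 0 * den (fun i => s (i + 1)) n + num (fun i => s (i + 1)) n) ∧
    (num s (n + 2) = den (fun i => s (i + 1)) (n + 1) ∧
      den s (n + 2) = s 0 * den (fun i => s (i + 1)) (n + 1) + num (fun i => s (i + 1)) (n + 1)) := by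
  induction n with
  | zero => simp [num, den]
  | succ n ih =>
    obtain ⟨⟨h1, h2⟩, h3, h4⟩ := ih
    refine ⟨⟨h3, h4⟩, ?_, ?_⟩
    · rw [num, h3, h1, den]
    · rw [den, h4, h2, den, num]
      ring

theorem conv_nonneg (s : ℕ → ℕ) (n : ℕ) : 0 ≤ (contFract s).convs n := by
  rw [convs_contFract]; positivity

theorem conv_succ {s : ℕ → ℕ} (hs : ∀ i, 1 ≤ s i) (n : ℕ) :
    (contFract s).convs (n + 1) = 1 / (s 0 + (contFract fun i => s (i + 1)).convs n) := by
  obtain ⟨-, h1, h2⟩ := shift_conv s n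
  rw [convs_contFract, convs_contFract, h1, h2]
  have hd := den_pos (s := fun i => s (i + 1)) (fun i => hs _) n
  have hd' : (den (fun i => s (i + 1)) (n + 1) : ℝ) ≠ 0 := by positivity
  push_cast
  field_simp

theorem conv_le_one {s : ℕ → ℕ} (hs : ∀ i, 1 ≤ s i) (n : ℕ) : (contFract s).convs n ≤ 1 := by
  rcases n with _ | n
  · rw [convs_contFract]; simp [num]
  · rw [conv_succ hs]
    have h1 : (1 : ℝ) ≤ s 0 := by exact_mod_cast hs 0
    have h2 := conv_nonneg (fun i => s (i + 1)) n
    rw [div_le_one (by linarith)]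
    linarith

theorem conv_limit {s : ℕ → ℕ} (hs : ∀ i, 1 ≤ s i) {ρ : ℝ}
    (h : Tendsto (contFract s).convs atTop (𝓝 ρ)) :
    0 < ρ ∧ Tendsto (contFract fun i => s (i + 1)).convs atTop (𝓝 (1 / ρ - s 0)) := by
  have h' := (tendsto_add_atTop_iff_nat 1).2 h
  have h1 : (1 : ℝ) ≤ s 0 := by exact_mod_cast hs 0
  have hρ : 0 < ρ := by
    have : 1 / ((s 0 : ℝ) + 1) ≤ ρ := by
      refine ge_of_tendsto' h' fun n => ?_
      rw [conv_succ hs]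
      have := conv_nonneg (fun i => s (i + 1)) n
      apply one_div_le_one_div_of_le (by linarith)
      have := conv_le_one (s := fun i => s (i + 1)) (fun i => hs _) n
      linarith
    exact lt_of_lt_of_le (by positivity) this
  refine ⟨hρ, ?_⟩
  have t := (h'.inv₀ hρ.ne').sub_const (s 0 : ℝ)
  rw [one_div]
  refine t.congr fun n => ?_
  rw [conv_succ hs, one_div, inv_inv, add_sub_cancel_left]

theorem conv_limit_lt {s : ℕ → ℕ} (hs : ∀ i, 1 ≤ s i) {ρ : ℝ}
    (h : Tendsto (contFract s).convs atTop (𝓝 ρ)) : 0 < ρ ∧ ρ < 1 := by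
  obtain ⟨h1, h2⟩ := conv_limit hs h
  have h3 := (conv_limit (fun i => hs (i + 1)) h2).1
  have h4 : (1 : ℝ) ≤ s 0 := by exact_mod_cast hs 0
  refine ⟨h1, ?_⟩
  have : 1 < 1 / ρ := by linarith
  rwa [lt_div_iff₀ h1, one_mul] at this

theorem contFract_unique (n : ℕ) : ∀ {s t : ℕ → ℕ}, (∀ i, 1 ≤ s i) → (∀ i, 1 ≤ t i) → ∀ {ρ : ℝ},
    Tendsto (contFract s).convs atTop (𝓝 ρ) → Tendsto (contFract t).convs atTop (𝓝 ρ) →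
      s n = t n := by
  have zero : ∀ {s t : ℕ → ℕ}, (∀ i, 1 ≤ s i) → (∀ i, 1 ≤ t i) → ∀ {ρ : ℝ},
      Tendsto (contFract s).convs atTop (𝓝 ρ) → Tendsto (contFract t).convs atTop (𝓝 ρ) →
        s 0 = t 0 := by
    intro s t hs ht ρ h h'
    have a := conv_limit_lt (fun i => hs (i + 1)) (conv_limit hs h).2
    have b := conv_limit_lt (fun i => ht (i + 1)) (conv_limit ht h').2
    have l1 : (s 0 : ℝ) < t 0 + 1 := by linarith
    have l2 : (t 0 : ℝ) < s 0 + 1 := by linarith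
    norm_cast at l1 l2
    omega
  induction n with
  | zero => exact zero
  | succ n ih =>
    intro s t hs ht ρ h h'
    have a := (conv_limit hs h).2
    have b := (conv_limit ht h').2
    rw [← zero hs ht h h'] at b
    exact ih (fun i => hs (i + 1)) (fun i => ht (i + 1)) a b

/-- A number that lies alternately on either side of the convergents is their limit. -/
theorem tendsto_convs {s : ℕ → ℕ} (hs : ∀ i, 1 ≤ s i) {τ : ℝ}
    (h : ∀ n, 0 ≤ (-1 : ℝ) ^ n * (den s (n + 1) * τ - num s (n + 1))) :
    Tendsto (contFract s).convs atTop (𝓝 τ) := by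
  refine tendsto_iff_dist_tendsto_zero.2 ?_
  refine squeeze_zero (fun _ => dist_nonneg) (fun n => ?_)
    (tendsto_one_div_add_atTop_nhds_zero_nat (𝕜 := ℝ))
  have d1 : (0 : ℝ) < den s (n + 1) := by exact_mod_cast den_pos hs n
  have d2 : ((n : ℝ) + 1) ≤ den s (n + 2) := by exact_mod_cast le_den hs (n + 1)
  have a := h n
  have b := h (n + 1)
  have dt := det_conv s (n + 1)
  have e : (contFract s).convs n - τ = -(den s (n + 1) * τ - num s (n + 1)) / den s (n + 1) := by
    rw [convs_contFract]
    field_simp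
    ring
  have n1 : (0 : ℝ) < n + 1 := by positivity
  have abs_eq : |(den s (n + 1) * τ - num s (n + 1) : ℝ)|
      = (-1) ^ n * (den s (n + 1) * τ - num s (n + 1)) := by
    rw [← abs_of_nonneg a, abs_mul, abs_neg_one_pow, one_mul]
  rw [Real.dist_eq, e, abs_div, abs_neg, abs_eq, abs_of_pos d1, div_le_div_iff₀ d1 n1]
  have sq : ((-1 : ℝ) ^ n) * (-1) ^ n = 1 := by rw [← mul_pow]; norm_num
  rw [pow_succ] at b dt
  set ε := (-1 : ℝ) ^ n
  set x := (den s (n + 1) : ℝ) * τ - num s (n + 1) with hx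
  set y := (den s (n + 2) : ℝ) * τ - num s (n + 2) with hy
  have key : (den s (n + 1) : ℝ) * y - den s (n + 2) * x = - ε := by
    rw [hx, hy]; linear_combination dt
  have : (den s (n + 2) : ℝ) * (ε * x) = 1 - den s (n + 1) * (ε * -1 * y) := by
    linear_combination -ε * key + sq
  have h3 : ε * x * (n + 1) ≤ den s (n + 2) * (ε * x) := by
    rw [mul_comm (den s (n + 2) : ℝ)]
    exact mul_le_mul_of_nonneg_left d2 a
  have h4 := mul_nonneg d1.le b
  have h5 : (1 : ℝ) ≤ den s (n + 1) := by exact_mod_cast den_pos hs n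
  linarith

/-! ### The rotation number of an infinitely renormalizable pair -/

section Maps

variable {c : ℝ} {q : ℝ × ℝ}

theorem F_den_pos (hq : q ∈ D c) {z : ℝ} (h1 : -1 ≤ z) (h0 : z ≤ 0) : 0 < 1 - q.2 * z :=
  one_sub_mul_pos (neg_one_lt hq) h1 h0

theorem F_mono (hq : q ∈ D c) {z w : ℝ} (h1 : -1 ≤ z) (hzw : z ≤ w) (h0 : w ≤ 0) :
    F c q z ≤ F c q w := by
  obtain ⟨a0, ac, av⟩ := hq
  have hv := neg_one_lt ⟨a0, ac, av⟩
  rw [F, F, div_le_div_iff₀ (F_den_pos ⟨a0, ac, av⟩ h1 (hzw.trans h0))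
    (F_den_pos ⟨a0, ac, av⟩ (h1.trans hzw) h0)]
  have : 0 < c + q.1 * q.2 := by nlinarith
  nlinarith [mul_nonneg (sub_nonneg.2 hzw) this.le]

theorem F_zero : F c q 0 = q.1 := by simp [F]

theorem F_neg_one : F c q (-1) = (q.1 - c) / (1 + q.2) := by
  simp only [F]; congr 1 <;> ring

theorem F_neg_one_bounds (hq : q ∈ D c) : -1 ≤ F c q (-1) ∧ F c q (-1) ≤ 0 := by
  have hv := neg_one_lt hq
  rw [F_neg_one]
  obtain ⟨a0, ac, av⟩ := hq
  constructor
  · rw [le_div_iff₀ (by linarith)]; linarith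
  · exact div_nonpos_of_nonpos_of_nonneg (by linarith) (by linarith)

theorem F_neg_iff (hc : 0 < c) (hq : q ∈ D c) {z : ℝ} (h1 : -1 ≤ z) (h0 : z ≤ 0) :
    F c q z < 0 ↔ z < -q.1 / c := by
  rw [F, div_lt_iff₀ (F_den_pos hq h1 h0), lt_div_iff₀ hc, zero_mul]
  constructor <;> intro h <;> linarith

theorem G_den_pos (hc : 0 < c) (hq : q ∈ D c) {z : ℝ} (h0 : 0 ≤ z) (h1 : z ≤ q.1) :
    0 < q.1 * c + z * (1 + q.2 - c) := by
  have hv := neg_one_lt hq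
  obtain ⟨a0, ac, av⟩ := hq
  have e : q.1 * c + z * (1 + q.2 - c) = (q.1 - z) * c + z * (1 + q.2) := by ring
  rw [e]
  have p1 := mul_nonneg (sub_nonneg.2 h1) hc.le
  rcases h0.lt_or_eq with h | h
  · have := mul_pos h (show 0 < 1 + q.2 by linarith)
    linarith
  · rw [← h]
    have := mul_pos a0 hc
    linarith

theorem G_mono (hc : 0 < c) (hq : q ∈ D c) {z w : ℝ} (h0 : 0 ≤ z) (hzw : z ≤ w) (h1 : w ≤ q.1) :
    G c q z ≤ G c q w := by
  rw [G, G, div_le_div_iff₀ (G_den_pos hc hq h0 (hzw.trans h1)) (G_den_pos hc hq (h0.trans hzw) h1)]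
  obtain ⟨a0, ac, av⟩ := hq
  have : 0 < q.1 * c * (q.1 + 1 + q.2 - c) := mul_pos (mul_pos a0 hc) (by linarith)
  nlinarith [mul_nonneg (sub_nonneg.2 hzw) this.le]

theorem G_fst (hq : q ∈ D c) : G c q q.1 = F c q (-1) := by
  have hv := neg_one_lt hq
  rw [F_neg_one, G]
  have a0 := hq.1
  have h1 : 1 + q.2 ≠ 0 := by linarith
  have e : q.1 * c + q.1 * (1 + q.2 - c) = q.1 * (1 + q.2) := by ring
  rw [e, mul_div_mul_left _ _ a0.ne']

theorem G_bounds (hc : 0 < c) (hq : q ∈ D c) {z : ℝ} (h0 : 0 ≤ z) (h1 : z ≤ q.1) :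
    -1 ≤ G c q z ∧ G c q z ≤ F c q (-1) := by
  refine ⟨?_, ?_⟩
  · rw [← G_zero hc hq]; exact G_mono hc hq le_rfl h0 h1
  · rw [← G_fst hq]; exact G_mono hc hq h0 h1 le_rfl

end Maps

/-- The projection of the domain `[-1, a]` of a pair to the universal cover of its circle. -/
def proj (c : ℝ) (q : ℝ × ℝ) (u : ℝ) : ℝ := if u < 0 then u else G c q u + 1

section Proj

variable {c : ℝ} {q : ℝ × ℝ}

theorem proj_nonpos (hc : 0 < c) (hq : q ∈ D c) {u : ℝ} (hu : u ≤ 0) : proj c q u = u := by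
  rcases hu.lt_or_eq with h | h
  · exact if_pos h
  · rw [h, proj, if_neg (lt_irrefl 0), G_zero hc hq]; norm_num

theorem proj_nonneg {u : ℝ} (hu : 0 ≤ u) : proj c q u = G c q u + 1 := if_neg (not_lt.2 hu)

theorem proj_mono (hc : 0 < c) (hq : q ∈ D c) {u w : ℝ} (huw : u ≤ w) (hw : w ≤ q.1) :
    proj c q u ≤ proj c q w := by
  rcases lt_or_ge w 0 with h | h
  · rw [proj_nonpos hc hq h.le, proj_nonpos hc hq (huw.trans h.le)]; exact huw
  · rw [proj_nonneg h]
    rcases lt_or_ge u 0 with h' | h'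
    · rw [proj_nonpos hc hq h'.le]
      have := (G_bounds hc hq h hw).1
      linarith
    · rw [proj_nonneg h']
      have := G_mono hc hq h' huw hw
      linarith

theorem lift_eq (hc : 0 < c) (hq : q ∈ D c) (x : ℝ) :
    lift c q x = proj c q (F c q (Int.fract x - 1)) + (⌊x⌋ + 1) := by
  have h1 := Int.fract_nonneg x
  have h2 := Int.fract_lt_one x
  have := F_neg_iff hc hq (z := Int.fract x - 1) (by linarith) (by linarith)
  simp only [lift, proj, this]

theorem lift_add_one (c : ℝ) (q : ℝ × ℝ) (x : ℝ) : lift c q (x + 1) = lift c q x + 1 := by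
  simp only [lift, Int.fract_add_one, Int.floor_add_one]
  push_cast
  ring

theorem lift_mono (hc : 0 < c) (hq : q ∈ D c) : Monotone (lift c q) := by
  intro x y hxy
  rw [lift_eq hc hq, lift_eq hc hq]
  have bd : ∀ w : ℝ, F c q (-1) ≤ proj c q (F c q (Int.fract w - 1)) ∧
      proj c q (F c q (Int.fract w - 1)) ≤ F c q (-1) + 1 := by
    intro w
    have h1 := Int.fract_nonneg w
    have h2 := Int.fract_lt_one w
    have b1 := F_mono hq (z := -1) (w := Int.fract w - 1) le_rfl (by linarith) (by linarith)
    have b2 := F_mono hq (z := Int.fract w - 1) (w := 0) (by linarith) (by linarith) le_rfl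
    rw [F_zero] at b2
    constructor
    · have := proj_mono hc hq b1 b2
      rwa [proj_nonpos hc hq (F_neg_one_bounds hq).2] at this
    · have := proj_mono hc hq b2 le_rfl
      rwa [proj_nonneg hq.1.le, G_fst hq] at this
  rcases (Int.floor_mono hxy).lt_or_eq with h | h
  · have h' : (⌊x⌋ : ℝ) + 1 ≤ ⌊y⌋ := by exact_mod_cast h
    have := (bd x).2
    have := (bd y).1
    linarith
  · have hf : Int.fract x ≤ Int.fract y := by
      rw [Int.fract, Int.fract, h]; linarith
    have h1 := Int.fract_nonneg x
    have h2 := Int.fract_lt_one y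
    have m1 := F_mono hq (z := Int.fract x - 1) (w := Int.fract y - 1) (by linarith)
      (by linarith) (by linarith)
    have m2 := F_mono hq (z := Int.fract y - 1) (w := 0) (by linarith) (by linarith) le_rfl
    rw [F_zero] at m2
    have := proj_mono hc hq m1 m2
    rw [h]
    linarith

theorem lift_of_mem (hc : 0 < c) (hq : q ∈ D c) {t : ℝ} (h1 : -1 ≤ t) (h0 : t ≤ 0) :
    lift c q t = proj c q (F c q t) := by
  have neg : ∀ t : ℝ, -1 ≤ t → t < 0 → lift c q t = proj c q (F c q t) := by
    intro t h1 h0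
    have fl : ⌊t⌋ = -1 := by
      rw [Int.floor_eq_iff]
      push_cast
      exact ⟨h1, by linarith⟩
    rw [lift_eq hc hq, Int.fract, fl]
    push_cast
    rw [show t - -1 - 1 = t by ring]
    ring
  rcases h0.lt_or_eq with h | rfl
  · exact neg t h1 h
  · have := lift_add_one c q (-1)
    rw [neg_add_cancel] at this
    rw [this, neg (-1) le_rfl (by norm_num), proj_nonpos hc hq (F_neg_one_bounds hq).2, F_zero,
      proj_nonneg hq.1.le, G_fst hq]

end Proj

/-- The lift of the circle map as a monotone map of degree one. -/
def circleLift {c : ℝ} {q : ℝ × ℝ} (hc : 0 < c) (hq : q ∈ D c) : CircleDeg1Lift where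
  toFun := lift c q
  monotone' := lift_mono hc hq
  map_add_one' := lift_add_one c q

/-- The map `ψ` carries the two maps of a pair to words `f ^ α + β`, `f ^ γ + δ` of a lift `f`. -/
structure Semi (f : CircleDeg1Lift) (c : ℝ) (q : ℝ × ℝ) (ψ : ℝ → ℝ) (α : ℕ) (β : ℤ) (γ : ℕ)
    (δ : ℤ) (ε : ℝ) : Prop where
  fst : ∀ z, -1 ≤ z → z ≤ 0 → ψ (F c q z) = (f ^ α) (ψ z) + β
  snd : ∀ u, 0 ≤ u → u ≤ q.1 → ψ (G c q u) = (f ^ γ) (ψ u) + δ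
  zero : ψ 0 = 0
  pos : ∀ u, 0 ≤ u → u ≤ q.1 → 0 ≤ ε * ψ u
  neg : ∀ u, -1 ≤ u → u ≤ 0 → ε * ψ u ≤ 0


theorem Semi.base {c : ℝ} {q : ℝ × ℝ} (hc : 0 < c) (hq : q ∈ D c) :
    Semi (circleLift hc hq) c q (proj c q) 1 0 0 (-1) 1 where
  fst z h1 h0 := by
    rw [pow_one, proj_nonpos hc hq h0]
    push_cast
    rw [add_zero]
    exact (lift_of_mem hc hq h1 h0).symm
  snd u h0 h1 := by
    rw [pow_zero, proj_nonneg h0,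
      proj_nonpos hc hq ((G_bounds hc hq h0 h1).2.trans (F_neg_one_bounds hq).2)]
    simp
  zero := proj_nonpos hc hq le_rfl
  pos u h0 h1 := by
    rw [one_mul, proj_nonneg h0]
    have := (G_bounds hc hq h0 h1).1
    linarith
  neg u h1 h0 := by rw [one_mul, proj_nonpos hc hq h0]; exact h0

theorem Semi.step {f : CircleDeg1Lift} {c : ℝ} {q : ℝ × ℝ} {ψ : ℝ → ℝ} {α : ℕ} {β : ℤ} {γ : ℕ}
    {δ : ℤ} {ε : ℝ} (h : Semi f c q ψ α β γ δ ε) (hc : 0 < c) (hq : q ∈ D c) {k : ℕ}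
    (hk : HasHeight c q k) (hq' : renorm c q ∈ D (1 / c)) :
    Semi f (1 / c) (renorm c q) (fun x => ψ (-(q.1 * x))) (k * α + γ) (k * β + δ) α β (-ε) := by
  obtain ⟨hb, -, hr⟩ := renorm_eq hc hq hk
  have a0 := hq.1
  have ea : q.1 * (renorm c q).1 = -(F c q)^[k] (-1) := by
    rw [hr]; field_simp
  have word : ∀ u, 0 ≤ u → u ≤ q.1 → ∀ j ≤ k, -1 ≤ (F c q)^[j] (G c q u) ∧
      (F c q)^[j] (G c q u) ≤ (F c q)^[j + 1] (-1) ∧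
      ψ ((F c q)^[j] (G c q u)) = (f ^ (j * α + γ)) (ψ u) + ((j * β + δ : ℤ) : ℝ) := by
    intro u h0 h1 j
    induction j with
    | zero =>
      intro _
      refine ⟨(G_bounds hc hq h0 h1).1, (G_bounds hc hq h0 h1).2, ?_⟩
      simpa using h.snd u h0 h1
    | succ j ih =>
      intro hj
      obtain ⟨i1, i2, i3⟩ := ih (by omega)
      have hle := (hb (j + 1) hj).2
      have i0 := i2.trans hle
      rw [Function.iterate_succ_apply' (F c q) (j + 1), Function.iterate_succ_apply' (F c q) j]
      refine ⟨?_, F_mono hq i1 i2 hle, ?_⟩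
      · exact (F_neg_one_bounds hq).1.trans (F_mono hq le_rfl i1 i0)
      · have e : f ^ ((j + 1) * α + γ) = f ^ α * f ^ (j * α + γ) := by
          rw [← pow_add]; congr 1; ring
        rw [h.fst _ i1 i0, i3, CircleDeg1Lift.map_add_int, e, CircleDeg1Lift.mul_apply]
        push_cast
        ring
  have right : ∀ x, 0 ≤ x → x ≤ (BreakPair.renorm c q).1 → -1 ≤ -(q.1 * x) ∧ -(q.1 * x) ≤ 0 := by
    intro x h0 h1
    have := mul_le_mul_of_nonneg_left h1 a0.le
    have := mul_nonneg a0.le h0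
    have := (hb k le_rfl).1
    constructor <;> linarith
  have left : ∀ x, -1 ≤ x → x ≤ 0 → 0 ≤ -(q.1 * x) ∧ -(q.1 * x) ≤ q.1 := by
    intro x h1 h0
    constructor <;> nlinarith
  refine ⟨?_, ?_, ?_, ?_, ?_⟩
  · intro x h1 h0
    obtain ⟨l0, l1⟩ := left x h1 h0
    have := (word _ l0 l1 k le_rfl).2.2
    rw [F_renorm hc hq hk h1 h0, rescaledFst]
    have e : -(q.1 * (-(F c q)^[k] (G c q (-(q.1 * x))) / q.1)) = (F c q)^[k] (G c q (-(q.1 * x))) := by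
      field_simp
    rw [e, this]
  · intro x h0 h1
    obtain ⟨l0, l1⟩ := right x h0 h1
    rw [G_renorm hc hq hk hq'.1, rescaledSnd]
    have e : -(q.1 * (-F c q (-(q.1 * x)) / q.1)) = F c q (-(q.1 * x)) := by
      field_simp
    rw [e]
    exact h.fst _ l0 l1
  · simpa using h.zero
  · intro x h0 h1
    have := h.neg _ (right x h0 h1).1 (right x h0 h1).2
    linarith
  · intro x h1 h0
    have := h.pos _ (left x h1 h0).1 (left x h1 h0).2
    linarith

theorem exists_semi {c : ℝ} {q : ℝ × ℝ} (hc : 0 < c) (hq : q ∈ D c) {s : ℕ → ℕ} (n : ℕ)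
    (h : HasHeights n c q s) :
    ∃ ψ, Semi (circleLift hc hq) (lev c n) (orb c q n) ψ (den s (n + 1)) (-(num s (n + 1) : ℤ))
      (den s n) (-(num s n : ℤ)) ((-1) ^ n) := by
  induction n with
  | zero => exact ⟨_, by simpa [den, num, lev, orb] using Semi.base hc hq⟩
  | succ n ih =>
    obtain ⟨ψ, hψ⟩ := ih (h.mono (Nat.le_succ n))
    obtain ⟨h1, h2⟩ := hasHeights_iff.1 h
    have hl : 0 < lev c n := by
      rw [lev_eq]; split_ifs
      · exact hc
      · positivity
    have e : lev c (n + 1) = 1 / lev c n := by rw [lev_succ, lev_inv]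
    have hR := h2 (n + 1) le_rfl
    rw [orb_succ', e] at hR
    have := hψ.step hl (h2 n (Nat.le_succ n)) (h1 n (Nat.lt_succ_self n)) hR
    refine ⟨fun x => ψ (-((orb c q n).1 * x)), ?_⟩
    rw [orb_succ', e]
    convert this using 1
    · rfl
    · rw [num]; push_cast; ring
    · rw [pow_succ]; ring

theorem rotationNumberEq {c : ℝ} {q : ℝ × ℝ} (hc : 0 < c) {s : ℕ → ℕ}
    (h : ∀ n, HasHeights n c q s) (hs : ∀ i, 1 ≤ s i) : RotationNumberEq c q s := by
  have hq : q ∈ D c := h 0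
  set f := circleLift hc hq
  refine ⟨f.translationNumber, tendsto_convs hs fun n => ?_, fun x => ?_⟩
  · obtain ⟨ψ, hψ⟩ := exists_semi hc hq n (h n)
    have hD := (hasHeights_iff.1 (h n)).2 n le_rfl
    have e := hψ.fst 0 (by norm_num) le_rfl
    have p := hψ.pos _ hD.1.le le_rfl
    rw [F_zero, hψ.zero] at e
    rw [e] at p
    have tp : (f ^ den s (n + 1)).translationNumber = den s (n + 1) * f.translationNumber :=
      f.translationNumber_pow _
    rcases n.even_or_odd with hn | hn
    · rw [hn.neg_one_pow, one_mul] at p ⊢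
      have := (f ^ den s (n + 1)).le_translationNumber_of_add_nat_le (x := 0) (m := num s (n + 1))
        (by push_cast at p ⊢; linarith)
      rw [tp] at this
      linarith
    · rw [hn.neg_one_pow] at p ⊢
      have := (f ^ den s (n + 1)).translationNumber_le_of_le_add_nat (x := 0) (m := num s (n + 1))
        (by push_cast at p ⊢; linarith)
      rw [tp] at this
      linarith
  · have := f.tendsto_translationNumber x
    simp only [CircleDeg1Lift.coe_pow] at this
    exact this

/-! ### Uniqueness of the periodic point -/

theorem IsPeriodic.orb_eq {c : ℝ} {p : ℕ} {z : ℝ × ℝ} (h : IsPeriodic c p z) :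
    orb c z (2 * p) = z := by
  rw [← T_iterate]; exact h.2

theorem IsPeriodic.heights {c : ℝ} {p : ℕ} (hp : 1 ≤ p) {z : ℝ × ℝ} (h : IsPeriodic c p z) :
    ∃ s : ℕ → ℕ, ∀ n, HasHeights n c z s := by
  obtain ⟨t, ht⟩ := h.1
  obtain ⟨h1, h2⟩ := hasHeights_iff.1 ht
  have hmul : ∀ m, orb c z (2 * p * m) = z := by
    intro m
    induction m with
    | zero => rfl
    | succ m ih =>
      rw [Nat.mul_succ, orb_add, ih, mul_assoc, lev_two_mul, h.orb_eq]
  have hmod : ∀ i, orb c z i = orb c z (i % (2 * p)) ∧ lev c i = lev c (i % (2 * p)) := by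
    intro i
    have e := Nat.div_add_mod i (2 * p)
    constructor
    · conv_lhs => rw [← e, orb_add, hmul, mul_assoc, lev_two_mul]
    · conv_lhs => rw [← e, lev_add, mul_assoc, lev_two_mul]
  refine ⟨fun i => t (i % (2 * p)), fun n => hasHeights_iff.2 ⟨fun i _ => ?_, fun i _ => ?_⟩⟩
  · rw [(hmod i).1, (hmod i).2]
    exact h1 _ (Nat.mod_lt _ (by omega))
  · rw [(hmod i).1, (hmod i).2]
    exact h2 _ (Nat.mod_lt _ (by omega)).le

theorem renorm_snd {c : ℝ} (hc : Adm c) {q : ℝ × ℝ} (hq : q ∈ D c) {k : ℕ}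
    (hk : HasHeight c q k) (hq' : renorm c q ∈ D (1 / c)) :
    ∃ w, 0 < w ∧ w < 1 ∧ (renorm c q).2 / (1 / c - 1) = 1 - q.2 / (c - 1) * w := by
  obtain ⟨hb, -, hr⟩ := renorm_eq hc.pos hq hk
  have h1 := one_le_height hc.pos hq hk
  obtain ⟨j, rfl⟩ : ∃ j, k = j + 1 := ⟨k - 1, by omega⟩
  obtain ⟨b1, b2⟩ := hb j (by omega)
  have a0 := hq.1
  have hv := neg_one_lt hq
  have lo : -1 < (F c q)^[j + 1] (-1) := by
    rw [Function.iterate_succ_apply']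
    refine lt_of_lt_of_le ?_ (F_mono hq le_rfl b1 b2)
    rw [F_neg_one, lt_div_iff₀ (by linarith)]
    linarith [hq.2.2]
  have hi : (F c q)^[j + 1] (-1) < 0 := by
    have := hq'.1
    rw [hr] at this
    have := (div_pos_iff_of_pos_right a0).1 this
    linarith
  refine ⟨-(F c q)^[j + 1] (-1), by linarith, by linarith, ?_⟩
  rw [hr]
  have hcp := hc.pos.ne'
  have hc1 := hc.sub_ne
  have hc2 : 1 - c ≠ 0 := fun h => hc1 (by linarith)
  have e : 1 / c - 1 = (1 - c) / c := by field_simp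
  simp only [e]
  rw [div_div_div_cancel_right₀ hcp, div_eq_iff hc2]
  field_simp
  ring

theorem IsPeriodic.mem_Del {c : ℝ} (hc : Adm c) {p : ℕ} (hp : 1 ≤ p) {z : ℝ × ℝ}
    (h : IsPeriodic c p z) : z ∈ Del c := by
  obtain ⟨t, ht⟩ := h.1
  obtain ⟨h1, h2⟩ := hasHeights_iff.1 ht
  set σ : ℕ → ℝ := fun i => (orb c z i).2 / (lev c i - 1) with hσ
  have step : ∀ i < 2 * p, ∃ w, 0 < w ∧ w < 1 ∧ σ (i + 1) = 1 - σ i * w := by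
    intro i hi
    have e : lev c (i + 1) = 1 / lev c i := by rw [lev_succ, lev_inv]
    have hR := h2 (i + 1) hi
    rw [orb_succ', e] at hR
    obtain ⟨w, w0, w1, hw⟩ := renorm_snd (hc.lev i) (h2 i hi.le) (h1 i hi) hR
    refine ⟨w, w0, w1, ?_⟩
    simp only [hσ]
    rw [orb_succ', e, hw]
  have hσ0 : |σ 0 - 1 / 2| ≤ 1 / 2 := by
    by_contra! hcon
    have lt : ∀ i ≤ 2 * p, 1 ≤ i → |σ i - 1 / 2| < |σ 0 - 1 / 2| := by
      intro i
      induction i with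
      | zero => intro _ h0; omega
      | succ i ih =>
        intro hi _
        obtain ⟨w, w0, w1, hw⟩ := step i (by omega)
        have hle : |σ i - 1 / 2| ≤ |σ 0 - 1 / 2| := by
          rcases Nat.eq_zero_or_pos i with rfl | h0
          · exact le_rfl
          · exact (ih (by omega) h0).le
        have e : σ (i + 1) - 1 / 2 = -w * (σ i - 1 / 2) + (1 - w) * (1 / 2) := by rw [hw]; ring
        have b : |σ (i + 1) - 1 / 2| ≤ w * |σ i - 1 / 2| + (1 - w) * (1 / 2) := by
          rw [e]
          refine (abs_add_le _ _).trans ?_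
          rw [abs_mul, abs_neg, abs_of_pos w0, abs_of_pos (by nlinarith : 0 < (1 - w) * (1 / 2))]
        nlinarith
    have := lt (2 * p) le_rfl (by omega)
    have e : σ (2 * p) = σ 0 := by
      simp only [hσ, h.orb_eq, lev_two_mul, lev_zero]; rfl
    rw [e] at this
    exact lt_irrefl _ this
  obtain ⟨l1, l2⟩ := abs_le.1 hσ0
  refine (Del_iff hc).2 ⟨ht.head, σ 0, by linarith, by linarith, ?_⟩
  simp only [hσ, orb, lev_zero]
  rw [mul_div_cancel₀ _ hc.sub_ne]

theorem IsPeriodic.eq_of_heights {c : ℝ} (hc : Adm c) {p : ℕ} (hp : 1 ≤ p) {z z' : ℝ × ℝ}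
    (h : IsPeriodic c p z) (h' : IsPeriodic c p z') {s : ℕ → ℕ} (hs : ∀ n, HasHeights n c z s)
    (hs' : ∀ n, HasHeights n c z' s) : z = z' := by
  have hD := h.mem_Del hc hp
  have hD' := h'.mem_Del hc hp
  have f := orb_facts hc hD (hs (2 * p)) (i := 2 * p - 1) (by omega)
  have f' := orb_facts hc hD' (hs' (2 * p)) (i := 2 * p - 1) (by omega)
  rw [show 2 * p - 1 + 1 = 2 * p by omega, lev_two_mul] at f f'
  rw [h.orb_eq] at f
  rw [h'.orb_eq] at f'
  have con := future_contract hc hD hD' f.1 f'.1 f.2.2.2.2 f'.2.2.2.2 hs hs' (2 * p)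
  rw [lev_two_mul, h.orb_eq, h'.orb_eq] at con
  have κ0 := lrate_nonneg c
  have pw : lrate c ^ (2 * p) < 1 := pow_lt_one₀ κ0 hc.lrate_lt (by omega)
  have ey : ld (yc c z) (yc c z') ≤ 0 := by
    by_contra! hcon
    have := mul_lt_of_lt_one_left hcon pw
    linarith [con.2]
  exact eq_of_coords hc hD hD' f.1 f'.1
    (con.1.trans (mul_nonpos_of_nonneg_of_nonpos κ0 ey)) ey

theorem heights_of_rotationNumberEq {c : ℝ} (hc : Adm c) {p : ℕ} (hp : 1 ≤ p) {z : ℝ × ℝ}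
    (h : IsPeriodic c p z) {s : ℕ → ℕ} (hs : ∀ i, 1 ≤ s i) (hρ : RotationNumberEq c z s) (n : ℕ) :
    HasHeights n c z s := by
  obtain ⟨t, ht⟩ := h.heights hp
  have ht1 : ∀ i, 1 ≤ t i := fun i =>
    one_le_height (hc.lev i).pos ((hasHeights_iff.1 (ht i)).2 i le_rfl)
      ((hasHeights_iff.1 (ht (i + 1))).1 i (Nat.lt_succ_self i))
  obtain ⟨ρ, l1, l2⟩ := hρ
  obtain ⟨ρ', l1', l2'⟩ := rotationNumberEq hc.pos ht ht1
  have e : ρ = ρ' := tendsto_nhds_unique (l2 0) (l2' 0)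
  have : t = s := funext fun i => contFract_unique i ht1 hs l1' (e ▸ l1)
  exact this ▸ ht n

end BreakPair

end

theorem theorem3 (c : ℝ) (hc_lo : 1 / 2 < c) (hc_hi : c < 2) (hc_ne : c ≠ 1)
    (p : ℕ) (hp : 1 ≤ p) (r : ℤ → ℕ) (hr_pos : ∀ i, 1 ≤ r i)
    (hr_per : ∀ i, r (i + 2 * (p : ℤ)) = r i) :
    ∃ z : ℝ × ℝ,
      (BreakPair.IsPeriodic c p z ∧ BreakPair.RotationNumberEq c z (fun n => r (n : ℤ))) ∧
      (∀ z' : ℝ × ℝ, BreakPair.IsPeriodic c p z' →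
        BreakPair.RotationNumberEq c z' (fun n => r (n : ℤ)) → z' = z) ∧
      BreakPair.IsHyperbolic c p z ∧
      BreakPair.IsCurve (BreakPair.Lfuture c r) ∧
      BreakPair.IsCurve (BreakPair.Lpast c r) ∧
      BreakPair.Lfuture c r = BreakPair.Ws c z ∧
      BreakPair.Lpast c r = BreakPair.Wu c p z := by
  have hc : BreakPair.Adm c := ⟨hc_lo, hc_hi, hc_ne⟩
  obtain ⟨x, y, h1, h2⟩ := BreakPair.exists_cycle hc r hr_pos hr_per
  have h : BreakPair.Cycle c r p x y :=
    ⟨fun i => ⟨(h1 i).1, (h1 i).2.1⟩, hr_pos, fun i => (h1 i).2.2, h2⟩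
  have hz := h.isPeriodic hc
  refine ⟨BreakPair.pt c (x 0) (y 0),
    ⟨hz, BreakPair.rotationNumberEq hc.pos (h.heights hc) fun i => hr_pos _⟩, fun z' hz' hρ => ?_,
    h.isHyperbolic hc hp, BreakPair.isCurve_Lfuture hc hr_pos, ?_, h.Lfuture_eq_Ws hc, ?_⟩
  · exact hz'.eq_of_heights hc hp hz
      (BreakPair.heights_of_rotationNumberEq hc hp hz' (fun i => hr_pos _) hρ) (h.heights hc)
  · obtain ⟨γ, g1, g2, g3⟩ := BreakPair.isCurve_Past hc (s := fun i : ℕ => r (-1 - (i : ℤ)))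
      fun i => hr_pos _
    rw [BreakPair.Lpast_eq hc]
    exact ⟨_, γ, Set.ordConnected_Ioo, (Set.Ioo_infinite one_pos).nontrivial, g1, g2, g3⟩
  · rw [BreakPair.Lpast_eq hc]
    exact h.Past_eq_Wu hc hp
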